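/- A temporal graph $\mathcal G=(G_1,\dots,G_T)$ is a sequence of simple graphs on a common vertex set $V$ with $|V|=n$. An activity interval is a triple $(v,a,b)$ with $v\in V$ and $1\le a\le b\le T$; its length is $b-a$. A $k$-activity $\ell$-timeline is a set $\mathcal T$ of activity intervals of length at most $\ell$ that contains at most $k$ intervals for each vertex. A vertex $u$ is active in $G_i$ if some $(u,a,b)\in\mathcal T$ satisfies $a\le i\le b$, and $\mathcal T$ dominates $(v,i)$ if $v$ is active in $G_i$ or adjacent in $G_i$ to a vertex that is active in $G_i$. Timeline Dominating Set (Timeline DS) asks, given $\mathcal G$ and integers $k\ge 1$, $\ell\ge 0$, whether there is a $k$-activity $\ell$-timeline that dominates every $(v,i)\in V\times\{1,\dots,T\}$. For $1\le i\le T$ let $F_i$ be the set of vertices $v$ for which there are $p\le i\le q$ such that $v$ is non-isolated in $G_p$ and in $G_q$. For $x\ge 1$ let $\mathrm{vimw}[x](\mathcal G)$ be the size of the $x$-th largest of the bags $F_1,\dots,F_T$ (counted with multiplicity), and $0$ if $x>T$. Proposition. Timeline DS is solvable in $\big((k+1)(\ell+2)\big)^{4\cdot \mathrm{vimw}[x]}\cdot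 (n+T)^{O(1)}$ time, where $x=\ell+2$. That is, there are constants $C,c$ and a program for a word RAM (unit-cost addition, truncated subtraction, multiplication, comparison and indirect addressing) that, on every instance, given as the numbers $n,T,k,\ell$ followed by the adjacency matrices of the snapshots, halts with the correct answer after at most $t=C\cdot\big((k+1)(\ell+2)\big)^{4\cdot \mathrm{vimw}[\ell+2](\mathcal G)}\cdot (n+T+1)^{c}$ steps, and all of whose registers and memory cells always hold numbers of size at most $k+\ell+t$. -/

import Mathlib

/-! ### Temporal graphs, timelines and the vertex-interval-membership sequence -/

/-- A temporal graph with vertex set `Fin n` and lifetime `T`: a sequence of `T` simple graphs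
(snapshots) on the same vertex set. Time steps are numbered `0, …, T - 1`. -/
structure TemporalGraph (n T : ℕ) where
  /-- The snapshot at a given time step. -/
  snapshot : Fin T → SimpleGraph (Fin n)

namespace TemporalGraph

/-- `𝒯` is a `k`-activity `ℓ`-timeline: a set of activity intervals `(v, a, b)` with `a ≤ b`, each
of length `b - a` at most `ℓ`, with at most `k` activity intervals for each vertex. -/
def IsTimeline {n T : ℕ} (k ℓ : ℕ) (𝒯 : Finset (Fin n × Fin T × Fin T)) : Prop :=
  (∀ I ∈ 𝒯, I.2.1 ≤ I.2.2 ∧ (I.2.2 : ℕ) - (I.2.1 : ℕ) ≤ ℓ) ∧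
    ∀ v : Fin n, (𝒯.filter fun I => I.1 = v).card ≤ k

/-- The set of vertices that are active at time step `i` with respect to `𝒯`. -/
def activeAt {n T : ℕ} (𝒯 : Finset (Fin n × Fin T × Fin T)) (i : Fin T) : Set (Fin n) :=
  {v | ∃ a b : Fin T, (v, a, b) ∈ 𝒯 ∧ a ≤ i ∧ i ≤ b}

/-- The closed neighbourhood `N_{G_i}[S]` of a vertex set in the snapshot at time step `i`. -/
def closedNeighborhood {n T : ℕ} (G : TemporalGraph n T) (i : Fin T) (S : Set (Fin n)) :
    Set (Fin n) :=
  ⋃ s ∈ S, insert s ((G.snapshot i).neighborSet s)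

/-- `𝒯` dominates the temporal vertex `(v, i)`. -/
def Dominates {n T : ℕ} (G : TemporalGraph n T) (𝒯 : Finset (Fin n × Fin T × Fin T))
    (v : Fin n) (i : Fin T) : Prop :=
  v ∈ G.closedNeighborhood i (activeAt 𝒯 i)

/-- The question of Timeline Dominating Set: is there a `k`-activity `ℓ`-timeline which dominates
all temporal vertices? -/
def TimelineDS {n T : ℕ} (G : TemporalGraph n T) (k ℓ : ℕ) : Prop :=
  ∃ 𝒯 : Finset (Fin n × Fin T × Fin T),
    IsTimeline k ℓ 𝒯 ∧ ∀ (v : Fin n) (i : Fin T), G.Dominates 𝒯 v i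

/-- The bag `F_i` of the vertex-interval-membership sequence: the vertices that are non-isolated at
some time step `p ≤ i` and at some time step `q ≥ i`. -/
def bag {n T : ℕ} (G : TemporalGraph n T) (i : Fin T) : Set (Fin n) :=
  {v | ∃ p q : Fin T, p ≤ i ∧ i ≤ q ∧
    1 ≤ ((G.snapshot p).neighborSet v).ncard ∧ 1 ≤ ((G.snapshot q).neighborSet v).ncard}

/-- The sizes of the bags `F_1, …, F_T`, in non-increasing order. -/
noncomputable def sortedBagSizes {n T : ℕ} (G : TemporalGraph n T) : List ℕ :=
  (List.ofFn fun i : Fin T => (G.bag i).ncard).mergeSort fun a b => decide (b ≤ a)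

/-- `vimw[x]` for `x ≥ 1`: the size of the `x`-th largest bag, and `0` if there are fewer than `x`
bags. -/
noncomputable def vimw {n T : ℕ} (G : TemporalGraph n T) (x : ℕ) : ℕ :=
  G.sortedBagSizes.getD (x - 1) 0

open Classical in
/-- The input of Timeline Dominating Set as a list of words: the numbers `n`, `T`, `k`, `ℓ`, followed
by the adjacency matrices of the snapshots, row by row. -/
noncomputable def encode {n T : ℕ} (G : TemporalGraph n T) (k ℓ : ℕ) : List ℕ :=
  [n, T, k, ℓ] ++
    (List.finRange T).flatMap fun i =>
      (List.finRange n).flatMap fun u =>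
        (List.finRange n).map fun v => if (G.snapshot i).Adj u v then 1 else 0

end TemporalGraph

/-! ### Word RAM -/

namespace WordRAM

/-- Instructions of a random access machine with registers `r₀, r₁, …`, an addressable working
memory and a read-only, randomly accessible input. Registers are only addressed directly. -/
inductive Instr where
  /-- `r_d := c` -/
  | const (d c : ℕ)
  /-- `r_d := r_a` -/
  | move (d a : ℕ)
  /-- `r_d := r_a + r_b` -/
  | add (d a b : ℕ)
  /-- `r_d := max (r_a - r_b) 0` -/
  | sub (d a b : ℕ)
  /-- `r_d := r_a * r_b` -/
  | mul (d a b : ℕ)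
  /-- `r_d :=` the input word at position `r_a` (`0` behind the end of the input) -/
  | read (d a : ℕ)
  /-- `r_d := mem[r_a]` -/
  | load (d a : ℕ)
  /-- `mem[r_a] := r_b` -/
  | store (a b : ℕ)
  /-- if `r_a ≤ r_b`, continue at instruction number `l` -/
  | jumpLE (a b l : ℕ)
  /-- halt with the given answer -/
  | halt (answer : Bool)

/-- A program is a finite list of instructions, numbered from `0`. -/
abbrev Program := List Instr

/-- A configuration: program counter, registers and working memory. -/
structure Config where
  /-- program counter -/
  pc : ℕ
  /-- contents of the registers -/
  reg : ℕ → ℕ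
  /-- contents of the working memory -/
  mem : ℕ → ℕ

/-- The initial configuration: everything is zero. -/
def Config.init : Config := ⟨0, fun _ => 0, fun _ => 0⟩

/-- Write `x` into register `d` and go to the next instruction. -/
def Config.setReg (s : Config) (d x : ℕ) : Config :=
  ⟨s.pc + 1, Function.update s.reg d x, s.mem⟩

/-- Execute one instruction. -/
def Instr.exec (input : List ℕ) (s : Config) : Instr → Config
  | .const d c => s.setReg d c
  | .move d a => s.setReg d (s.reg a)
  | .add d a b => s.setReg d (s.reg a + s.reg b)
  | .sub d a b => s.setReg d (s.reg a - s.reg b)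
  | .mul d a b => s.setReg d (s.reg a * s.reg b)
  | .read d a => s.setReg d (input.getD (s.reg a) 0)
  | .load d a => s.setReg d (s.mem (s.reg a))
  | .store a b => ⟨s.pc + 1, s.reg, Function.update s.mem (s.reg a) (s.reg b)⟩
  | .jumpLE a b l => ⟨if s.reg a ≤ s.reg b then l else s.pc + 1, s.reg, s.mem⟩
  | .halt _ => s

/-- One step of the machine. A configuration whose program counter has left the program is stuck
(and never gives an answer). -/
def step (P : Program) (input : List ℕ) (s : Config) : Config :=
  match P[s.pc]? with
  | some i => i.exec input s
  | none => s

/-- The configuration after `t` steps from the initial configuration. -/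
def run (P : Program) (input : List ℕ) (t : ℕ) : Config :=
  (step P input)^[t] Config.init

/-- `P` halts on `input` with the given answer after at most `t` steps (each instruction counts as
one step), and no register and no memory cell ever holds a number larger than `W`. (Hence all
addresses are at most `W`, and words of `O(log W)` bits suffice.) -/
def HaltsWithin (P : Program) (input : List ℕ) (t W : ℕ) (answer : Bool) : Prop :=
  ∃ s ≤ t, P[(run P input s).pc]? = some (.halt answer) ∧
    ∀ r ≤ s, ∀ j : ℕ, (run P input r).reg j ≤ W ∧ (run P input r).mem j ≤ W

end WordRAM

/-! If `T ≤ k * (ℓ + 1)`, every vertex can be kept active throughout and the answer is yes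
(`timelineDS_of_le`). Otherwise no vertex can be active all the time. A vertex that is isolated at
some time step can only be dominated by itself, so each vertex has to be active outside its
lifetime, the span from its first to its last non-isolated time step. By the exchange argument
`exists_middle`, the two ends outside the lifetime may be covered greedily from time `0` and from
the last time step, with the least possible number of intervals; whatever budget remains is spent
inside the lifetime. If the lifetime has at most `ℓ + 1` steps, one spare interval covers all of it
and nothing is left to choose. Choices remain only for long-lived vertices, whose lifetime has at
least `ℓ + 2` steps (`solvable_iff_middle`).

Let `w = vimw (ℓ + 2)`. At most `ℓ + 1` bags are larger than `w`, so every long lifetime contains a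
time whose bag has size at most `w`. Lifetimes are intervals, so a long-lived vertex alive at time
`i` lies in the bag of the last such time up to `i` or in that of the first such time from `i` on.
Hence at most `2 * w` long-lived vertices are alive simultaneously (`width_le`).

A dynamic program over time records, for each of them, the number of intervals used and the
remaining length of the current one: `base = (k + 1) * (ℓ + 2)` possibilities. A joint state is a
number with one digit in this base per slot, so there are `N ≤ base ^ (2 * w)` joint states. The
instance is solvable iff the greedy ends fit the budgets and some joint state is reachable at the
last time step (`solvable_iff_reach`). Examining all pairs of consecutive joint states costs a
factor `N ^ 2`, which explains the exponent `4 * w`.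

For the machine, the algorithm is written in a language of expressions with bounded sums, which is
compiled to RAM code. Syntactic degrees bound values and costs by `p ^ a * N ^ b` (`eval_le`,
`compSpec`), where `p` is linear in `n + T`; this includes `base ≤ p` in the nontrivial case. For
all expressions used, `b ≤ 1` (`good_of_mem`), and at most `p * N` entries of each table are
computed (`main_triple`), which gives a total of `p ^ O(1) * N ^ 2`. -/

namespace WordRAM

/-! ### Expressions -/

/-- Binary arithmetic operations. -/
inductive BinOp where
  | add
  | sub
  | mul

/-- The value of a binary operation. -/
def BinOp.eval : BinOp → ℕ → ℕ → ℕ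
  | .add, a, b => a + b
  | .sub, a, b => a - b
  | .mul, a, b => a * b

/-- The instruction `r_d := r_d ∘ r_{d + 1}`. -/
def BinOp.instr (d : ℕ) : BinOp → Instr
  | .add => .add d d (d + 1)
  | .sub => .sub d d (d + 1)
  | .mul => .mul d d (d + 1)

/-- Side-effect free expressions over registers, input and memory. `sum x g a` is the sum of `a`
over all values of register `x` below the value of register `g`. -/
inductive Expr where
  | lit (c : ℕ)
  | var (j : ℕ)
  | op (o : BinOp) (a b : Expr)
  | le (a b : Expr)
  | inp (a : Expr)
  | mem (a : Expr)
  | sum (x g : ℕ) (a : Expr)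
  | bind (x : ℕ) (a b : Expr)

namespace Expr

/-- The value of an expression. -/
def eval (I : List ℕ) (μ : ℕ → ℕ) : Expr → (ℕ → ℕ) → ℕ
  | lit c, _ => c
  | var j, ρ => ρ j
  | op o a b, ρ => o.eval (a.eval I μ ρ) (b.eval I μ ρ)
  | le a b, ρ => if a.eval I μ ρ ≤ b.eval I μ ρ then 1 else 0
  | inp a, ρ => I.getD (a.eval I μ ρ) 0
  | mem a, ρ => μ (a.eval I μ ρ)
  | sum x g a, ρ => ∑ i ∈ Finset.range (ρ g), a.eval I μ (Function.update ρ x i)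
  | bind x a b, ρ => b.eval I μ (Function.update ρ x (a.eval I μ ρ))

/-- Registers from this number on are scratch space. -/
abbrev scratch : ℕ := 100

/-- All registers that are mentioned lie below the scratch space. -/
def wf : Expr → Bool
  | lit _ => true
  | var j => decide (j < scratch)
  | op _ a b => a.wf && b.wf
  | le a b => a.wf && b.wf
  | inp a => a.wf
  | mem a => a.wf
  | sum x g a => decide (x < scratch) && decide (g < scratch) && a.wf
  | bind x a b => decide (x < scratch) && a.wf && b.wf

/-- Compiled code keeps its temporaries from register `scratch` on; well-formed expressions must be
insensitive to them. -/
theorem eval_congr {I : List ℕ} {μ : ℕ → ℕ} : ∀ (e : Expr) {ρ ρ' : ℕ → ℕ}, e.wf = true →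
    (∀ j < scratch, ρ j = ρ' j) → e.eval I μ ρ = e.eval I μ ρ'
  | lit c, _, _, _, _ => rfl
  | var j, ρ, ρ', hw, h => by
      simp only [wf, decide_eq_true_eq] at hw
      exact h j hw
  | op o a b, ρ, ρ', hw, h => by
      simp only [wf, Bool.and_eq_true] at hw
      simp only [eval, eval_congr a hw.1 h, eval_congr b hw.2 h]
  | le a b, ρ, ρ', hw, h => by
      simp only [wf, Bool.and_eq_true] at hw
      simp only [eval, eval_congr a hw.1 h, eval_congr b hw.2 h]
  | inp a, ρ, ρ', hw, h => by simp only [eval, eval_congr a hw h]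
  | mem a, ρ, ρ', hw, h => by simp only [eval, eval_congr a hw h]
  | sum x g a, ρ, ρ', hw, h => by
      simp only [wf, Bool.and_eq_true, decide_eq_true_eq] at hw
      simp only [eval, h g hw.1.2]
      refine Finset.sum_congr rfl fun i _ => eval_congr a hw.2 fun j hj => ?_
      by_cases hjx : j = x
      · simp [hjx]
      · simp [hjx, h j hj]
  | bind x a b, ρ, ρ', hw, h => by
      simp only [wf, Bool.and_eq_true, decide_eq_true_eq] at hw
      simp only [eval, eval_congr a hw.1.2 h]
      refine eval_congr b hw.2 fun j hj => ?_
      by_cases hjx : j = x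
      · simp [hjx]
      · simp [hjx, h j hj]

/-- The number of instructions of the compiled expression. -/
def len : Expr → ℕ
  | lit _ => 1
  | var _ => 1
  | op _ a b => a.len + b.len + 1
  | le a b => a.len + b.len + 4
  | inp a => a.len + 1
  | mem a => a.len + 1
  | sum _ _ a => a.len + 10
  | bind _ a b => a.len + b.len + 4

/-- Code at position `p` which computes the expression into register `d`, using only registers from
`d` on as scratch space. -/
def comp : Expr → ℕ → ℕ → List Instr
  | lit c, d, _ => [.const d c]
  | var j, d, _ => [.move d j]
  | op o a b, d, p => a.comp d p ++ (b.comp (d + 1) (p + a.len) ++ [o.instr d])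
  | le a b, d, p => a.comp d p ++ (b.comp (d + 1) (p + a.len) ++
      [.jumpLE d (d + 1) (p + a.len + b.len + 3), .const d 0,
        .jumpLE d d (p + a.len + b.len + 4), .const d 1])
  | inp a, d, p => a.comp d p ++ [.read d d]
  | mem a, d, p => a.comp d p ++ [.load d d]
  | sum x g a, d, p => [.const d 0, .move (d + 1) x, .move (d + 2) g, .const x 0,
      .jumpLE (d + 2) x (p + a.len + 9)] ++ (a.comp (d + 3) (p + 5) ++
      [.add d d (d + 3), .const (d + 3) 1, .add x x (d + 3), .jumpLE d d (p + 4),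
        .move x (d + 1)])
  | bind x a b, d, p => a.comp d p ++ ([.move (d + 1) x, .move x d] ++
      (b.comp (d + 2) (p + a.len + 2) ++ [.move d (d + 2), .move x (d + 1)]))

theorem length_comp : ∀ (e : Expr) (d p : ℕ), (e.comp d p).length = e.len
  | lit _, _, _ => rfl
  | var _, _, _ => rfl
  | op _ a b, d, p => by simp [comp, len, length_comp a, length_comp b]; omega
  | le a b, d, p => by simp [comp, len, length_comp a, length_comp b]; omega
  | inp a, d, p => by simp [comp, len, length_comp a]
  | mem a, d, p => by simp [comp, len, length_comp a]
  | sum x g a, d, p => by simp [comp, len, length_comp a]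
  | bind x a b, d, p => by simp [comp, len, length_comp a, length_comp b]; omega

end Expr

/-! ### Bounds of the form `p ^ a * N ^ b` -/

/-- The bound `p ^ a * N ^ b` given by a pair of exponents. -/
def bnd (p N : ℕ) (D : ℕ × ℕ) : ℕ := p ^ D.1 * N ^ D.2

theorem bnd_mono {p N : ℕ} (hp : 2 ≤ p) (hN : 1 ≤ N) {D E : ℕ × ℕ} (h : D ≤ E) :
    bnd p N D ≤ bnd p N E :=
  Nat.mul_le_mul (Nat.pow_le_pow_right (by omega) h.1) (Nat.pow_le_pow_right hN h.2)

theorem bnd_add {p N : ℕ} (D E : ℕ × ℕ) : bnd p N (D + E) = bnd p N D * bnd p N E := by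
  simp only [bnd, Prod.fst_add, Prod.snd_add, pow_add]; ring

theorem one_le_bnd {p N : ℕ} (hp : 2 ≤ p) (hN : 1 ≤ N) (D : ℕ × ℕ) : 1 ≤ bnd p N D :=
  Nat.mul_pos (Nat.pow_pos (by omega)) (Nat.pow_pos hN)

/-- Constant factors are absorbed into the exponent of `p`, because `2 ^ c ≤ p ^ c`. -/
theorem le_bnd_shift {p N x : ℕ} (hp : 2 ≤ p) (D : ℕ × ℕ) (c : ℕ)
    (h : x ≤ 2 ^ c * bnd p N D) : x ≤ bnd p N (D + (c, 0)) := by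
  rw [bnd_add, mul_comm]
  refine h.trans (Nat.mul_le_mul_right _ ?_)
  simpa [bnd] using Nat.pow_le_pow_left hp c

namespace Expr

/-- Exponents of a bound on the value of an expression, from exponents of bounds on the
registers. -/
def vdeg : Expr → (ℕ → ℕ × ℕ) → ℕ × ℕ
  | lit c, _ => (c, 0)
  | var j, Γ => Γ j
  | op .add a b, Γ => (a.vdeg Γ ⊔ b.vdeg Γ) + (1, 0)
  | op .sub a _, Γ => a.vdeg Γ
  | op .mul a b, Γ => a.vdeg Γ + b.vdeg Γ
  | le _ _, _ => (0, 0)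
  | inp _, _ => (1, 0)
  | mem _, _ => (0, 1)
  | sum x g a, Γ => Γ g + a.vdeg (Function.update Γ x (Γ g))
  | bind x a b, Γ => b.vdeg (Function.update Γ x (a.vdeg Γ))

/-- Exponents of a bound on all intermediate values in the evaluation of an expression. -/
def mdeg : Expr → (ℕ → ℕ × ℕ) → ℕ × ℕ
  | lit c, _ => (c, 0)
  | var j, Γ => Γ j
  | op o a b, Γ => a.mdeg Γ ⊔ b.mdeg Γ ⊔ (op o a b).vdeg Γ
  | le a b, Γ => a.mdeg Γ ⊔ b.mdeg Γ
  | inp a, Γ => a.mdeg Γ ⊔ (1, 0)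
  | mem a, Γ => a.mdeg Γ ⊔ (0, 1)
  | sum x g a, Γ => Γ g ⊔ a.mdeg (Function.update Γ x (Γ g)) ⊔ (sum x g a).vdeg Γ
  | bind x a b, Γ => a.mdeg Γ ⊔ b.mdeg (Function.update Γ x (a.vdeg Γ))

/-- Exponents of a bound on the number of steps in the evaluation of an expression. -/
def cdeg : Expr → (ℕ → ℕ × ℕ) → ℕ × ℕ
  | lit _, _ => (0, 0)
  | var _, _ => (0, 0)
  | op _ a b, Γ => (a.cdeg Γ ⊔ b.cdeg Γ) + (2, 0)
  | le a b, Γ => (a.cdeg Γ ⊔ b.cdeg Γ) + (3, 0)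
  | inp a, Γ => a.cdeg Γ + (1, 0)
  | mem a, Γ => a.cdeg Γ + (1, 0)
  | sum x g a, Γ => Γ g + a.cdeg (Function.update Γ x (Γ g)) + (4, 0)
  | bind x a b, Γ => (a.cdeg Γ ⊔ b.cdeg (Function.update Γ x (a.vdeg Γ))) + (3, 0)

theorem update_le_bnd {p N : ℕ} {ρ : ℕ → ℕ} {Γ : ℕ → ℕ × ℕ}
    (hρ : ∀ j < scratch, ρ j ≤ bnd p N (Γ j)) {x i : ℕ} {D : ℕ × ℕ} (hi : i ≤ bnd p N D) :
    ∀ j < scratch, Function.update ρ x i j ≤ bnd p N (Function.update Γ x D j) := by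
  intro j hj
  by_cases hjx : j = x
  · simpa [hjx] using hi
  · simpa [hjx] using hρ j hj

/-- Soundness of `vdeg`, by structural induction. A literal is absorbed through `c ≤ 2 ^ c ≤ p ^ c`,
an input word counts as `p` and a memory word as `N`. -/
theorem eval_le {I : List ℕ} {μ : ℕ → ℕ} {p N : ℕ} (hp : 2 ≤ p) (hN : 1 ≤ N)
    (hI : ∀ j, I.getD j 0 ≤ p) (hμ : ∀ j, μ j ≤ N) :
    ∀ (e : Expr) {ρ : ℕ → ℕ} {Γ : ℕ → ℕ × ℕ}, e.wf = true →
    (∀ j < scratch, ρ j ≤ bnd p N (Γ j)) → e.eval I μ ρ ≤ bnd p N (e.vdeg Γ)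
  | lit c, ρ, Γ, _, _ => by
      simp only [eval, vdeg, bnd, pow_zero, mul_one]
      exact Nat.lt_two_pow_self.le.trans (Nat.pow_le_pow_left hp c)
  | var j, ρ, Γ, hw, h => by
      simp only [wf, decide_eq_true_eq] at hw
      exact h j hw
  | op o a b, ρ, Γ, hw, h => by
      simp only [wf, Bool.and_eq_true] at hw
      have ha := eval_le hp hN hI hμ a hw.1 h
      have hb := eval_le hp hN hI hμ b hw.2 h
      cases o
      · simp only [eval, vdeg, BinOp.eval]
        refine le_bnd_shift hp _ 1 ?_
        have h1 := ha.trans (bnd_mono hp hN (le_sup_left (b := b.vdeg Γ)))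
        have h2 := hb.trans (bnd_mono hp hN (le_sup_right (a := a.vdeg Γ)))
        omega
      · simp only [eval, vdeg, BinOp.eval]
        omega
      · simp only [eval, vdeg, BinOp.eval, bnd_add]
        exact Nat.mul_le_mul ha hb
  | le a b, ρ, Γ, hw, h => by
      simp only [eval, vdeg, bnd, pow_zero, mul_one]
      split_ifs <;> simp
  | inp a, ρ, Γ, hw, h => by simpa [eval, vdeg, bnd] using hI _
  | mem a, ρ, Γ, hw, h => by simpa [eval, vdeg, bnd] using hμ _
  | sum x g a, ρ, Γ, hw, h => by
      simp only [wf, Bool.and_eq_true, decide_eq_true_eq] at hw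
      simp only [eval, vdeg, bnd_add]
      have hg := h g hw.1.2
      refine (Finset.sum_le_card_nsmul _ _ (bnd p N (a.vdeg (Function.update Γ x (Γ g))))
        fun i hi => ?_).trans ?_
      · refine eval_le hp hN hI hμ a hw.2 (update_le_bnd h ?_)
        have := Finset.mem_range.1 hi
        omega
      · simpa using Nat.mul_le_mul_right _ hg
  | bind x a b, ρ, Γ, hw, h => by
      simp only [wf, Bool.and_eq_true, decide_eq_true_eq] at hw
      exact eval_le hp hN hI hμ b hw.2 (update_le_bnd h (eval_le hp hN hI hμ a hw.1.2 h))

end Expr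

/-! ### Bounded executions -/

/-- All registers and memory cells are at most `W`. -/
def Config.Bdd (W : ℕ) (s : Config) : Prop := ∀ j, s.reg j ≤ W ∧ s.mem j ≤ W

/-- The machine gets from `s` to `s'` in at most `b` steps, with all numbers at most `W`. -/
def Reaches (P : Program) (I : List ℕ) (W b : ℕ) (s s' : Config) : Prop :=
  ∃ m ≤ b, (step P I)^[m] s = s' ∧ ∀ r ≤ m, ((step P I)^[r] s).Bdd W

/-- The code `c` stands in the program `P` at position `p`. -/
def CodeAt (P : Program) : ℕ → List Instr → Prop
  | _, [] => True
  | p, i :: c => P[p]? = some i ∧ CodeAt P (p + 1) c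

theorem codeAt_append {P : Program} : ∀ {p : ℕ} {c d : List Instr},
    CodeAt P p (c ++ d) ↔ CodeAt P p c ∧ CodeAt P (p + c.length) d
  | p, [], d => by simp [CodeAt]
  | p, i :: c, d => by
      simp only [List.cons_append, CodeAt, codeAt_append (c := c), List.length_cons, and_assoc]
      rw [show p + 1 + c.length = p + (c.length + 1) by omega]

theorem codeAt_self (pre : List Instr) : ∀ c : List Instr, CodeAt (pre ++ c) pre.length c
  | [] => trivial
  | i :: c => by
      refine ⟨by simp, ?_⟩
      have := codeAt_self (pre ++ [i]) c
      simpa using this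

section

variable {P : Program} {I : List ℕ} {W : ℕ}

theorem Reaches.trans {b c : ℕ} {s s' s'' : Config} (h : Reaches P I W b s s')
    (h' : Reaches P I W c s' s'') : Reaches P I W (b + c) s s'' := by
  obtain ⟨m, hm, rfl, hb⟩ := h
  obtain ⟨m', hm', rfl, hb'⟩ := h'
  refine ⟨m' + m, by omega, by rw [Function.iterate_add_apply], fun r hr => ?_⟩
  by_cases hrm : r ≤ m
  · exact hb r hrm
  · have := hb' (r - m) (by omega)
    rwa [← Function.iterate_add_apply, Nat.sub_add_cancel (by omega)] at this

theorem Reaches.mono {b c : ℕ} {s s' : Config} (h : Reaches P I W b s s') (hbc : b ≤ c) :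
    Reaches P I W c s s' := by
  obtain ⟨m, hm, h⟩ := h
  exact ⟨m, hm.trans hbc, h⟩

theorem Reaches.weaken {b c q q' : ℕ} {s : Config} {ρ μ : ℕ → ℕ}
    (h : Reaches P I W b s ⟨q, ρ, μ⟩) (hbc : b ≤ c) (hq : q = q') :
    Reaches P I W c s ⟨q', ρ, μ⟩ :=
  hq ▸ h.mono hbc

theorem Reaches.bdd_right {b : ℕ} {s s' : Config} (h : Reaches P I W b s s') : s'.Bdd W := by
  obtain ⟨m, hm, rfl, hb⟩ := h
  exact hb m le_rfl

theorem Reaches.single {s : Config} {i : Instr} (hi : P[s.pc]? = some i) (hs : s.Bdd W)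
    (hs' : (i.exec I s).Bdd W) : Reaches P I W 1 s (i.exec I s) := by
  have h1 : step P I s = i.exec I s := by simp only [step, hi]
  refine ⟨1, le_rfl, h1, fun r hr => ?_⟩
  interval_cases r
  · exact hs
  · simpa [h1] using hs'

/-- Instructions which write `x` into register `d`. -/
theorem Reaches.setReg {pc : ℕ} {ρ μ : ℕ → ℕ} {i : Instr} {d x : ℕ} (hi : P[pc]? = some i)
    (hex : i.exec I ⟨pc, ρ, μ⟩ = Config.setReg ⟨pc, ρ, μ⟩ d x) (hs : Config.Bdd W ⟨pc, ρ, μ⟩)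
    (hx : x ≤ W) :
    Reaches P I W 1 ⟨pc, ρ, μ⟩ ⟨pc + 1, Function.update ρ d x, μ⟩ := by
  have := Reaches.single (I := I) (W := W) (s := ⟨pc, ρ, μ⟩) hi hs
  rw [hex] at this
  refine this fun j => ⟨?_, (hs j).2⟩
  by_cases hj : j = d
  · simpa [Config.setReg, hj] using hx
  · simpa [Config.setReg, hj] using (hs j).1

/-- The effect of a conditional jump. -/
theorem Reaches.jump {pc a b l : ℕ} {ρ μ : ℕ → ℕ} (hi : P[pc]? = some (.jumpLE a b l))
    (hs : Config.Bdd W ⟨pc, ρ, μ⟩) :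
    Reaches P I W 1 ⟨pc, ρ, μ⟩ ⟨if ρ a ≤ ρ b then l else pc + 1, ρ, μ⟩ :=
  Reaches.single (I := I) (W := W) (s := ⟨pc, ρ, μ⟩) hi hs fun j => hs j

end

end WordRAM

/-! ### Correctness and cost of compiled expressions -/

namespace WordRAM

namespace Expr

/-- The compiled expression computes its value, and changes no register below `d`. -/
def CompSpec (P : Program) (I : List ℕ) (W p N : ℕ) (e : Expr) : Prop :=
  ∀ (d pc : ℕ) (ρ μ : ℕ → ℕ) (Γ : ℕ → ℕ × ℕ), scratch ≤ d → CodeAt P pc (e.comp d pc) →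
    (∀ j < scratch, ρ j ≤ bnd p N (Γ j)) → (∀ j, μ j ≤ N) → bnd p N (e.mdeg Γ) ≤ W →
    Config.Bdd W ⟨pc, ρ, μ⟩ →
    ∃ ρ' : ℕ → ℕ, Reaches P I W (bnd p N (e.cdeg Γ)) ⟨pc, ρ, μ⟩ ⟨pc + e.len, ρ', μ⟩ ∧
      ρ' d = e.eval I μ ρ ∧ ∀ j < d, ρ' j = ρ j

variable {P : Program} {I : List ℕ} {W p N : ℕ}

theorem compSpec_op (hp : 2 ≤ p) (hN : 1 ≤ N) (hI : ∀ j, I.getD j 0 ≤ p) (o : BinOp) {a b : Expr}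
    (hw : (op o a b).wf = true)
    (ha : CompSpec P I W p N a) (hb : CompSpec P I W p N b) : CompSpec P I W p N (op o a b) := by
  intro d pc ρ μ Γ hd hc hρ hμ hW hB
  have hle := eval_le (I := I) hp hN hI hμ (op o a b) hw hρ
  simp only [wf, Bool.and_eq_true] at hw
  simp only [comp, codeAt_append, length_comp, CodeAt] at hc
  have mono := fun {D E : ℕ × ℕ} => bnd_mono (D := D) (E := E) hp hN
  simp only [mdeg] at hW
  have hW1 := (mono (le_sup_left.trans le_sup_left)).trans hW
  have hW2 := (mono (le_sup_right.trans le_sup_left)).trans hW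
  have hW3 := (mono le_sup_right).trans hW
  obtain ⟨ρ₁, h₁, e₁, f₁⟩ := ha d pc ρ μ Γ hd hc.1 hρ hμ hW1 hB
  obtain ⟨ρ₂, h₂, e₂, f₂⟩ := hb (d + 1) (pc + a.len) ρ₁ μ Γ (by omega) hc.2.1
    (fun j hj => (f₁ j (by omega)).trans_le (hρ j hj)) hμ hW2 h₁.bdd_right
  have e₂' : ρ₂ (d + 1) = b.eval I μ ρ := by
    rw [e₂]; exact eval_congr b hw.2 fun j hj => f₁ j (by omega)
  have e₁' : ρ₂ d = a.eval I μ ρ := by rw [f₂ d (by omega), e₁]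
  have h₃ : Reaches P I W 1 ⟨pc + a.len + b.len, ρ₂, μ⟩
      ⟨pc + a.len + b.len + 1, Function.update ρ₂ d ((op o a b).eval I μ ρ), μ⟩ := by
    refine Reaches.setReg hc.2.2.1 ?_ h₂.bdd_right (hle.trans hW3)
    cases o <;> simp [BinOp.instr, Instr.exec, eval, BinOp.eval, e₁', e₂']
  refine ⟨_, ((h₁.trans h₂).trans h₃).weaken ?_ (by simp only [len]; omega), by simp,
    fun j hj => ?_⟩
  · refine le_bnd_shift hp _ 2 ?_
    have k1 := mono (le_sup_left (a := a.cdeg Γ) (b := b.cdeg Γ))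
    have k2 := mono (le_sup_right (a := a.cdeg Γ) (b := b.cdeg Γ))
    have := one_le_bnd hp hN (a.cdeg Γ)
    omega
  · rw [Function.update_of_ne (by omega), f₂ j (by omega), f₁ j hj]

theorem compSpec_le (hp : 2 ≤ p) (hN : 1 ≤ N) {a b : Expr} (hw : (le a b).wf = true)
    (ha : CompSpec P I W p N a) (hb : CompSpec P I W p N b) : CompSpec P I W p N (le a b) := by
  intro d pc ρ μ Γ hd hc hρ hμ hW hB
  simp only [wf, Bool.and_eq_true] at hw
  simp only [comp, codeAt_append, length_comp, CodeAt] at hc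
  have mono := fun {D E : ℕ × ℕ} => bnd_mono (D := D) (E := E) hp hN
  have hW0 : 1 ≤ W := (one_le_bnd hp hN _).trans hW
  simp only [mdeg] at hW
  have hW1 := (mono le_sup_left).trans hW
  have hW2 := (mono le_sup_right).trans hW
  obtain ⟨ρ₁, h₁, e₁, f₁⟩ := ha d pc ρ μ Γ hd hc.1 hρ hμ hW1 hB
  obtain ⟨ρ₂, h₂, e₂, f₂⟩ := hb (d + 1) (pc + a.len) ρ₁ μ Γ (by omega) hc.2.1
    (fun j hj => (f₁ j (by omega)).trans_le (hρ j hj)) hμ hW2 h₁.bdd_right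
  have e₂' : ρ₂ (d + 1) = b.eval I μ ρ := by
    rw [e₂]; exact eval_congr b hw.2 fun j hj => f₁ j (by omega)
  have e₁' : ρ₂ d = a.eval I μ ρ := by rw [f₂ d (by omega), e₁]
  obtain ⟨-, -, i₀, i₁, i₂, i₃, -⟩ := hc
  have h₃ := Reaches.jump (I := I) i₀ h₂.bdd_right
  have fin : ∀ x, ∀ j < d, Function.update ρ₂ d x j = ρ j := fun x j hj => by
    rw [Function.update_of_ne (by omega), f₂ j (by omega), f₁ j hj]
  have cost : bnd p N (a.cdeg Γ) + bnd p N (b.cdeg Γ) + 4 ≤ bnd p N ((le a b).cdeg Γ) := by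
    refine le_bnd_shift hp _ 3 ?_
    have k1 := mono (le_sup_left (a := a.cdeg Γ) (b := b.cdeg Γ))
    have k2 := mono (le_sup_right (a := a.cdeg Γ) (b := b.cdeg Γ))
    have := one_le_bnd hp hN (a.cdeg Γ)
    omega
  rw [e₁', e₂'] at h₃
  by_cases hab : a.eval I μ ρ ≤ b.eval I μ ρ
  · rw [if_pos hab] at h₃
    have h₄ := Reaches.setReg (I := I) (ρ := ρ₂) (μ := μ) i₃ rfl h₂.bdd_right hW0
    refine ⟨_, ((h₁.trans h₂).trans (h₃.trans h₄)).weaken ?_ (by simp only [len]; omega), ?_, fin 1⟩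
    · omega
    · simp [eval, hab]
  · rw [if_neg hab] at h₃
    have h₄ := Reaches.setReg (I := I) (ρ := ρ₂) (μ := μ) i₁ rfl h₂.bdd_right (Nat.zero_le _)
    have h₅ := Reaches.jump (I := I) i₂ h₄.bdd_right
    rw [if_pos le_rfl] at h₅
    refine ⟨_, ((h₁.trans h₂).trans ((h₃.trans h₄).trans h₅)).weaken ?_
      (by simp only [len]; omega), ?_, fin 0⟩
    · omega
    · simp [eval, hab]

/-- Common to `inp` and `mem`, which both follow the code of their argument by one instruction that
overwrites register `d`. -/
theorem compSpec_unary (hp : 2 ≤ p) (hN : 1 ≤ N) {a e : Expr} (f : (ℕ → ℕ) → ℕ → ℕ) (B : ℕ × ℕ)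
    (i : ℕ → Instr) (hcomp : ∀ d pc, e.comp d pc = a.comp d pc ++ [i d]) (hlen : e.len = a.len + 1)
    (hm : ∀ Γ, e.mdeg Γ = a.mdeg Γ ⊔ B) (hcd : ∀ Γ, e.cdeg Γ = a.cdeg Γ + (1, 0))
    (heval : ∀ μ ρ, e.eval I μ ρ = f μ (a.eval I μ ρ))
    (hex : ∀ s d, (i d).exec I s = s.setReg d (f s.mem (s.reg d)))
    (hf : ∀ μ x, (∀ j, μ j ≤ N) → f μ x ≤ bnd p N B)
    (ha : CompSpec P I W p N a) : CompSpec P I W p N e := by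
  intro d pc ρ μ Γ hd hc hρ hμ hW hB
  simp only [hcomp, codeAt_append, length_comp, CodeAt] at hc
  have mono := fun {D E : ℕ × ℕ} => bnd_mono (D := D) (E := E) hp hN
  rw [hm] at hW
  obtain ⟨ρ₁, h₁, e₁, f₁⟩ := ha d pc ρ μ Γ hd hc.1 hρ hμ ((mono le_sup_left).trans hW) hB
  have h₂ := Reaches.setReg (I := I) hc.2.1 (hex _ d) h₁.bdd_right
    ((hf μ _ hμ).trans ((mono le_sup_right).trans hW))
  rw [hlen, heval, hcd]
  refine ⟨_, (h₁.trans h₂).mono ?_, by simp [e₁], fun j hj => ?_⟩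
  · refine le_bnd_shift hp _ 1 ?_
    have := one_le_bnd hp hN (a.cdeg Γ)
    omega
  · rw [Function.update_of_ne (by omega), f₁ j hj]

/-- The old content of `x` waits in register `d + 1` while `b` works from `d + 2` on, so it can be
restored at the end. -/
theorem compSpec_bind (hp : 2 ≤ p) (hN : 1 ≤ N) (hI : ∀ j, I.getD j 0 ≤ p) {x : ℕ} {a b : Expr}
    (hw : (bind x a b).wf = true)
    (ha : CompSpec P I W p N a) (hb : CompSpec P I W p N b) : CompSpec P I W p N (bind x a b) := by
  intro d pc ρ μ Γ hd hc hρ hμ hW hB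
  simp only [wf, Bool.and_eq_true, decide_eq_true_eq] at hw
  obtain ⟨⟨hx, hwa⟩, hwb⟩ := hw
  simp only [comp, codeAt_append, length_comp, CodeAt, List.length_cons, List.length_nil] at hc
  obtain ⟨ca, ⟨i₁, i₂, -⟩, cb, i₃, i₄, -⟩ := hc
  have mono := fun {D E : ℕ × ℕ} => bnd_mono (D := D) (E := E) hp hN
  simp only [mdeg] at hW
  have hW1 := (mono le_sup_left).trans hW
  have hW2 := (mono le_sup_right).trans hW
  have hva := eval_le (I := I) hp hN hI hμ a hwa hρ
  obtain ⟨ρ₁, h₁, e₁, f₁⟩ := ha d pc ρ μ Γ hd ca hρ hμ hW1 hB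
  have h₂ := Reaches.setReg (I := I) (ρ := ρ₁) (μ := μ) i₁ rfl h₁.bdd_right (h₁.bdd_right x).1
  have h₃ := Reaches.setReg (I := I) i₂ rfl h₂.bdd_right (h₂.bdd_right d).1
  set ρ₃ := Function.update (Function.update ρ₁ (d + 1) (ρ₁ x)) x
    (Function.update ρ₁ (d + 1) (ρ₁ x) d) with hρ₃
  have r₃ : ∀ j < d, ρ₃ j = Function.update ρ x (a.eval I μ ρ) j := by
    intro j hj
    by_cases hjx : j = x
    · subst hjx
      simp [hρ₃, e₁]
    · simp [hρ₃, hjx, f₁ j hj, show j ≠ d + 1 by omega]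
  have r₃' : ρ₃ (d + 1) = ρ x := by
    rw [hρ₃, Function.update_of_ne (by omega), Function.update_self, f₁ x (by omega)]
  obtain ⟨ρ₄, h₄, e₄, f₄⟩ := hb (d + 2) (pc + a.len + 2) ρ₃ μ
    (Function.update Γ x (a.vdeg Γ)) (by omega) cb
    (fun j hj => (r₃ j (by omega)).trans_le (update_le_bnd hρ hva j hj)) hμ hW2 h₃.bdd_right
  have h₅ := Reaches.setReg (I := I) (ρ := ρ₄) (μ := μ) i₃ rfl h₄.bdd_right
    (h₄.bdd_right (d + 2)).1
  have h₆ := Reaches.setReg (I := I) i₄ rfl h₅.bdd_right (h₅.bdd_right (d + 1)).1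
  refine ⟨_, (h₁.trans (h₂.trans (h₃.trans (h₄.trans (h₅.trans h₆))))).weaken ?_
    (by simp only [len]; omega), ?_, fun j hj => ?_⟩
  · simp only [cdeg]
    refine le_bnd_shift hp _ 3 ?_
    have k1 := mono (le_sup_left (a := a.cdeg Γ)
      (b := b.cdeg (Function.update Γ x (a.vdeg Γ))))
    have k2 := mono (le_sup_right (a := a.cdeg Γ)
      (b := b.cdeg (Function.update Γ x (a.vdeg Γ))))
    have := one_le_bnd hp hN (a.cdeg Γ)
    omega
  · rw [Function.update_of_ne (by omega), Function.update_self]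
    refine e₄.trans ?_
    simp only [eval]
    exact eval_congr b hwb fun j hj => r₃ j (by omega)
  · by_cases hjx : j = x
    · subst hjx
      rw [Function.update_self, ← r₃', ← f₄ (d + 1) (by omega)]
      exact Function.update_of_ne (by omega) _ _
    · rw [Function.update_of_ne hjx, Function.update_of_ne (by omega), f₄ _ (by omega), r₃ j hj,
        Function.update_of_ne hjx]

/-- Register `d` accumulates the sum, `d + 1` saves the old content of `x`, `d + 2` holds a copy of
the bound (so even `g = x` is allowed), and the summand is computed into `d + 3`. -/
theorem compSpec_sum (hp : 2 ≤ p) (hN : 1 ≤ N) (hI : ∀ j, I.getD j 0 ≤ p) {x g : ℕ} {a : Expr}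
    (hw : (sum x g a).wf = true) (ha : CompSpec P I W p N a) :
    CompSpec P I W p N (sum x g a) := by
  intro d pc ρ μ Γ hd hc hρ hμ hW hB
  have hle := eval_le (I := I) hp hN hI hμ (sum x g a) hw hρ
  simp only [wf, Bool.and_eq_true, decide_eq_true_eq] at hw
  obtain ⟨⟨hx, hg⟩, hwa⟩ := hw
  simp only [comp, codeAt_append, length_comp, CodeAt, List.length_cons, List.length_nil] at hc
  obtain ⟨⟨i₀, i₁, i₂, i₃, i₄, -⟩, ca, i₅, i₆, i₇, i₈, i₉, -⟩ := hc
  have mono := fun {D E : ℕ × ℕ} => bnd_mono (D := D) (E := E) hp hN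
  have hW0 : 1 ≤ W := (one_le_bnd hp hN _).trans hW
  simp only [mdeg] at hW
  have hWg := (mono (le_sup_left.trans le_sup_left)).trans hW
  have hWa := (mono (le_sup_right.trans le_sup_left)).trans hW
  have hWs := (mono le_sup_right).trans hW
  set Γ' := Function.update Γ x (Γ g)
  set c := bnd p N (a.cdeg Γ') with hc
  -- the state at the head of the loop before iteration `i`
  have loop : ∀ i ≤ ρ g, ∃ ρ' : ℕ → ℕ,
      Reaches P I W (4 + i * (c + 5)) ⟨pc, ρ, μ⟩ ⟨pc + 4, ρ', μ⟩ ∧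
      ρ' d = ∑ i' ∈ Finset.range i, a.eval I μ (Function.update ρ x i') ∧ ρ' (d + 1) = ρ x ∧
      ρ' (d + 2) = ρ g ∧ ∀ j < d, ρ' j = Function.update ρ x i j := by
    intro i
    induction i with
    | zero =>
      intro _
      have h₁ := Reaches.setReg (I := I) (ρ := ρ) (μ := μ) i₀ rfl hB (Nat.zero_le _)
      have h₂ := Reaches.setReg (I := I) i₁ rfl h₁.bdd_right (h₁.bdd_right x).1
      have h₃ := Reaches.setReg (I := I) i₂ rfl h₂.bdd_right (h₂.bdd_right g).1
      have h₄ := Reaches.setReg (I := I) i₃ rfl h₃.bdd_right (Nat.zero_le _)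
      refine ⟨_, (h₁.trans (h₂.trans (h₃.trans h₄))).mono (by omega), ?_, ?_, ?_, ?_⟩
      · simp [Function.update_apply, show d ≠ x by omega]
      · simp [Function.update_apply, show x ≠ d by omega, show d + 1 ≠ x by omega]
      · simp [Function.update_apply, show g ≠ d by omega, show g ≠ d + 1 by omega,
          show d + 2 ≠ x by omega]
      · intro j hj
        simp [Function.update_apply, show j ≠ d by omega, show j ≠ d + 1 by omega,
          show j ≠ d + 2 by omega]
    | succ i ih =>
      intro hi
      obtain ⟨ρ₁, h₁, s₁, sx, sg, f₁⟩ := ih (by omega)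
      have hρi : ∀ j < scratch, Function.update ρ x i j ≤ bnd p N (Γ' j) :=
        update_le_bnd hρ ((show i ≤ ρ g by omega).trans (hρ g hg))
      have h₂ := Reaches.jump (I := I) i₄ h₁.bdd_right
      have hx₁ : ρ₁ x = i := by rw [f₁ x (by omega), Function.update_self]
      rw [sg, hx₁, if_neg (by omega)] at h₂
      obtain ⟨ρ₂, h₃, e₂, f₂⟩ := ha (d + 3) (pc + 5) ρ₁ μ Γ' (by omega) ca
        (fun j hj => (f₁ j (by omega)).trans_le (hρi j hj)) hμ hWa h₂.bdd_right
      have e₂' : ρ₂ (d + 3) = a.eval I μ (Function.update ρ x i) := by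
        rw [e₂]; exact eval_congr a hwa fun j hj => f₁ j (by omega)
      have hsum : ρ₂ d + ρ₂ (d + 3) =
          ∑ i' ∈ Finset.range (i + 1), a.eval I μ (Function.update ρ x i') := by
        rw [f₂ d (by omega), e₂', s₁, Finset.sum_range_succ]
      have h₄ := Reaches.setReg (I := I) (ρ := ρ₂) (μ := μ) i₅ rfl h₃.bdd_right (by
        simp only
        rw [hsum]
        -- A partial sum is at most the full sum, whose bound is part of `mdeg`.
        refine le_trans ?_ (hle.trans hWs)
        exact Finset.sum_le_sum_of_subset (Finset.range_subset_range.2 hi))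
      have h₅ := Reaches.setReg (I := I) i₆ rfl h₄.bdd_right hW0
      have hx₂ : ρ₂ x = i := by rw [f₂ x (by omega), hx₁]
      have h₆ := Reaches.setReg (I := I) i₇ rfl h₅.bdd_right (by
        have := (hρ g hg).trans hWg
        simp [show x ≠ d by omega, show x ≠ d + 3 by omega, hx₂]
        omega)
      have h₇ := Reaches.jump (I := I) i₈ h₆.bdd_right
      rw [if_pos le_rfl] at h₇
      refine ⟨_, (h₁.trans (h₂.trans (h₃.trans (h₄.trans (h₅.trans (h₆.trans h₇)))))).mono ?_,
        ?_, ?_, ?_, ?_⟩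
      · rw [← hc]; ring_nf; omega
      · simp [Function.update_apply, show d ≠ x by omega, hsum]
      · simp [Function.update_apply, show d + 1 ≠ x by omega, f₂, sx]
      · simp [Function.update_apply, show d + 2 ≠ x by omega, f₂, sg]
      · intro j hj
        by_cases hjx : j = x
        · simp [hjx, show x ≠ d by omega, show x ≠ d + 3 by omega, hx₂]
        · simp [Function.update_apply, hjx, show j ≠ d by omega, show j ≠ d + 3 by omega,
            f₂ j (by omega), f₁ j hj]
  obtain ⟨ρ₁, h₁, s₁, sx, sg, f₁⟩ := loop (ρ g) le_rfl
  have h₂ := Reaches.jump (I := I) i₄ h₁.bdd_right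
  have hx₁ : ρ₁ x = ρ g := by rw [f₁ x (by omega), Function.update_self]
  rw [sg, hx₁, if_pos le_rfl] at h₂
  have h₃ := Reaches.setReg (I := I) (ρ := ρ₁) (μ := μ) (pc := pc + a.len + 9)
    (by rw [← i₉]; congr 1; omega) rfl h₂.bdd_right (h₂.bdd_right (d + 1)).1
  refine ⟨_, (h₁.trans (h₂.trans h₃)).weaken ?_ (by simp only [len]; omega), ?_, fun j hj => ?_⟩
  · simp only [cdeg]
    -- The total is at most `6 + B * (c + 5) ≤ 12 * B * c`, where `B ≥ 1` bounds the number of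
    -- rounds and `c ≥ 1` the cost of the summand; `2 ^ 4` leaves room.
    refine le_bnd_shift hp _ 4 ?_
    rw [bnd_add, ← hc]
    have k1 := one_le_bnd hp hN (a.cdeg Γ')
    have k2 := one_le_bnd hp hN (Γ g)
    have k3 := hρ g hg
    rw [← hc] at k1
    nlinarith [Nat.mul_le_mul_right (c + 5) k3, Nat.mul_le_mul k2 k1]
  · rw [Function.update_of_ne (by omega), s₁, eval]
  · by_cases hjx : j = x
    · subst hjx
      rw [Function.update_self]
      exact sx
    · rw [Function.update_of_ne hjx, f₁ j hj, Function.update_of_ne hjx]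

theorem compSpec (hp : 2 ≤ p) (hN : 1 ≤ N) (hI : ∀ j, I.getD j 0 ≤ p) (e : Expr)
    (hw : e.wf = true) : CompSpec P I W p N e := by
  induction e with
  | lit c =>
    intro d pc ρ μ Γ hd hc hρ hμ hW hB
    simp only [comp, CodeAt] at hc
    have hle : c ≤ bnd p N ((lit c).mdeg Γ) := by
      simpa [mdeg, bnd] using Nat.lt_two_pow_self.le.trans (Nat.pow_le_pow_left hp c)
    have h₁ := Reaches.setReg (I := I) (ρ := ρ) (μ := μ) hc.1 rfl hB (hle.trans hW)
    exact ⟨_, h₁.mono (one_le_bnd hp hN _), by simp [eval], fun j hj => by simp [hj.ne]⟩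
  | var x =>
    intro d pc ρ μ Γ hd hc hρ hμ hW hB
    simp only [comp, CodeAt] at hc
    have h₁ := Reaches.setReg (I := I) (ρ := ρ) (μ := μ) hc.1 rfl hB (hB x).1
    exact ⟨_, h₁.mono (one_le_bnd hp hN _), by simp [eval], fun j hj => by simp [hj.ne]⟩
  | op o a b iha ihb =>
    have := hw
    simp only [wf, Bool.and_eq_true] at this
    exact compSpec_op hp hN hI o hw (iha this.1) (ihb this.2)
  | le a b iha ihb =>
    have := hw
    simp only [wf, Bool.and_eq_true] at this
    exact compSpec_le hp hN hw (iha this.1) (ihb this.2)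
  | inp a ih =>
    exact compSpec_unary hp hN (fun _ x => I.getD x 0) (1, 0) (fun d => .read d d)
      (fun _ _ => rfl) rfl (fun _ => rfl) (fun _ => rfl) (fun _ _ => rfl) (fun _ _ => rfl)
      (fun _ x _ => by simpa [bnd] using hI x) (ih hw)
  | mem a ih =>
    exact compSpec_unary hp hN (fun μ x => μ x) (0, 1) (fun d => .load d d)
      (fun _ _ => rfl) rfl (fun _ => rfl) (fun _ => rfl) (fun _ _ => rfl) (fun _ _ => rfl)
      (fun μ x hμ => by simpa [bnd] using hμ x) (ih hw)
  | sum x g a ih =>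
    have := hw
    simp only [wf, Bool.and_eq_true] at this
    exact compSpec_sum hp hN hI hw (ih this.2)
  | bind x a b iha ihb =>
    have := hw
    simp only [wf, Bool.and_eq_true] at this
    exact compSpec_bind hp hN hI hw (iha this.1.2) (ihb this.2)

end Expr

end WordRAM

namespace WordRAM

/-! ### Statements -/

/-- A state predicate: prescribed contents of the registers below the scratch space, and a property
of the memory. -/
def St (r : ℕ → ℕ) (Q : (ℕ → ℕ) → Prop) (ρ μ : ℕ → ℕ) : Prop :=
  (∀ j < Expr.scratch, ρ j = r j) ∧ Q μ

/-- Started at `pc` with property `A`, the program reaches `pc'` with property `B` in at most `b`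
steps. -/
def Triple (P : Program) (I : List ℕ) (W b pc pc' : ℕ) (A B : (ℕ → ℕ) → (ℕ → ℕ) → Prop) : Prop :=
  ∀ ρ μ, A ρ μ → Config.Bdd W ⟨pc, ρ, μ⟩ →
    ∃ ρ' μ', B ρ' μ' ∧ Reaches P I W b ⟨pc, ρ, μ⟩ ⟨pc', ρ', μ'⟩

/-- Code for `r_x := e`. -/
def assignCode (x : ℕ) (e : Expr) (p : ℕ) : List Instr :=
  e.comp Expr.scratch p ++ [.move x Expr.scratch]

/-- Code for `mem[a] := e`. -/
def storeCode (a e : Expr) (p : ℕ) : List Instr :=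
  a.comp Expr.scratch p ++ (e.comp (Expr.scratch + 1) (p + a.len) ++
    [.store Expr.scratch (Expr.scratch + 1)])

/-- Code for a loop over all values of register `x` below the value of register `g`. -/
def loopCode (x g : ℕ) (body : List Instr) (p : ℕ) : List Instr :=
  [.const x 0, .jumpLE g x (p + body.length + 5)] ++ (body ++
    [.const Expr.scratch 1, .add x x Expr.scratch, .jumpLE Expr.scratch Expr.scratch (p + 1)])

section

variable {P : Program} {I : List ℕ} {W p N : ℕ}

theorem Triple.trans {b c pc pc' pc'' : ℕ} {A B C : (ℕ → ℕ) → (ℕ → ℕ) → Prop}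
    (h : Triple P I W b pc pc' A B) (h' : Triple P I W c pc' pc'' B C) :
    Triple P I W (b + c) pc pc'' A C := by
  intro ρ μ hA hB
  obtain ⟨ρ₁, μ₁, hB₁, h₁⟩ := h ρ μ hA hB
  obtain ⟨ρ₂, μ₂, hB₂, h₂⟩ := h' ρ₁ μ₁ hB₁ h₁.bdd_right
  exact ⟨ρ₂, μ₂, hB₂, h₁.trans h₂⟩

theorem Triple.weaken {b c pc pc' q' : ℕ} {A B A' B' : (ℕ → ℕ) → (ℕ → ℕ) → Prop}
    (h : Triple P I W b pc pc' A B) (hbc : b ≤ c) (hq : pc' = q') (hA : ∀ ρ μ, A' ρ μ → A ρ μ)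
    (hB : ∀ ρ μ, B ρ μ → B' ρ μ) : Triple P I W c pc q' A' B' := by
  intro ρ μ hA' hb
  obtain ⟨ρ₁, μ₁, hB₁, h₁⟩ := h ρ μ (hA _ _ hA') hb
  exact ⟨ρ₁, μ₁, hB _ _ hB₁, h₁.weaken hbc hq⟩

theorem triple_assign (hp : 2 ≤ p) (hN : 1 ≤ N) (hI : ∀ j, I.getD j 0 ≤ p) {x pc : ℕ} {e : Expr}
    (hw : e.wf = true) (hc : CodeAt P pc (assignCode x e pc)) {r : ℕ → ℕ}
    {Q : (ℕ → ℕ) → Prop} {Γ : ℕ → ℕ × ℕ} (hr : ∀ j < Expr.scratch, r j ≤ bnd p N (Γ j))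
    (hQ : ∀ μ, Q μ → ∀ j, μ j ≤ N) (hW : bnd p N (e.mdeg Γ) ≤ W) {v : ℕ}
    (hv : ∀ μ, Q μ → e.eval I μ r = v) :
    Triple P I W (bnd p N (e.cdeg Γ) + 1) pc (pc + e.len + 1) (St r Q)
      (St (Function.update r x v) Q) := by
  intro ρ μ ⟨hρ, hμ⟩ hB
  simp only [assignCode, codeAt_append, Expr.length_comp, CodeAt] at hc
  obtain ⟨ρ₁, h₁, e₁, f₁⟩ := Expr.compSpec (P := P) (W := W) hp hN hI e hw Expr.scratch pc
    ρ μ Γ le_rfl hc.1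
    (fun j hj => (hρ j hj).trans_le (hr j hj)) (hQ μ hμ) hW hB
  have h₂ := Reaches.setReg (I := I) (ρ := ρ₁) (μ := μ) hc.2.1 rfl h₁.bdd_right
    (h₁.bdd_right Expr.scratch).1
  refine ⟨_, μ, ⟨fun j hj => ?_, hμ⟩, h₁.trans h₂⟩
  by_cases hjx : j = x
  · subst hjx
    rw [Function.update_self, Function.update_self, ← hv μ hμ]
    exact e₁.trans (Expr.eval_congr e hw hρ)
  · rw [Function.update_of_ne hjx, Function.update_of_ne hjx, f₁ j hj, hρ j hj]

theorem triple_store (hp : 2 ≤ p) (hN : 1 ≤ N) (hI : ∀ j, I.getD j 0 ≤ p) {pc : ℕ} {a e : Expr}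
    (hwa : a.wf = true) (hwe : e.wf = true) (hc : CodeAt P pc (storeCode a e pc)) {r : ℕ → ℕ}
    {Q Q' : (ℕ → ℕ) → Prop} {Γ : ℕ → ℕ × ℕ} (hr : ∀ j < Expr.scratch, r j ≤ bnd p N (Γ j))
    (hQ : ∀ μ, Q μ → ∀ j, μ j ≤ N) (hWa : bnd p N (a.mdeg Γ) ≤ W) (hWe : bnd p N (e.mdeg Γ) ≤ W)
    (hQ' : ∀ μ, Q μ → Q' (Function.update μ (a.eval I μ r) (e.eval I μ r))) :
    Triple P I W (bnd p N (a.cdeg Γ) + bnd p N (e.cdeg Γ) + 1) pc (pc + a.len + e.len + 1)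
      (St r Q) (St r Q') := by
  intro ρ μ ⟨hρ, hμ⟩ hB
  simp only [storeCode, codeAt_append, Expr.length_comp, CodeAt] at hc
  obtain ⟨ρ₁, h₁, e₁, f₁⟩ := Expr.compSpec (P := P) (W := W) hp hN hI a hwa Expr.scratch pc
    ρ μ Γ le_rfl hc.1
    (fun j hj => (hρ j hj).trans_le (hr j hj)) (hQ μ hμ) hWa hB
  have r₁ : ∀ j < Expr.scratch, ρ₁ j = r j := fun j hj => (f₁ j hj).trans (hρ j hj)
  obtain ⟨ρ₂, h₂, e₂, f₂⟩ := Expr.compSpec (P := P) (W := W) hp hN hI e hwe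
    (Expr.scratch + 1) (pc + a.len) ρ₁ μ Γ
    (by omega) hc.2.1 (fun j hj => (r₁ j hj).trans_le (hr j hj)) (hQ μ hμ) hWe h₁.bdd_right
  have ea : ρ₂ Expr.scratch = a.eval I μ r := by
    rw [f₂ _ (by omega), e₁]; exact Expr.eval_congr a hwa hρ
  have ee : ρ₂ (Expr.scratch + 1) = e.eval I μ r := by
    rw [e₂]; exact Expr.eval_congr e hwe r₁
  have h₃ := Reaches.single (I := I) (W := W) (s := ⟨pc + a.len + e.len, ρ₂, μ⟩) hc.2.2.1
    h₂.bdd_right (by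
      refine fun j => ⟨(h₂.bdd_right j).1, ?_⟩
      simp only [Instr.exec, Function.update_apply]
      split_ifs
      · exact (h₂.bdd_right _).1
      · exact (h₂.bdd_right j).2)
  refine ⟨ρ₂, Function.update μ (ρ₂ Expr.scratch) (ρ₂ (Expr.scratch + 1)), ⟨fun j hj => ?_, ?_⟩,
    (h₁.trans h₂).trans h₃⟩
  · rw [f₂ j (by omega), r₁ j hj]
  · rw [ea, ee]; exact hQ' μ hμ

/-- The family `r i` describes the registers other than the counter, whose value is overlaid by
`Function.update`. The body must return with the counter unchanged; only the loop code increments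
it. -/
theorem triple_loop (hW : 1 ≤ W) {x g pc c G : ℕ} {body : List Instr}
    (hx : x < Expr.scratch) (hg : g < Expr.scratch) (hxg : g ≠ x)
    (hc : CodeAt P pc (loopCode x g body pc)) {r : ℕ → ℕ → ℕ} {Q : ℕ → (ℕ → ℕ) → Prop}
    (hG : ∀ i, r i g = G)
    (hbody : ∀ i < G, Triple P I W c (pc + 2) (pc + 2 + body.length)
      (St (Function.update (r i) x i) (Q i)) (St (Function.update (r (i + 1)) x i) (Q (i + 1)))) :
    Triple P I W (G * (c + 4) + 2) pc (pc + body.length + 5) (St (r 0) (Q 0))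
      (St (Function.update (r G) x G) (Q G)) := by
  simp only [loopCode, codeAt_append, CodeAt, List.length_cons, List.length_nil] at hc
  obtain ⟨⟨i₀, i₁, -⟩, -, i₂, i₃, i₄, -⟩ := hc
  have key : ∀ i ≤ G, Triple P I W (1 + i * (c + 4)) pc (pc + 1) (St (r 0) (Q 0))
      (St (Function.update (r i) x i) (Q i)) := by
    intro i
    induction i with
    | zero =>
      intro _ ρ μ ⟨hρ, hμ⟩ hB
      have h₁ := Reaches.setReg (I := I) (ρ := ρ) (μ := μ) i₀ rfl hB (Nat.zero_le _)
      refine ⟨_, μ, ⟨fun j hj => ?_, hμ⟩, h₁.mono (by omega)⟩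
      by_cases hjx : j = x
      · simp [hjx]
      · simp [hjx, hρ j hj]
    | succ i ih =>
      intro hi
      refine ((ih (by omega)).trans (c := c + 4) ?_).weaken (by ring_nf; omega) rfl
        (fun _ _ h => h) (fun _ _ h => h)
      intro ρ μ hA hB
      have h₁ := Reaches.jump (I := I) i₁ hB
      rw [hA.1 g hg, hA.1 x hx, Function.update_of_ne hxg, hG, Function.update_self,
        if_neg (by omega)] at h₁
      obtain ⟨ρ₁, μ₁, ⟨hρ₁, hμ₁⟩, h₂⟩ := hbody i (by omega) ρ μ hA h₁.bdd_right
      have h₃ := Reaches.setReg (I := I) (ρ := ρ₁) (μ := μ₁) i₂ rfl h₂.bdd_right hW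
      have hxi : ρ₁ x = i := by rw [hρ₁ x hx, Function.update_self]
      have hgG : ρ₁ g = G := by rw [hρ₁ g hg, Function.update_of_ne hxg, hG]
      have h₄ := Reaches.setReg (I := I) i₃ rfl h₃.bdd_right (by
        have := (h₂.bdd_right g).1
        simp only at this
        simp [hx.ne, hxi]
        omega)
      have h₅ := Reaches.jump (I := I) i₄ h₄.bdd_right
      rw [if_pos le_rfl] at h₅
      refine ⟨_, μ₁, ⟨fun j hj => ?_, hμ₁⟩,
        (h₁.trans (h₂.trans (h₃.trans (h₄.trans h₅)))).mono (by omega)⟩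
      by_cases hjx : j = x
      · simp [hjx, hx.ne, hxi]
      · simp [hjx, hj.ne, hρ₁ j hj]
  have last : Triple P I W 1 (pc + 1) (pc + body.length + 5) (St (Function.update (r G) x G) (Q G))
      (St (Function.update (r G) x G) (Q G)) := by
    intro ρ μ hA hB
    have h₁ := Reaches.jump (I := I) i₁ hB
    rw [hA.1 g hg, hA.1 x hx, Function.update_of_ne hxg, hG, Function.update_self,
      if_pos le_rfl] at h₁
    exact ⟨ρ, μ, hA, h₁⟩
  exact ((key G le_rfl).trans last).weaken (by omega) rfl (fun _ _ h => h) (fun _ _ h => h)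

end

end WordRAM

/-! ### The exchange argument for a single vertex -/

namespace TimelineDP

/-- Time step `i` is covered by an activity interval `[s, s + ℓ]` with `s ∈ S`. -/
def Cov (ℓ : ℕ) (S : Finset ℕ) (i : ℕ) : Prop := ∃ s ∈ S, s ≤ i ∧ i ≤ s + ℓ

theorem card_le_of_cov {ℓ : ℕ} {S J : Finset ℕ} (h : ∀ i ∈ J, Cov ℓ S i) :
    J.card ≤ S.card * (ℓ + 1) := by
  have hJ : J ⊆ S.biUnion fun s => Finset.Icc s (s + ℓ) := by
    intro i hi
    obtain ⟨s, hs, h1, h2⟩ := h i hi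
    exact Finset.mem_biUnion.2 ⟨s, hs, Finset.mem_Icc.2 ⟨h1, h2⟩⟩
  refine (Finset.card_le_card hJ).trans (Finset.card_biUnion_le_card_mul _ _ _ fun s _ => ?_)
  simp
  omega

/-- The number of intervals of `ℓ + 1` time steps that are needed to cover `f` time steps. -/
def need (ℓ f : ℕ) : ℕ := (f + ℓ) / (ℓ + 1)

theorem le_need_mul (ℓ f : ℕ) : f ≤ need ℓ f * (ℓ + 1) := by
  have h1 := Nat.div_add_mod (f + ℓ) (ℓ + 1)
  have h2 := Nat.mod_lt (f + ℓ) (show 0 < ℓ + 1 by omega)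
  rw [need, mul_comm]
  omega

theorem need_le {ℓ f m : ℕ} (h : f ≤ m * (ℓ + 1)) : need ℓ f ≤ m := by
  rw [need, ← Nat.lt_add_one_iff, Nat.div_lt_iff_lt_mul (show 0 < ℓ + 1 by omega), add_mul,
    one_mul]
  omega

/-- In this form `need` can be computed by counting, on a machine without division. -/
theorem lt_need {ℓ f j : ℕ} : j < need ℓ f ↔ j * (ℓ + 1) < f := by
  rw [need, Nat.lt_iff_add_one_le, Nat.le_div_iff_mul_le (show 0 < ℓ + 1 by omega), add_mul,
    one_mul]
  omega

/-- Exchange argument: if `S` covers all time steps before `f` and the last `h` time steps, then one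
may cover these greedily from the two ends, and spend the remaining intervals on the lifetime. -/
theorem exists_middle {k ℓ T f h : ℕ} {S : Finset ℕ} (hk : k * (ℓ + 1) < T) (hS : S.card ≤ k)
    (hh : h ≤ T) (hc : ∀ i < T, i < f ∨ T ≤ i + h → Cov ℓ S i) :
    ∃ X : Finset ℕ, X.card + need ℓ f + need ℓ h ≤ k ∧ (∀ s ∈ X, f ≤ s ∧ s + h < T) ∧
      ∀ i < T, Cov ℓ S i →
        i < need ℓ f * (ℓ + 1) ∨ T ≤ i + need ℓ h * (ℓ + 1) ∨ Cov ℓ X i := by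
  have hall : ¬ ∀ i < T, Cov ℓ S i := by
    intro hall
    have := card_le_of_cov (ℓ := ℓ) (S := S) (J := Finset.range T) (by simpa using hall)
    rw [Finset.card_range] at this
    have := Nat.mul_le_mul_right (ℓ + 1) hS
    omega
  have hfh : f + h < T := by
    by_contra hfh
    exact hall fun i hi => hc i hi (by omega)
  -- An interval that starts before `f` and reaches the last `h` steps would span the whole middle,
  -- so that everything would be covered. Hence different intervals serve the two ends.
  have hstr : ∀ s ∈ S, s < f → s + ℓ + h < T := by
    intro s hs hsf
    by_contra hlt
    refine hall fun i hi => ?_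
    by_cases hi' : i < f ∨ T ≤ i + h
    · exact hc i hi hi'
    · exact ⟨s, hs, by omega, by omega⟩
  set S₁ := S.filter fun s => s < f with hS₁
  set S₂ := S.filter fun s => f ≤ s ∧ s + ℓ + h < T with hS₂
  set S₃ := S.filter fun s => f ≤ s ∧ T ≤ s + ℓ + h with hS₃
  have hcard : S₁.card + S₂.card + S₃.card ≤ k := by
    refine le_trans (le_of_eq ?_) hS
    rw [← Finset.card_union_of_disjoint, ← Finset.card_union_of_disjoint]
    · congr 1
      ext s
      simp only [hS₁, hS₂, hS₃, Finset.mem_union, Finset.mem_filter]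
      refine ⟨by tauto, fun hs => ?_⟩
      have : s < f ∨ (f ≤ s ∧ s + ℓ + h < T) ∨ (f ≤ s ∧ T ≤ s + ℓ + h) := by omega
      tauto
    · rw [Finset.disjoint_left]
      simp only [hS₁, hS₂, hS₃, Finset.mem_union, Finset.mem_filter]
      rintro s (⟨_, h1⟩ | ⟨_, h1⟩) ⟨_, h2⟩ <;> omega
    · rw [Finset.disjoint_left]
      simp only [hS₁, hS₂, Finset.mem_filter]
      rintro s ⟨_, h1⟩ ⟨_, h2⟩
      omega
  have c₁ : ∀ i < f, Cov ℓ S₁ i := by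
    intro i hi
    obtain ⟨s, hs, h1, h2⟩ := hc i (by omega) (Or.inl hi)
    exact ⟨s, Finset.mem_filter.2 ⟨hs, by omega⟩, h1, h2⟩
  have c₃ : ∀ i < T, T ≤ i + h → Cov ℓ S₃ i := by
    intro i hi hih
    obtain ⟨s, hs, h1, h2⟩ := hc i hi (Or.inr hih)
    have := hstr s hs
    exact ⟨s, Finset.mem_filter.2 ⟨hs, by omega⟩, h1, h2⟩
  have a₁ : need ℓ f ≤ S₁.card := need_le <| by
    simpa using card_le_of_cov (J := Finset.range f) (by simpa using c₁)
  have a₃ : need ℓ h ≤ S₃.card := need_le <| by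
    have := card_le_of_cov (J := Finset.Ico (T - h) T) (S := S₃) (ℓ := ℓ) (by
      intro i hi
      rw [Finset.mem_Ico] at hi
      exact c₃ i hi.2 (by omega))
    simp at this
    omega
  have n₁ := le_need_mul ℓ f
  have n₃ := le_need_mul ℓ h
  -- A spare interval from the right end is moved so as to end with the lifetime, but is not started
  -- before `f`. It covers every middle step that a member of `S₃` covers.
  set m := max f (T - h - 1 - ℓ) with hm
  refine ⟨S₂ ∪ ((if need ℓ f < S₁.card then {f} else ∅) ∪
    (if need ℓ h < S₃.card then {m} else ∅)), ?_, ?_, ?_⟩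
  · have u₁ := Finset.card_union_le S₂ ((if need ℓ f < S₁.card then {f} else ∅) ∪
      (if need ℓ h < S₃.card then {m} else ∅))
    have u₂ := Finset.card_union_le (if need ℓ f < S₁.card then {f} else ∅)
      (if need ℓ h < S₃.card then {m} else ∅)
    have v₁ : (if need ℓ f < S₁.card then {f} else ∅ : Finset ℕ).card ≤ S₁.card - need ℓ f := by
      split_ifs <;> simp
      omega
    have v₃ : (if need ℓ h < S₃.card then {m} else ∅ : Finset ℕ).card ≤ S₃.card - need ℓ h := by
      split_ifs <;> simp
      omega
    omega
  · intro s hs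
    simp only [Finset.mem_union] at hs
    rcases hs with hs | hs | hs
    · have := (Finset.mem_filter.1 hs).2
      omega
    · split_ifs at hs <;> simp at hs
      omega
    · split_ifs at hs <;> simp at hs
      omega
  · rintro i hi ⟨s, hs, h1, h2⟩
    by_cases hs₁ : s < f
    · have hsm : s ∈ S₁ := Finset.mem_filter.2 ⟨hs, hs₁⟩
      -- With a surplus interval in `S₁`, restarting it at `f` covers all that `S₁` covers from `f`
      -- on. Without one, `S₁` has exactly `need ℓ f` members, and it covers all of `0, …, i`, so
      -- that counting bounds `i`.
      by_cases hlt : need ℓ f < S₁.card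
      · by_cases hif : i < f
        · left; omega
        · refine Or.inr (Or.inr ⟨f, ?_, by omega, by omega⟩)
          simp [hlt]
      · left
        have := card_le_of_cov (J := Finset.range (i + 1)) (S := S₁) (ℓ := ℓ) (by
          intro j hj
          rw [Finset.mem_range] at hj
          by_cases hjf : j < f
          · exact c₁ j hjf
          · exact ⟨s, hsm, by omega, by omega⟩)
        rw [Finset.card_range, show S₁.card = need ℓ f by omega] at this
        omega
    · by_cases hs₂ : s + ℓ + h < T
      · refine Or.inr (Or.inr ⟨s, ?_, h1, h2⟩)
        exact Finset.mem_union_left _ (Finset.mem_filter.2 ⟨hs, by omega, hs₂⟩)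
      · have hsm : s ∈ S₃ := Finset.mem_filter.2 ⟨hs, by omega, by omega⟩
        by_cases hlt : need ℓ h < S₃.card
        · by_cases hif : T ≤ i + h
          · right; left; omega
          · refine Or.inr (Or.inr ⟨m, ?_, by omega, by omega⟩)
            simp [hlt]
        · right; left
          have := card_le_of_cov (J := Finset.Ico i T) (S := S₃) (ℓ := ℓ) (by
            intro j hj
            rw [Finset.mem_Ico] at hj
            by_cases hjf : T ≤ j + h
            · exact c₃ j hj.2 hjf
            · exact ⟨s, hsm, by omega, by omega⟩)
          rw [Nat.card_Ico, show S₃.card = need ℓ h by omega] at this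
          omega

/-- Converse of `exists_middle`: consecutive intervals tile the first `a * (ℓ + 1)` and the last `b
* (ℓ + 1)` steps. -/
theorem exists_extension {k ℓ T a b : ℕ} {X : Finset ℕ} (hk : k * (ℓ + 1) < T)
    (hX : X.card + a + b ≤ k) :
    ∃ S : Finset ℕ, S.card ≤ k ∧ ∀ i < T,
      i < a * (ℓ + 1) ∨ T ≤ i + b * (ℓ + 1) ∨ Cov ℓ X i → Cov ℓ S i := by
  refine ⟨X ∪ ((Finset.range a).image (fun j => j * (ℓ + 1)) ∪
    (Finset.range b).image fun j => T - (j + 1) * (ℓ + 1)), ?_, ?_⟩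
  · have u₁ := Finset.card_union_le X ((Finset.range a).image (fun j => j * (ℓ + 1)) ∪
      (Finset.range b).image fun j => T - (j + 1) * (ℓ + 1))
    have u₂ := Finset.card_union_le ((Finset.range a).image (fun j => j * (ℓ + 1)))
      ((Finset.range b).image fun j => T - (j + 1) * (ℓ + 1))
    have u₃ := Finset.card_image_le (s := Finset.range a) (f := fun j => j * (ℓ + 1))
    have u₄ := Finset.card_image_le (s := Finset.range b) (f := fun j => T - (j + 1) * (ℓ + 1))
    rw [Finset.card_range] at u₃ u₄
    omega
  · rintro i hi (h | h | ⟨s, hs, h⟩)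
    · refine ⟨i / (ℓ + 1) * (ℓ + 1), ?_, ?_, ?_⟩
      · refine Finset.mem_union_right _ (Finset.mem_union_left _ (Finset.mem_image.2 ⟨_, ?_, rfl⟩))
        rw [Finset.mem_range]
        exact Nat.div_lt_of_lt_mul (by rwa [mul_comm])
      · exact Nat.div_mul_le_self _ _
      · have := Nat.lt_div_mul_add (a := i) (Nat.succ_pos ℓ)
        simp only [Nat.succ_eq_add_one] at this
        omega
    · set j := (T - 1 - i) / (ℓ + 1) with hj
      have hjb : j < b := by
        refine Nat.div_lt_of_lt_mul ?_
        rw [mul_comm]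
        omega
      have h1 : j * (ℓ + 1) ≤ T - 1 - i := Nat.div_mul_le_self _ _
      have h2 := Nat.lt_div_mul_add (a := T - 1 - i) (Nat.succ_pos ℓ)
      rw [Nat.succ_eq_add_one, ← hj] at h2
      -- Together with `hk` this keeps the subtraction in `T - (j + 1) * (ℓ + 1)` from being
      -- truncated.
      have h3 : (j + 1) * (ℓ + 1) ≤ k * (ℓ + 1) := Nat.mul_le_mul_right _ (by omega)
      have h4 : (j + 1) * (ℓ + 1) = j * (ℓ + 1) + (ℓ + 1) := by ring
      refine ⟨T - (j + 1) * (ℓ + 1), ?_, by omega, by omega⟩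
      refine Finset.mem_union_right _ (Finset.mem_union_right _ (Finset.mem_image.2 ⟨j, ?_, rfl⟩))
      exact Finset.mem_range.2 hjb
    · exact ⟨s, Finset.mem_union_left _ hs, h⟩

/-! ### Instances -/

/-- An instance of Timeline Dominating Set on the natural numbers: vertices below `n`, time steps
below `T`. -/
structure Inst where
  n : ℕ
  T : ℕ
  k : ℕ
  ℓ : ℕ
  /-- adjacency of two vertices at a time step -/
  adj : ℕ → ℕ → ℕ → Prop

namespace Inst

variable (J : Inst)

/-- There are sets of starting times, at most `k` for each vertex, for which all temporal vertices
are dominated. -/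
def Solvable : Prop :=
  ∃ S : ℕ → Finset ℕ, (∀ v < J.n, (S v).card ≤ J.k) ∧
    ∀ i < J.T, ∀ u < J.n, ∃ v < J.n, (u = v ∨ J.adj i u v) ∧ Cov J.ℓ (S v) i

/-- `v` is not isolated at time `i`. -/
def NonIsolated (i v : ℕ) : Prop := ∃ u < J.n, J.adj i v u

/-- `v` is not isolated at some time up to `i`. -/
def Since (i v : ℕ) : Prop := ∃ p < J.T, p ≤ i ∧ J.NonIsolated p v

/-- `v` is not isolated at some time from `i` on. -/
def Until (i v : ℕ) : Prop := ∃ q < J.T, i ≤ q ∧ J.NonIsolated q v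

/-- `i` lies in the lifetime of `v`. -/
def Alive (i v : ℕ) : Prop := J.Since i v ∧ J.Until i v

open Classical in
/-- The number of time steps before the lifetime of `v`. -/
noncomputable def pre (v : ℕ) : ℕ := ((Finset.range J.T).filter fun i => ¬ J.Since i v).card

open Classical in
/-- The number of time steps after the lifetime of `v`. -/
noncomputable def post (v : ℕ) : ℕ := ((Finset.range J.T).filter fun i => ¬ J.Until i v).card

theorem pre_le (v : ℕ) : J.pre v ≤ J.T := by
  classical
  exact (Finset.card_filter_le _ _).trans (by simp)

theorem post_le (v : ℕ) : J.post v ≤ J.T := by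
  classical
  exact (Finset.card_filter_le _ _).trans (by simp)

variable {J}

/-- `Since` is monotone in time, so the steps at which it fails form an initial segment, and their
number is its end. -/
theorem since_iff {i v : ℕ} (hi : i < J.T) : J.Since i v ↔ J.pre v ≤ i := by
  classical
  constructor
  · rintro ⟨p, hp, hpi, h⟩
    refine (Finset.card_le_card (t := Finset.range i) fun j hj => ?_).trans (by simp)
    simp only [Finset.mem_filter, Finset.mem_range] at hj ⊢
    by_contra hij
    exact hj.2 ⟨p, hp, by omega, h⟩
  · intro h
    by_contra hs
    have : (Finset.range (i + 1)).card ≤ J.pre v := by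
      refine Finset.card_le_card fun j hj => ?_
      simp only [Finset.mem_filter, Finset.mem_range] at hj ⊢
      refine ⟨by omega, ?_⟩
      rintro ⟨p, hp, hpj, h⟩
      exact hs ⟨p, hp, by omega, h⟩
    simp at this
    omega

theorem until_iff {i v : ℕ} (hi : i < J.T) : J.Until i v ↔ i + J.post v < J.T := by
  classical
  constructor
  · rintro ⟨q, hq, hiq, h⟩
    have : J.post v ≤ (Finset.Ioo i J.T).card := by
      refine Finset.card_le_card fun j hj => ?_
      simp only [Finset.mem_filter, Finset.mem_range, Finset.mem_Ioo] at hj ⊢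
      refine ⟨?_, hj.1⟩
      by_contra hij
      exact hj.2 ⟨q, hq, by omega, h⟩
    simp at this
    omega
  · intro h
    by_contra hs
    have : (Finset.Ico i J.T).card ≤ J.post v := by
      refine Finset.card_le_card fun j hj => ?_
      simp only [Finset.mem_filter, Finset.mem_range, Finset.mem_Ico] at hj ⊢
      refine ⟨by omega, ?_⟩
      rintro ⟨q, hq, hjq, h⟩
      exact hs ⟨q, hq, by omega, h⟩
    simp at this
    omega

theorem alive_iff {i v : ℕ} (hi : i < J.T) :
    J.Alive i v ↔ J.pre v ≤ i ∧ i + J.post v < J.T := by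
  rw [Alive, since_iff hi, until_iff hi]

theorem alive_of_nonIsolated {i v : ℕ} (hi : i < J.T) (h : J.NonIsolated i v) : J.Alive i v :=
  ⟨⟨i, hi, le_rfl, h⟩, ⟨i, hi, le_rfl, h⟩⟩

variable (J)

/-- The number of intervals spent before the lifetime of `v`. -/
noncomputable def left (v : ℕ) : ℕ := need J.ℓ (J.pre v)

/-- The number of intervals spent after the lifetime of `v`. -/
noncomputable def right (v : ℕ) : ℕ := need J.ℓ (J.post v)

/-- The lifetime of `v` does not fit into a single interval. -/
def Long (v : ℕ) : Prop := J.pre v + J.post v + J.ℓ + 2 ≤ J.T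

/-- The long-lived vertices at time `i`. -/
def LongAlive (i v : ℕ) : Prop := J.Alive i v ∧ J.Long v

/-- Vertices that are active at time `i` irrespective of the choices for the long-lived vertices. -/
def Fixed (i v : ℕ) : Prop :=
  ¬ J.Alive i v ∨ i < J.left v * (J.ℓ + 1) ∨ J.T ≤ i + J.right v * (J.ℓ + 1) ∨
    (¬ J.Long v ∧ J.left v + J.right v + 1 ≤ J.k)

/-- Starting times for the long-lived vertices within their lifetimes. -/
def Middle (X : ℕ → Finset ℕ) : Prop :=
  (∀ v < J.n, J.Long v → (X v).card + J.left v + J.right v ≤ J.k ∧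
    ∀ s ∈ X v, s < J.T ∧ J.Alive s v) ∧
  ∀ i < J.T, ∀ u < J.n, ∃ v < J.n, (u = v ∨ J.adj i u v) ∧
    (J.Fixed i v ∨ (J.LongAlive i v ∧ Cov J.ℓ (X v) i))

/-- Forward, `exists_middle` normalizes the intervals of every vertex separately; backward,
`exists_extension` adds the greedy ends again. In both directions activity is only gained, so
domination persists. -/
theorem solvable_iff_middle (hk : J.k * (J.ℓ + 1) < J.T) :
    J.Solvable ↔ (∀ v < J.n, J.left v + J.right v ≤ J.k) ∧ ∃ X, J.Middle X := by
  constructor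
  · rintro ⟨S, hS, hdom⟩
    -- Outside its lifetime `v` has no neighbour that could dominate it.
    have hself : ∀ v < J.n, ∀ i < J.T, i < J.pre v ∨ J.T ≤ i + J.post v → Cov J.ℓ (S v) i := by
      intro v hv i hi h
      obtain ⟨u, hu, rfl | hadj, hc⟩ := hdom i hi v hv
      · exact hc
      · have := (alive_iff hi).1 (alive_of_nonIsolated hi ⟨u, hu, hadj⟩)
        omega
    have hex : ∀ v, ∃ X : Finset ℕ, v < J.n → (X.card + J.left v + J.right v ≤ J.k ∧
        (∀ s ∈ X, J.pre v ≤ s ∧ s + J.post v < J.T) ∧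
        ∀ i < J.T, Cov J.ℓ (S v) i →
          i < J.left v * (J.ℓ + 1) ∨ J.T ≤ i + J.right v * (J.ℓ + 1) ∨ Cov J.ℓ X i) := by
      intro v
      by_cases hv : v < J.n
      · obtain ⟨X, hX⟩ := exists_middle hk (hS v hv) (J.post_le v) (hself v hv)
        exact ⟨X, fun _ => hX⟩
      · exact ⟨∅, fun h => absurd h hv⟩
    choose X hX using hex
    refine ⟨fun v hv => by have := (hX v hv).1; omega, X, fun v hv _ => ⟨(hX v hv).1, ?_⟩, ?_⟩
    · intro s hs
      have h1 := (hX v hv).2.1 s hs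
      have hsT : s < J.T := by omega
      exact ⟨hsT, (alive_iff hsT).2 h1⟩
    · intro i hi u hu
      obtain ⟨v, hv, huv, hc⟩ := hdom i hi u hu
      refine ⟨v, hv, huv, ?_⟩
      obtain ⟨h1, -, h2⟩ := hX v hv
      rcases h2 i hi hc with h | h | h
      · exact Or.inl (Or.inr (Or.inl h))
      · exact Or.inl (Or.inr (Or.inr (Or.inl h)))
      · by_cases ha : J.Alive i v
        · by_cases hl : J.Long v
          · exact Or.inr ⟨⟨ha, hl⟩, h⟩
          · refine Or.inl (Or.inr (Or.inr (Or.inr ⟨hl, ?_⟩)))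
            obtain ⟨s, hs, -⟩ := h
            have := Finset.card_pos.2 ⟨s, hs⟩
            omega
        · exact Or.inl (Or.inl ha)
  · rintro ⟨hfeas, X, hX, hdom⟩
    have hex : ∀ v, ∃ S : Finset ℕ, v < J.n → S.card ≤ J.k ∧ ∀ i < J.T,
        (J.Fixed i v ∨ (J.LongAlive i v ∧ Cov J.ℓ (X v) i)) → Cov J.ℓ S i := by
      intro v
      by_cases hv : v < J.n
      swap
      · exact ⟨∅, fun h => absurd h hv⟩
      have hout : ∀ i < J.T, ¬ J.Alive i v →
          i < J.left v * (J.ℓ + 1) ∨ J.T ≤ i + J.right v * (J.ℓ + 1) := by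
        intro i hi ha
        rw [alive_iff hi] at ha
        have h1 : J.pre v ≤ J.left v * (J.ℓ + 1) := le_need_mul _ _
        have h2 : J.post v ≤ J.right v * (J.ℓ + 1) := le_need_mul _ _
        omega
      by_cases hl : J.Long v
      · obtain ⟨S, hS, hc⟩ := exists_extension (X := X v) hk (hX v hv hl).1
        refine ⟨S, fun _ => ⟨hS, fun i hi h => hc i hi ?_⟩⟩
        rcases h with (h | h | h | h) | h
        · have := hout i hi h
          tauto
        · tauto
        · tauto
        · exact absurd hl h.1
        · tauto
      · by_cases hb : J.left v + J.right v + 1 ≤ J.k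
        -- One interval from the first step of the lifetime on covers a short lifetime entirely.
        · obtain ⟨S, hS, hc⟩ := exists_extension (ℓ := J.ℓ) (X := {J.pre v})
            (a := J.left v) (b := J.right v) hk (by simp; omega)
          refine ⟨S, fun _ => ⟨hS, fun i hi h => hc i hi ?_⟩⟩
          by_cases ha : J.Alive i v
          · refine Or.inr (Or.inr ⟨J.pre v, by simp, ?_⟩)
            rw [alive_iff hi] at ha
            rw [Long] at hl
            omega
          · have := hout i hi ha
            tauto
        · obtain ⟨S, hS, hc⟩ := exists_extension (ℓ := J.ℓ) (X := ∅)
            (a := J.left v) (b := J.right v) hk (by simpa using hfeas v hv)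
          refine ⟨S, fun _ => ⟨hS, fun i hi h => hc i hi ?_⟩⟩
          rcases h with (h | h | h | h) | h
          · have := hout i hi h
            tauto
          · tauto
          · tauto
          · exact absurd h.2 hb
          · exact absurd h.1.2 hl
    choose S hS using hex
    refine ⟨S, fun v hv => (hS v hv).1, fun i hi u hu => ?_⟩
    obtain ⟨v, hv, huv, h⟩ := hdom i hi u hu
    exact ⟨v, hv, huv, (hS v hv).2 i hi h⟩

end Inst

end TimelineDP

namespace TimelineDP

/-! ### The state of a single vertex -/

/-- The state of a vertex, encoded as `c * (ℓ + 2) + r`, where `c` is the number of intervals used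
so far and `r` the remaining length of the current one, right before time `i`, if the intervals
start at the times in `X`. -/
def track (ℓ : ℕ) (X : Finset ℕ) : ℕ → ℕ
  | 0 => 0
  | i + 1 => if i ∈ X then track ℓ X i / (ℓ + 2) * (ℓ + 2) + (2 * ℓ + 3)
      else track ℓ X i - if 1 ≤ track ℓ X i % (ℓ + 2) then 1 else 0

/-- Since `2 * ℓ + 3 = (ℓ + 2) + (ℓ + 1)`, a restart raises the count by one and sets the remaining
length to `ℓ + 1`. -/
theorem restart_div (ℓ d : ℕ) :
    (d / (ℓ + 2) * (ℓ + 2) + (2 * ℓ + 3)) / (ℓ + 2) = d / (ℓ + 2) + 1 := by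
  rw [show d / (ℓ + 2) * (ℓ + 2) + (2 * ℓ + 3) = (d / (ℓ + 2) + 1) * (ℓ + 2) + (ℓ + 1) by ring,
    Nat.add_div_of_dvd_right (Dvd.intro_left _ rfl), Nat.mul_div_cancel _ (by omega),
    Nat.div_eq_of_lt (show ℓ + 1 < ℓ + 2 by omega), add_zero]

theorem restart_mod (ℓ d : ℕ) :
    (d / (ℓ + 2) * (ℓ + 2) + (2 * ℓ + 3)) % (ℓ + 2) = ℓ + 1 := by
  rw [show d / (ℓ + 2) * (ℓ + 2) + (2 * ℓ + 3) = (ℓ + 1) + (d / (ℓ + 2) + 1) * (ℓ + 2) by ring,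
    Nat.add_mul_mod_self_right, Nat.mod_eq_of_lt (by omega)]

theorem tick_div (ℓ d : ℕ) :
    (d - if 1 ≤ d % (ℓ + 2) then 1 else 0) / (ℓ + 2) = d / (ℓ + 2) := by
  split_ifs with h
  · have h1 := Nat.div_add_mod d (ℓ + 2)
    have h2 := Nat.mod_lt d (show 0 < ℓ + 2 by omega)
    conv_lhs => rw [← h1]
    rw [Nat.add_sub_assoc h, Nat.mul_add_div (by omega),
      Nat.div_eq_of_lt (show d % (ℓ + 2) - 1 < ℓ + 2 by omega), add_zero]
  · simp

theorem tick_mod (ℓ d : ℕ) :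
    (d - if 1 ≤ d % (ℓ + 2) then 1 else 0) % (ℓ + 2) = d % (ℓ + 2) - 1 := by
  split_ifs with h
  · have h1 := Nat.div_add_mod d (ℓ + 2)
    have h2 := Nat.mod_lt d (show 0 < ℓ + 2 by omega)
    conv_lhs => rw [← h1]
    rw [Nat.add_sub_assoc h, Nat.mul_add_mod, Nat.mod_eq_of_lt (by omega)]
  · rw [Nat.sub_zero]
    omega

theorem track_div (ℓ : ℕ) (X : Finset ℕ) (i : ℕ) :
    track ℓ X i / (ℓ + 2) = (X.filter (· < i)).card := by
  induction i with
  | zero => simp [track]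
  | succ i ih =>
    rw [track]
    by_cases h : i ∈ X
    · rw [if_pos h, restart_div, ih, ← Finset.card_insert_of_notMem (a := i) (by simp)]
      congr 1
      ext s
      simp only [Finset.mem_insert, Finset.mem_filter]
      constructor
      · rintro (rfl | ⟨h1, h2⟩)
        · exact ⟨h, by omega⟩
        · exact ⟨h1, by omega⟩
      · rintro ⟨h1, h2⟩
        by_cases hs : s = i
        · exact Or.inl hs
        · exact Or.inr ⟨h1, by omega⟩
    · rw [if_neg h, tick_div, ih]
      congr 1
      ext s
      simp only [Finset.mem_filter]
      refine and_congr_right fun hs => ?_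
      have : s ≠ i := fun e => h (e ▸ hs)
      omega

/-- The remaining length is the maximum of the truncated differences `s + ℓ + 2 - i` over the starts
`s < i`. Thresholds `m` express this without a maximum; they vary in the induction because each tick
shifts them. -/
theorem lt_track_mod (ℓ : ℕ) (X : Finset ℕ) (i m : ℕ) :
    m < track ℓ X i % (ℓ + 2) ↔ ∃ s ∈ X, s < i ∧ i + m ≤ s + ℓ + 1 := by
  induction i generalizing m with
  | zero => simp [track]
  | succ i ih =>
    rw [track]
    by_cases h : i ∈ X
    · rw [if_pos h, restart_mod]
      constructor
      · intro hm
        exact ⟨i, h, by omega, by omega⟩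
      · rintro ⟨s, -, h1, h2⟩
        omega
    · rw [if_neg h, tick_mod, Nat.lt_sub_iff_add_lt, ih]
      constructor
      · rintro ⟨s, hs, h1, h2⟩
        exact ⟨s, hs, by omega, by omega⟩
      · rintro ⟨s, hs, h1, h2⟩
        have : s ≠ i := fun e => h (e ▸ hs)
        exact ⟨s, hs, by omega, by omega⟩

theorem one_le_track_mod {ℓ : ℕ} {X : Finset ℕ} {i : ℕ} :
    1 ≤ track ℓ X (i + 1) % (ℓ + 2) ↔ Cov ℓ X i := by
  rw [Nat.one_le_iff_ne_zero, ← Nat.pos_iff_ne_zero, lt_track_mod, Cov]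
  refine exists_congr fun s => and_congr_right fun _ => ?_
  omega

theorem track_eq_zero {ℓ : ℕ} {X : Finset ℕ} {i : ℕ} (h : ∀ s ∈ X, i ≤ s) :
    track ℓ X i = 0 := by
  induction i with
  | zero => rfl
  | succ i ih =>
    rw [track, if_neg (fun hi => by have := h i hi; omega), ih fun s hs => by
      have := h s hs
      omega]
    simp

/-! ### Joint states of the long-lived vertices and their reachability -/

namespace Inst

variable (J : Inst)

/-- The number of states of a vertex. -/
def base : ℕ := (J.k + 1) * (J.ℓ + 2)

open Classical in
/-- The number of long-lived vertices smaller than `v` at time `i`. -/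
noncomputable def rank (i v : ℕ) : ℕ :=
  ((Finset.range J.n).filter fun u => u < v ∧ J.LongAlive i u).card

open Classical in
/-- The number of long-lived vertices at time `i`. -/
noncomputable def width (i : ℕ) : ℕ := ((Finset.range J.n).filter fun u => J.LongAlive i u).card

open Classical in
/-- The maximum number of simultaneous long-lived vertices. -/
noncomputable def slots : ℕ :=
  ((Finset.range J.n).filter fun c => ∃ i < J.T, c < J.width i).card

/-- The number of joint states. -/
noncomputable def states : ℕ := J.base ^ J.slots

/-- The state of vertex `v` at time `i` in the joint state `x`. -/
noncomputable def digit (i v x : ℕ) : ℕ :=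
  open Classical in if J.LongAlive i v then x / J.base ^ J.rank i v % J.base else 0

/-- The state of vertex `v` before time `i` if the joint state at time `i - 1` is `x`. -/
noncomputable def prevDigit (i v x : ℕ) : ℕ := if 1 ≤ i then J.digit (i - 1) v x else 0

/-- The vertex `v` may go from state `d` to state `d'`. -/
def Trans (v d d' : ℕ) : Prop :=
  d' = (d - if 1 ≤ d % (J.ℓ + 2) then 1 else 0) ∨
    (d' = d / (J.ℓ + 2) * (J.ℓ + 2) + (2 * J.ℓ + 3) ∧
      d / (J.ℓ + 2) + 1 + J.left v + J.right v ≤ J.k)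

/-- The vertex `v` is active at time `i` in the joint state `x`. -/
def Active (i v x : ℕ) : Prop := J.Fixed i v ∨ 1 ≤ J.digit i v x % (J.ℓ + 2)

/-- In the joint state `x`, all vertices are dominated at time `i`. -/
def Dom (i x : ℕ) : Prop := ∀ u < J.n, ∃ v < J.n, (u = v ∨ J.adj i u v) ∧ J.Active i v x

/-- The joint state `x'` is possible at time `i` after the joint state `x` at time `i - 1`. -/
def Step (i x x' : ℕ) : Prop :=
  (∀ v < J.n, J.LongAlive i v → J.Trans v (J.prevDigit i v x) (J.digit i v x')) ∧ J.Dom i x'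

/-- The joint state is reachable at time `i`. -/
def Reach : ℕ → ℕ → Prop
  | 0, x' => J.Step 0 0 x'
  | i + 1, x' => ∃ x < J.states, Reach i x ∧ J.Step (i + 1) x x'

variable {J}

theorem step_zero {x y x' : ℕ} : J.Step 0 x x' ↔ J.Step 0 y x' := by
  simp [Step, prevDigit]

theorem rank_lt_width {i v : ℕ} (hv : v < J.n) (h : J.LongAlive i v) :
    J.rank i v < J.width i := by
  classical
  refine Finset.card_lt_card ⟨fun u hu => ?_, fun hsub => ?_⟩
  · simp only [Finset.mem_filter] at hu ⊢
    exact ⟨hu.1, hu.2.2⟩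
  · have := hsub (Finset.mem_filter.2 ⟨Finset.mem_range.2 hv, h⟩)
    simp at this

theorem rank_lt_rank {i u v : ℕ} (hu : u < J.n) (h : J.LongAlive i u) (huv : u < v) :
    J.rank i u < J.rank i v := by
  classical
  refine Finset.card_lt_card ⟨fun w hw => ?_, fun hsub => ?_⟩
  · simp only [Finset.mem_filter] at hw ⊢
    exact ⟨hw.1, by omega, hw.2.2⟩
  · have := hsub (Finset.mem_filter.2 ⟨Finset.mem_range.2 hu, huv, h⟩)
    simp at this

theorem rank_inj {i u v : ℕ} (hu : u < J.n) (hv : v < J.n) (h : J.LongAlive i u)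
    (h' : J.LongAlive i v) (e : J.rank i u = J.rank i v) : u = v := by
  rcases lt_trichotomy u v with huv | huv | huv
  · have := rank_lt_rank hu h huv
    omega
  · exact huv
  · have := rank_lt_rank hv h' huv
    omega

theorem width_le_slots {i : ℕ} (hi : i < J.T) : J.width i ≤ J.slots := by
  classical
  have hn : J.width i ≤ J.n := (Finset.card_filter_le _ _).trans (by simp)
  have : (Finset.range (J.width i)).card ≤ J.slots := by
    refine Finset.card_le_card fun c hc => ?_
    rw [Finset.mem_range] at hc
    exact Finset.mem_filter.2 ⟨Finset.mem_range.2 (by omega), i, hi, hc⟩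
  simpa using this

theorem slots_le {w : ℕ} (h : ∀ i < J.T, J.width i ≤ w) : J.slots ≤ w := by
  classical
  have : J.slots ≤ (Finset.range w).card := by
    refine Finset.card_le_card fun c hc => ?_
    obtain ⟨-, i, hi, hc⟩ := Finset.mem_filter.1 hc
    exact Finset.mem_range.2 (hc.trans_le (h i hi))
  simpa using this

theorem base_pos : 0 < J.base := Nat.mul_pos (Nat.succ_pos _) (Nat.succ_pos _)

/-- Ranks of long-lived vertices alive at one time are distinct and lie below `slots`, so their
digits can be prescribed independently; unused digits are zero. -/
theorem exists_state {i : ℕ} (hi : i < J.T) (σ : ℕ → ℕ)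
    (hσ : ∀ v < J.n, J.LongAlive i v → σ v < J.base) :
    ∃ x < J.states, ∀ v < J.n, J.LongAlive i v → J.digit i v x = σ v := by
  classical
  have hex : ∀ j : Fin J.slots, ∃ d : Fin J.base, ∀ v < J.n, J.LongAlive i v →
      J.rank i v = j → (d : ℕ) = σ v := by
    intro j
    by_cases h : ∃ v < J.n, J.LongAlive i v ∧ J.rank i v = j
    · obtain ⟨v, hv, hl, hr⟩ := h
      refine ⟨⟨σ v, hσ v hv hl⟩, fun u hu hlu hru => ?_⟩
      rw [rank_inj hu hv hlu hl (hru.trans hr.symm)]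
    · exact ⟨⟨0, base_pos⟩, fun v hv hl hr => absurd ⟨v, hv, hl, hr⟩ h⟩
  choose d hd using hex
  refine ⟨finFunctionFinEquiv d, (finFunctionFinEquiv d).2, fun v hv hl => ?_⟩
  have hlt := (rank_lt_width hv hl).trans_le (width_le_slots hi)
  rw [digit, if_pos hl, ← hd ⟨_, hlt⟩ v hv hl rfl]
  have := finFunctionFinEquiv_symm_apply_val (finFunctionFinEquiv d) ⟨_, hlt⟩
  rw [Equiv.symm_apply_apply] at this
  exact this.symm

/-- At `i = 0` the truncated index `i - 1` makes `xs 0` its own predecessor; this is harmless by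
`step_zero`. -/
theorem reach_of_seq {xs : ℕ → ℕ} (hN : ∀ i < J.T, xs i < J.states)
    (h : ∀ i < J.T, J.Step i (xs (i - 1)) (xs i)) : ∀ i < J.T, J.Reach i (xs i) := by
  intro i
  induction i with
  | zero => exact fun hi => step_zero.1 (h 0 hi)
  | succ i ih => exact fun hi => ⟨xs i, hN i (by omega), ih (by omega), h (i + 1) hi⟩

theorem seq_of_reach : ∀ {i x : ℕ}, J.Reach i x →
    ∃ xs : ℕ → ℕ, xs i = x ∧ ∀ j ≤ i, J.Step j (xs (j - 1)) (xs j)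
  | 0, x, h => ⟨fun _ => x, rfl, fun j hj => by
      obtain rfl : j = 0 := by omega
      exact step_zero.1 h⟩
  | i + 1, x, ⟨y, _, hy, hs⟩ => by
      obtain ⟨xs, rfl, hxs⟩ := seq_of_reach hy
      refine ⟨Function.update xs (i + 1) x, by simp, fun j hj => ?_⟩
      rw [Function.update_of_ne (show j - 1 ≠ i + 1 by omega)]
      by_cases hji : j = i + 1
      · subst hji
        simpa using hs
      · rw [Function.update_of_ne hji]
        exact hxs j (by omega)

theorem alive_before {i s v : ℕ} (hi : i < J.T) (ha : J.Alive i v) (hsi : s < i)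
    (hs : J.Alive s v) : J.Alive (i - 1) v := by
  rw [alive_iff (by omega)] at *
  omega

/-- The joint state at time `i` has the values of `track` at `i + 1` as its digits. -/
theorem seq_of_middle {X : ℕ → Finset ℕ} (hX : J.Middle X) : ∃ xs : ℕ → ℕ,
    (∀ i < J.T, xs i < J.states) ∧ ∀ i < J.T, J.Step i (xs (i - 1)) (xs i) := by
  classical
  have hcard : ∀ i, ∀ v < J.n, J.Long v → track J.ℓ (X v) i < J.base := by
    intro i v hv hl
    have h1 := (hX.1 v hv hl).1
    have h2 := track_div J.ℓ (X v) i
    have h3 := Finset.card_filter_le (X v) (· < i)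
    rw [base, ← Nat.div_lt_iff_lt_mul (by omega)]
    omega
  have hex : ∀ i, ∃ x, i < J.T → x < J.states ∧
      ∀ v < J.n, J.LongAlive i v → J.digit i v x = track J.ℓ (X v) (i + 1) := by
    intro i
    by_cases hi : i < J.T
    · obtain ⟨x, hx⟩ := exists_state hi (fun v => track J.ℓ (X v) (i + 1))
        fun v hv hl => hcard _ v hv hl.2
      exact ⟨x, fun _ => hx⟩
    · exact ⟨0, fun h => absurd h hi⟩
  choose xs hxs using hex
  refine ⟨xs, fun i hi => (hxs i hi).1, fun i hi => ⟨fun v hv hl => ?_, fun u hu => ?_⟩⟩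
  · have hprev : J.prevDigit i v (xs (i - 1)) = track J.ℓ (X v) i := by
      -- If the lifetime only begins at `i`, no start lies before `i`; the track is then `0`, the
      -- default value of `prevDigit`.
      by_cases hp : 1 ≤ i ∧ J.LongAlive (i - 1) v
      · rw [prevDigit, if_pos hp.1, (hxs (i - 1) (by omega)).2 v hv hp.2, Nat.sub_add_cancel hp.1]
      · rw [track_eq_zero]
        · rw [prevDigit, digit]
          split_ifs <;> tauto
        · intro s hs
          by_contra hsi
          refine hp ⟨by omega, ?_, hl.2⟩
          exact alive_before hi hl.1 (by omega) ((hX.1 v hv hl.2).2 s hs).2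
    rw [hprev, (hxs i hi).2 v hv hl, Trans, track]
    by_cases hiX : i ∈ X v
    · rw [if_pos hiX]
      refine Or.inr ⟨rfl, ?_⟩
      rw [track_div]
      have h1 := (hX.1 v hv hl.2).1
      have h2 : ((X v).filter (· < i)).card < (X v).card :=
        Finset.card_lt_card ⟨Finset.filter_subset _ _, fun hsub => by
          simpa using hsub hiX⟩
      omega
    · rw [if_neg hiX]
      exact Or.inl rfl
  · obtain ⟨v, hv, huv, h⟩ := hX.2 i hi u hu
    refine ⟨v, hv, huv, h.imp_right fun h => ?_⟩
    rw [(hxs i hi).2 v hv h.1, one_le_track_mod]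
    exact h.2

theorem middle_of_seq (hfeas : ∀ v < J.n, J.left v + J.right v ≤ J.k) {xs : ℕ → ℕ}
    (h : ∀ i < J.T, J.Step i (xs (i - 1)) (xs i)) : ∃ X, J.Middle X := by
  classical
  -- The starts are read off from the transitions that restart the interval within the budget; every
  -- other transition has to be a tick.
  set X : ℕ → Finset ℕ := fun v => (Finset.range J.T).filter fun i => J.LongAlive i v ∧
    (J.digit i v (xs i) = J.prevDigit i v (xs (i - 1)) / (J.ℓ + 2) * (J.ℓ + 2) + (2 * J.ℓ + 3) ∧
      J.prevDigit i v (xs (i - 1)) / (J.ℓ + 2) + 1 + J.left v + J.right v ≤ J.k) with hXdef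
  have hmem : ∀ {s v}, s ∈ X v ↔ s < J.T ∧ J.LongAlive s v ∧
    (J.digit s v (xs s) = J.prevDigit s v (xs (s - 1)) / (J.ℓ + 2) * (J.ℓ + 2) + (2 * J.ℓ + 3) ∧
      J.prevDigit s v (xs (s - 1)) / (J.ℓ + 2) + 1 + J.left v + J.right v ≤ J.k) := by
    intro s v
    rw [hXdef, Finset.mem_filter, Finset.mem_range]
  have key : ∀ v < J.n, ∀ i < J.T, J.LongAlive i v →
      J.prevDigit i v (xs (i - 1)) = track J.ℓ (X v) i ∧
      J.digit i v (xs i) = track J.ℓ (X v) (i + 1) := by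
    intro v hv i
    induction i using Nat.strong_induction_on with
    | _ i ih =>
      intro hi hl
      have hprev : J.prevDigit i v (xs (i - 1)) = track J.ℓ (X v) i := by
        by_cases hp : 1 ≤ i ∧ J.LongAlive (i - 1) v
        · rw [prevDigit, if_pos hp.1, (ih (i - 1) (by omega) (by omega) hp.2).2,
            Nat.sub_add_cancel hp.1]
        · rw [track_eq_zero]
          · rw [prevDigit, digit]
            split_ifs <;> tauto
          · intro s hs
            by_contra hsi
            refine hp ⟨by omega, ?_, hl.2⟩
            exact alive_before hi hl.1 (by omega) (hmem.1 hs).2.1.1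
      refine ⟨hprev, ?_⟩
      rw [track]
      by_cases hiX : i ∈ X v
      · rw [if_pos hiX, ← hprev]
        exact (hmem.1 hiX).2.2.1
      · rw [if_neg hiX, ← hprev]
        rcases (h i hi).1 v hv hl with ht | ht
        · exact ht
        · exact absurd (hmem.2 ⟨hi, hl, ht⟩) hiX
  refine ⟨X, fun v hv hl => ⟨?_, fun s hs => ⟨(hmem.1 hs).1, (hmem.1 hs).2.1.1⟩⟩,
    fun i hi u hu => ?_⟩
  · rcases (X v).eq_empty_or_nonempty with he | hne
    · rw [he]
      simpa using hfeas v hv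
    -- The budget test at the last start suffices: the count stored just before it is the number of
    -- all earlier starts.
    · have hm := hmem.1 ((X v).max'_mem hne)
      have h1 := hm.2.2.2
      rw [(key v hv _ hm.1 hm.2.1).1, track_div] at h1
      have h2 : (X v).card ≤ ((X v).filter (· < (X v).max' hne)).card + 1 := by
        rw [← Finset.card_insert_of_notMem (a := (X v).max' hne) (by simp)]
        refine Finset.card_le_card fun s hs => ?_
        rw [Finset.mem_insert, Finset.mem_filter]
        rcases ((X v).le_max' s hs).eq_or_lt with e | e
        · exact Or.inl e
        · exact Or.inr ⟨hs, e⟩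
      omega
  · obtain ⟨v, hv, huv, ha⟩ := (h i hi).2 u hu
    refine ⟨v, hv, huv, ha.imp_right fun ha => ?_⟩
    have hl : J.LongAlive i v := by
      by_contra hl
      rw [digit, if_neg hl] at ha
      simp at ha
    rw [(key v hv i hi hl).2, one_le_track_mod] at ha
    exact ⟨hl, ha⟩

theorem solvable_iff_reach (hk : J.k * (J.ℓ + 1) < J.T) : J.Solvable ↔
    (∀ v < J.n, J.left v + J.right v ≤ J.k) ∧ ∃ x < J.states, J.Reach (J.T - 1) x := by
  rw [solvable_iff_middle J hk]
  refine and_congr_right fun hfeas => ⟨?_, ?_⟩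
  · rintro ⟨X, hX⟩
    obtain ⟨xs, h1, h2⟩ := seq_of_middle hX
    exact ⟨xs (J.T - 1), h1 _ (by omega), reach_of_seq h1 h2 _ (by omega)⟩
  · rintro ⟨x, -, hx⟩
    obtain ⟨xs, -, h2⟩ := seq_of_reach hx
    exact middle_of_seq hfeas fun i hi => h2 i (by omega)

end Inst

end TimelineDP

namespace TimelineDP

/-! ### Counting large entries of a sorted list -/

/-- Entries larger than the one at position `x` stand before it. If `x` is past the end, the whole
list has at most `x` entries anyway. -/
theorem countP_lt_getD_le {l : List ℕ} (hl : l.Pairwise fun a b => b ≤ a) (x : ℕ) :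
    l.countP (fun a => decide (l.getD x 0 < a)) ≤ x := by
  have h1 : (l.drop x).countP (fun a => decide (l.getD x 0 < a)) = 0 := by
    rw [List.countP_eq_zero]
    intro a ha
    simp only [decide_eq_true_eq, not_lt]
    by_cases hx : x < l.length
    · rw [List.getD_eq_getElem _ _ hx]
      rw [List.drop_eq_getElem_cons hx, List.mem_cons] at ha
      rcases ha with rfl | ha
      · exact le_rfl
      · have := hl.sublist (List.drop_sublist x l)
        rw [List.drop_eq_getElem_cons hx, List.pairwise_cons] at this
        exact this.1 a ha
    · rw [List.drop_eq_nil_of_le (by omega)] at ha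
      simp at ha
  conv_lhs => arg 2; rw [← List.take_append_drop x l]
  rw [List.countP_append, h1, add_zero]
  exact List.countP_le_length.trans (by simp)

theorem card_filter_eq_countP {T : ℕ} (f : Fin T → ℕ) (w : ℕ) :
    (Finset.univ.filter fun i : Fin T => w < f i).card =
      (List.ofFn f).countP fun a => decide (w < a) := by
  rw [List.ofFn_eq_map, List.countP_map, List.countP_eq_length_filter]
  rw [← List.toFinset_card_of_nodup ((List.nodup_finRange T).filter _)]
  congr 1
  ext i
  simp

theorem card_large_bags_le {n T : ℕ} (G : TemporalGraph n T) (x : ℕ) :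
    (Finset.univ.filter fun i : Fin T => G.vimw (x + 1) < (G.bag i).ncard).card ≤ x := by
  have hperm : (G.sortedBagSizes).Perm (List.ofFn fun i : Fin T => (G.bag i).ncard) :=
    List.mergeSort_perm _ _
  have hsorted : G.sortedBagSizes.Pairwise fun a b => b ≤ a := by
    have := List.pairwise_mergeSort (le := fun a b : ℕ => decide (b ≤ a))
      (by simp; omega) (by simp; omega) (List.ofFn fun i : Fin T => (G.bag i).ncard)
    simpa [TemporalGraph.sortedBagSizes] using this
  rw [card_filter_eq_countP (fun i : Fin T => (G.bag i).ncard), ← hperm.countP_eq]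
  exact countP_lt_getD_le hsorted x

/-! ### The instance of a temporal graph -/

/-- A temporal graph as an instance on the natural numbers. -/
def ofGraph {n T : ℕ} (G : TemporalGraph n T) (k ℓ : ℕ) : Inst where
  n := n
  T := T
  k := k
  ℓ := ℓ
  adj i u v := ∃ (hi : i < T) (hu : u < n) (hv : v < n), (G.snapshot ⟨i, hi⟩).Adj ⟨u, hu⟩ ⟨v, hv⟩

variable {n T : ℕ} (G : TemporalGraph n T) (k ℓ : ℕ)

/-- Only starting times matter, because lengthening an interval never destroys domination. -/
theorem timelineDS_iff : G.TimelineDS k ℓ ↔ (ofGraph G k ℓ).Solvable := by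
  classical
  constructor
  · rintro ⟨𝒯, ⟨hlen, hcard⟩, hdom⟩
    refine ⟨fun v => (𝒯.filter fun I => (I.1 : ℕ) = v).image fun I => (I.2.1 : ℕ), ?_, ?_⟩
    · intro v hv
      refine Finset.card_image_le.trans ?_
      refine le_trans (Finset.card_le_card fun I hI => ?_) (hcard ⟨v, hv⟩)
      simp only [Finset.mem_filter] at hI ⊢
      exact ⟨hI.1, Fin.ext hI.2⟩
    · intro i hi u hu
      have h := hdom ⟨u, hu⟩ ⟨i, hi⟩
      simp only [TemporalGraph.Dominates, TemporalGraph.closedNeighborhood, Set.mem_iUnion,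
        Set.mem_insert_iff, SimpleGraph.mem_neighborSet] at h
      obtain ⟨v, ⟨a, b, hI, ha, hb⟩, huv⟩ := h
      refine ⟨v, v.2, ?_, a, ?_, ha, ?_⟩
      · rcases huv with h | h
        · exact Or.inl (congrArg Fin.val h)
        · exact Or.inr ⟨hi, hu, v.2, h.symm⟩
      · exact Finset.mem_image.2 ⟨_, Finset.mem_filter.2 ⟨hI, rfl⟩, rfl⟩
      · have h1 := (hlen _ hI).2
        have h2 : i ≤ (b : ℕ) := hb
        change i ≤ a + ℓ
        simp only at h1
        omega
  · rintro ⟨S, hS, hdom⟩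
    -- Intervals get full length, cut at the last time step; the end is a function of the start, so
    -- the intervals of a vertex inject into its starts.
    refine ⟨Finset.univ.filter fun I => (I.2.1 : ℕ) ∈ S I.1 ∧
      (I.2.2 : ℕ) = min ((I.2.1 : ℕ) + ℓ) (T - 1), ⟨?_, fun v => ?_⟩, fun v i => ?_⟩
    · rintro ⟨v, a, b⟩ hI
      simp only [Finset.mem_filter, Finset.mem_univ, true_and] at hI
      have := a.2
      simp only [Fin.le_def]
      omega
    · refine le_trans ?_ (hS v v.2)
      refine Finset.card_le_card_of_injOn (fun I => (I.2.1 : ℕ)) ?_ ?_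
      · rintro ⟨u, a, b⟩ hI
        simp only [Finset.coe_filter, Finset.mem_filter, Finset.mem_univ, true_and,
          Set.mem_ofPred_eq] at hI
        obtain ⟨⟨h1, -⟩, rfl⟩ := hI
        exact h1
      · rintro ⟨u, a, b⟩ hI ⟨u', a', b'⟩ hI' e
        simp only [Finset.coe_filter, Finset.mem_filter, Finset.mem_univ, true_and,
          Set.mem_ofPred_eq] at hI hI' e
        obtain ⟨⟨-, h1⟩, rfl⟩ := hI
        obtain ⟨⟨-, h2⟩, rfl⟩ := hI'
        obtain rfl := Fin.ext e
        rw [Prod.mk.injEq, Prod.mk.injEq]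
        exact ⟨rfl, rfl, Fin.ext (h1.trans h2.symm)⟩
    · obtain ⟨u, hu, huv, s, hs, h1, h2⟩ := hdom i i.2 v v.2
      change (i : ℕ) ≤ s + ℓ at h2
      simp only [TemporalGraph.Dominates, TemporalGraph.closedNeighborhood, Set.mem_iUnion,
        Set.mem_insert_iff, SimpleGraph.mem_neighborSet]
      have hi := i.2
      refine ⟨⟨u, hu⟩, ⟨⟨s, by omega⟩, ⟨min (s + ℓ) (T - 1), by omega⟩, ?_, h1, ?_⟩, ?_⟩
      · exact Finset.mem_filter.2 ⟨Finset.mem_univ _, hs, rfl⟩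
      · rw [Fin.le_def]
        simp only
        omega
      · rcases huv with h | ⟨_, _, _, h⟩
        · exact Or.inl (Fin.ext h)
        · exact Or.inr h.symm

theorem timelineDS_of_le (h : T ≤ k * (ℓ + 1)) : G.TimelineDS k ℓ := by
  rw [timelineDS_iff]
  refine ⟨fun _ => (Finset.range k).image fun j => j * (ℓ + 1), fun v _ => ?_,
    fun i hi u hu => ⟨u, hu, Or.inl rfl, i / (ℓ + 1) * (ℓ + 1), ?_, ?_, ?_⟩⟩
  · exact Finset.card_image_le.trans (by simp [ofGraph])
  · refine Finset.mem_image.2 ⟨_, Finset.mem_range.2 (Nat.div_lt_of_lt_mul ?_), rfl⟩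
    rw [mul_comm]
    exact (show i < T from hi).trans_le h
  · exact Nat.div_mul_le_self _ _
  · have := Nat.lt_div_mul_add (a := i) (show 0 < ℓ + 1 by omega)
    change i ≤ _ + ℓ
    omega

theorem nonIsolated_iff {i v : ℕ} (hi : i < T) (hv : v < n) :
    (ofGraph G k ℓ).NonIsolated i v ↔ 1 ≤ ((G.snapshot ⟨i, hi⟩).neighborSet ⟨v, hv⟩).ncard := by
  rw [Nat.one_le_iff_ne_zero, ← Nat.pos_iff_ne_zero, Set.ncard_pos]
  constructor
  · rintro ⟨u, hu, _, _, _, h⟩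
    exact ⟨⟨u, hu⟩, h⟩
  · rintro ⟨u, h⟩
    exact ⟨u, u.2, hi, hv, u.2, h⟩

theorem alive_iff_mem_bag {i v : ℕ} (hi : i < T) (hv : v < n) :
    (ofGraph G k ℓ).Alive i v ↔ (⟨v, hv⟩ : Fin n) ∈ G.bag ⟨i, hi⟩ := by
  constructor
  · rintro ⟨⟨p, hp, hpi, h1⟩, q, hq, hiq, h2⟩
    exact ⟨⟨p, hp⟩, ⟨q, hq⟩, hpi, hiq, (nonIsolated_iff G k ℓ hp hv).1 h1,
      (nonIsolated_iff G k ℓ hq hv).1 h2⟩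
  · rintro ⟨p, q, hpi, hiq, h1, h2⟩
    exact ⟨⟨p, p.2, hpi, (nonIsolated_iff G k ℓ p.2 hv).2 h1⟩,
      q, q.2, hiq, (nonIsolated_iff G k ℓ q.2 hv).2 h2⟩

open Classical in
theorem card_alive_eq {i : ℕ} (hi : i < T) :
    ((Finset.range n).filter fun v => (ofGraph G k ℓ).Alive i v).card = (G.bag ⟨i, hi⟩).ncard := by
  rw [Set.ncard_eq_toFinset_card']
  symm
  refine Finset.card_bij (fun v _ => (v : ℕ)) ?_ ?_ ?_
  · intro v hv
    rw [Set.mem_toFinset] at hv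
    exact Finset.mem_filter.2 ⟨Finset.mem_range.2 v.2, (alive_iff_mem_bag G k ℓ hi v.2).2 hv⟩
  · intro u _ v _ e
    exact Fin.ext e
  · intro v hv
    obtain ⟨h1, h2⟩ := Finset.mem_filter.1 hv
    rw [Finset.mem_range] at h1
    exact ⟨⟨v, h1⟩, Set.mem_toFinset.2 ((alive_iff_mem_bag G k ℓ hi h1).1 h2), rfl⟩

/-- Each long-lived vertex lives at a time with a small bag; hence it lives at the last such time
before `i` or at the first one after `i`. -/
theorem width_le {i : ℕ} (hi : i < T) : (ofGraph G k ℓ).width i ≤ 2 * G.vimw (ℓ + 2) := by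
  classical
  set J := ofGraph G k ℓ with hJ
  set w := G.vimw (ℓ + 2) with hw
  set small : ℕ → Prop := fun j => ((Finset.range n).filter fun v => J.Alive j v).card ≤ w
    with hsmall
  have hlarge : ((Finset.range T).filter fun j => ¬ small j).card ≤ ℓ + 1 := by
    refine le_trans (le_of_eq ?_) (card_large_bags_le G (ℓ + 1))
    symm
    refine Finset.card_bij (fun v _ => (v : ℕ)) ?_ ?_ ?_
    · intro j hj
      rw [Finset.mem_filter] at hj ⊢
      refine ⟨Finset.mem_range.2 j.2, ?_⟩
      rw [hsmall]
      simp only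
      rw [card_alive_eq G k ℓ j.2, not_le]
      exact hj.2
    · intro u _ v _ e
      exact Fin.ext e
    · intro j hj
      obtain ⟨h1, h2⟩ := Finset.mem_filter.1 hj
      rw [Finset.mem_range] at h1
      refine ⟨⟨j, h1⟩, ?_, rfl⟩
      rw [hsmall] at h2
      simp only at h2
      rw [card_alive_eq G k ℓ h1, not_le] at h2
      exact Finset.mem_filter.2 ⟨Finset.mem_univ _, h2⟩
  have hex : ∀ v, J.LongAlive i v → ∃ j < T, small j ∧ J.Alive j v := by
    rintro v ⟨-, hl⟩
    by_contra hcon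
    -- Otherwise all steps of the lifetime have large bags, so there are at most `ℓ + 1` of them,
    -- contrary to `Long`.
    have hsub : (Finset.Ico (J.pre v) (T - J.post v)).card ≤ ℓ + 1 := by
      refine (Finset.card_le_card fun j hj => ?_).trans hlarge
      rw [Finset.mem_Ico] at hj
      have hjT : j < T := by omega
      refine Finset.mem_filter.2 ⟨Finset.mem_range.2 hjT, fun hs => hcon ⟨j, hjT, hs, ?_⟩⟩
      rw [Inst.alive_iff (show j < J.T from hjT)]
      exact ⟨hj.1, show j + J.post v < T by omega⟩
    rw [Nat.card_Ico] at hsub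
    have : J.pre v + J.post v + ℓ + 2 ≤ T := hl
    omega
  have conv : ∀ {v a b c : ℕ}, a ≤ b → b ≤ c → a < T → c < T → J.Alive a v → J.Alive c v →
      J.Alive b v := by
    intro v a b c hab hbc ha hc h1 h2
    obtain ⟨⟨p, hp, hpa, h1⟩, -⟩ := h1
    obtain ⟨-, q, hq, hcq, h2⟩ := h2
    exact ⟨⟨p, hp, by omega, h1⟩, q, hq, by omega, h2⟩
  -- Both sides of `i` at once: `R` selects the side and `p` is the small time nearest to `i` on it.
  -- All vertices counted belong to the single small bag at `p`.
  have hside : ∀ R : ℕ → ℕ → Prop, (∀ j, small j → j < T → R j i → ∃ p < T, small p ∧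
      ∀ j < T, small j → R j i → ∀ v, J.Alive i v → J.Alive j v → J.Alive p v) →
      ((Finset.range n).filter fun v => J.Alive i v ∧
        ∃ j < T, small j ∧ R j i ∧ J.Alive j v).card ≤ w := by
    intro R hR
    by_cases hj : ∃ j < T, small j ∧ R j i
    · obtain ⟨j, hjT, hs, hr⟩ := hj
      obtain ⟨p, -, hsp, hp⟩ := hR j hs hjT hr
      refine (Finset.card_le_card fun v hv => ?_).trans hsp
      obtain ⟨hv, ha, j, hjT, hs, hr, hj⟩ := Finset.mem_filter.1 hv
      exact Finset.mem_filter.2 ⟨hv, hp j hjT hs hr v ha hj⟩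
    · rw [Finset.filter_eq_empty_iff.2]
      · simp
      · rintro v - ⟨-, j, hjT, hs, hr, -⟩
        exact hj ⟨j, hjT, hs, hr⟩
  have hA := hside (fun j i => j ≤ i) (by
    intro j hs hjT hji
    set F := (Finset.range (i + 1)).filter small with hF
    have hne : F.Nonempty := ⟨j, Finset.mem_filter.2 ⟨Finset.mem_range.2 (by omega), hs⟩⟩
    obtain ⟨h1, h2⟩ := Finset.mem_filter.1 (F.max'_mem hne)
    rw [Finset.mem_range] at h1
    refine ⟨F.max' hne, by omega, h2, fun j hjT hs hji v hi' hj => ?_⟩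
    exact conv (F.le_max' j (Finset.mem_filter.2 ⟨Finset.mem_range.2 (by omega), hs⟩)) (by omega)
      hjT hi hj hi')
  have hB := hside (fun j i => i ≤ j) (by
    intro j hs hjT hji
    set F := (Finset.Ico i T).filter small with hF
    have hne : F.Nonempty := ⟨j, Finset.mem_filter.2 ⟨Finset.mem_Ico.2 ⟨hji, hjT⟩, hs⟩⟩
    obtain ⟨h1, h2⟩ := Finset.mem_filter.1 (F.min'_mem hne)
    rw [Finset.mem_Ico] at h1
    refine ⟨F.min' hne, h1.2, h2, fun j hjT hs hji v hi' hj => ?_⟩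
    exact conv h1.1 (F.min'_le j (Finset.mem_filter.2 ⟨Finset.mem_Ico.2 ⟨hji, hjT⟩, hs⟩))
      hi hjT hi' hj)
  have hsub : (Finset.range n).filter (fun v => J.LongAlive i v) ⊆
      ((Finset.range n).filter fun v => J.Alive i v ∧ ∃ j < T, small j ∧ j ≤ i ∧ J.Alive j v) ∪
      ((Finset.range n).filter fun v => J.Alive i v ∧ ∃ j < T, small j ∧ i ≤ j ∧ J.Alive j v) := by
    intro v hv
    obtain ⟨hv, hl⟩ := Finset.mem_filter.1 hv
    obtain ⟨j, hjT, hs, hj⟩ := hex v hl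
    rcases le_total j i with hji | hji
    · exact Finset.mem_union_left _ (Finset.mem_filter.2 ⟨hv, hl.1, j, hjT, hs, hji, hj⟩)
    · exact Finset.mem_union_right _ (Finset.mem_filter.2 ⟨hv, hl.1, j, hjT, hs, hji, hj⟩)
  have hle := (Finset.card_le_card hsub).trans (Finset.card_union_le _ _)
  have hw : J.width i = ((Finset.range n).filter fun v => J.LongAlive i v).card := by
    unfold Inst.width
    congr
  refine (hw.trans_le (hle.trans (Nat.add_le_add ?_ ?_))).trans (two_mul _).ge
  · convert hA
  · convert hB

theorem slots_le_vimw : (ofGraph G k ℓ).slots ≤ 2 * G.vimw (ℓ + 2) :=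
  Inst.slots_le fun _ hi => width_le G k ℓ hi

/-! ### The input encoding -/

theorem getElem?_flatMap_of_length {α β : Type*} {f : α → List β} {b : ℕ}
    (hf : ∀ a, (f a).length = b) : ∀ (l : List α) (i j : ℕ) (hi : i < l.length), j < b →
    (l.flatMap f)[i * b + j]? = (f l[i])[j]?
  | [], i, j, hi, _ => absurd hi (by simp)
  | a :: l, 0, j, _, hj => by
      rw [List.flatMap_cons, List.getElem?_append_left (by rw [hf]; omega)]
      simp
  | a :: l, i + 1, j, hi, hj => by
      rw [List.flatMap_cons, List.getElem?_append_right (by rw [hf, add_mul]; omega), hf,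
        show (i + 1) * b + j - b = i * b + j by rw [add_mul]; omega,
        getElem?_flatMap_of_length hf l i j (by simpa using hi) hj]
      simp

open Classical in
theorem encode_adj {i u v : ℕ} (hi : i < T) (hu : u < n) (hv : v < n) :
    (G.encode k ℓ).getD (4 + ((i * n + u) * n + v)) 0 =
      if (ofGraph G k ℓ).adj i u v then 1 else 0 := by
  have hlen : ∀ i : Fin T, ((List.finRange n).flatMap fun u =>
      (List.finRange n).map fun v => if (G.snapshot i).Adj u v then 1 else 0).length = n * n := by
    intro i
    simp [List.length_flatMap]
  rw [TemporalGraph.encode, List.getD_append_right _ _ _ _ (by simp), List.getD_eq_getElem?_getD]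
  simp only [List.length_cons, List.length_nil, zero_add, Nat.reduceAdd, Nat.add_sub_cancel_left]
  rw [show (i * n + u) * n + v = i * (n * n) + (u * n + v) by ring,
    getElem?_flatMap_of_length hlen _ _ _ (by simpa using hi) (by nlinarith),
    getElem?_flatMap_of_length (by simp) _ _ _ (by simpa using hu) hv]
  simp [ofGraph, hi, hu, hv]

theorem encode_le {B : ℕ} (hn : n ≤ B) (hT : T ≤ B) (hk : k ≤ B) (hℓ : ℓ ≤ B) (hB : 1 ≤ B)
    (j : ℕ) : (G.encode k ℓ).getD j 0 ≤ B := by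
  classical
  have hall : ∀ x ∈ G.encode k ℓ, x ≤ B := by
    intro x hx
    simp only [TemporalGraph.encode, List.mem_append, List.mem_cons, List.not_mem_nil, or_false,
      List.mem_flatMap, List.mem_map] at hx
    rcases hx with (rfl | rfl | rfl | rfl) | ⟨i, -, u, -, v, -, rfl⟩
    · exact hn
    · exact hT
    · exact hk
    · exact hℓ
    · split_ifs <;> omega
  by_cases hj : j < (G.encode k ℓ).length
  · rw [List.getD_eq_getElem _ _ hj]
    exact hall _ (List.getElem_mem hj)
  · rw [List.getD_eq_default _ _ (by omega)]
    exact Nat.zero_le _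

end TimelineDP

namespace WordRAM.Expr

/-! ### Logical expressions -/

/-- The number `1` if `p` holds and `0` otherwise. -/
noncomputable def ind (p : Prop) : ℕ := open Classical in if p then 1 else 0

theorem ind_le_one (p : Prop) : ind p ≤ 1 := by
  unfold ind
  split_ifs <;> omega

theorem one_le_ind {p : Prop} : 1 ≤ ind p ↔ p := by
  unfold ind
  split_ifs with h <;> simp [h]

theorem ind_eq_ite (p : Prop) [Decidable p] : ind p = if p then 1 else 0 := by
  unfold ind
  congr

theorem ind_congr {p q : Prop} (h : p ↔ q) : ind p = ind q := by rw [propext h]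

instance : Add Expr := ⟨op .add⟩
instance : Sub Expr := ⟨op .sub⟩
instance : Mul Expr := ⟨op .mul⟩

/-- Truth values are `0` and `1`: the product is conjunction and `le` also serves as implication.
Quantifiers compare a count with `1` or with the size of its range. -/
def not (a : Expr) : Expr := le a (lit 0)
def or (a b : Expr) : Expr := le (lit 1) (a + b)
def lt (a b : Expr) : Expr := le (a + lit 1) b
def eq (a b : Expr) : Expr := le a b * le b a
def ex (x g : ℕ) (a : Expr) : Expr := le (lit 1) (sum x g a)
def all (x g : ℕ) (a : Expr) : Expr := le (var g) (sum x g a)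

section

variable {I : List ℕ} {μ ρ : ℕ → ℕ} {a b : Expr} {p q : Prop}

@[simp] theorem eval_lit (c : ℕ) : (lit c).eval I μ ρ = c := rfl
@[simp] theorem eval_var (j : ℕ) : (var j).eval I μ ρ = ρ j := rfl
@[simp] theorem eval_add : (a + b).eval I μ ρ = a.eval I μ ρ + b.eval I μ ρ := rfl
@[simp] theorem eval_sub : (a - b).eval I μ ρ = a.eval I μ ρ - b.eval I μ ρ := rfl
@[simp] theorem eval_mul : (a * b).eval I μ ρ = a.eval I μ ρ * b.eval I μ ρ := rfl
@[simp] theorem eval_inp : (inp a).eval I μ ρ = I.getD (a.eval I μ ρ) 0 := rfl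
@[simp] theorem eval_mem : (mem a).eval I μ ρ = μ (a.eval I μ ρ) := rfl

theorem eval_bind (x : ℕ) : (bind x a b).eval I μ ρ =
    b.eval I μ (Function.update ρ x (a.eval I μ ρ)) := rfl

theorem eval_sum (x g : ℕ) : (sum x g a).eval I μ ρ =
    ∑ i ∈ Finset.range (ρ g), a.eval I μ (Function.update ρ x i) := rfl

theorem eval_le_ind : (le a b).eval I μ ρ = ind (a.eval I μ ρ ≤ b.eval I μ ρ) := by
  simp [eval, ind]

theorem eval_and (ha : a.eval I μ ρ = ind p) (hb : b.eval I μ ρ = ind q) :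
    (a * b).eval I μ ρ = ind (p ∧ q) := by
  rw [eval_mul, ha, hb]
  unfold ind
  split_ifs <;> simp_all

theorem eval_or (ha : a.eval I μ ρ = ind p) (hb : b.eval I μ ρ = ind q) :
    (or a b).eval I μ ρ = ind (p ∨ q) := by
  rw [or, eval_le_ind, eval_add, ha, hb]
  unfold ind
  split_ifs <;> simp_all

theorem eval_not (ha : a.eval I μ ρ = ind p) : (not a).eval I μ ρ = ind (¬ p) := by
  rw [not, eval_le_ind, ha]
  unfold ind
  split_ifs <;> simp_all

theorem eval_imp (ha : a.eval I μ ρ = ind p) (hb : b.eval I μ ρ = ind q) :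
    (le a b).eval I μ ρ = ind (p → q) := by
  rw [eval_le_ind, ha, hb]
  unfold ind
  split_ifs <;> simp_all

theorem eval_lt : (lt a b).eval I μ ρ = ind (a.eval I μ ρ < b.eval I μ ρ) := eval_le_ind

theorem eval_eq : (eq a b).eval I μ ρ = ind (a.eval I μ ρ = b.eval I μ ρ) := by
  rw [eq, eval_and eval_le_ind eval_le_ind]
  exact ind_congr (by omega)

open Classical in
theorem eval_count {x g : ℕ} {p : ℕ → Prop}
    (h : ∀ i < ρ g, a.eval I μ (Function.update ρ x i) = ind (p i)) :
    (sum x g a).eval I μ ρ = ((Finset.range (ρ g)).filter p).card := by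
  rw [eval_sum, Finset.card_filter]
  refine Finset.sum_congr rfl fun i hi => ?_
  rw [h i (Finset.mem_range.1 hi), ind]

theorem eval_ex {x g : ℕ} {p : ℕ → Prop}
    (h : ∀ i < ρ g, a.eval I μ (Function.update ρ x i) = ind (p i)) :
    (ex x g a).eval I μ ρ = ind (∃ i < ρ g, p i) := by
  classical
  rw [ex, eval_le_ind, eval_count h]
  refine ind_congr (Finset.card_pos.trans ?_)
  simp [Finset.Nonempty]

theorem eval_all {x g : ℕ} {p : ℕ → Prop}
    (h : ∀ i < ρ g, a.eval I μ (Function.update ρ x i) = ind (p i)) :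
    (all x g a).eval I μ ρ = ind (∀ i < ρ g, p i) := by
  classical
  rw [all, eval_le_ind, eval_count h, eval_var]
  refine ind_congr ⟨fun hc i hi => ?_, fun hp => ?_⟩
  · have := Finset.eq_of_subset_of_card_le (Finset.filter_subset p (Finset.range (ρ g)))
      (by simpa using hc)
    rw [← Finset.mem_range, ← this] at hi
    exact (Finset.mem_filter.1 hi).2
  · rw [Finset.filter_true_of_mem (by simpa using hp)]
    simp

/-- Division by counting multiples. -/
theorem card_filter_mul_le {m d z : ℕ} (hd : 0 < d) (h : z / d ≤ m) :
    ((Finset.range m).filter fun q => (q + 1) * d ≤ z).card = z / d := by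
  rw [show (Finset.range m).filter (fun q => (q + 1) * d ≤ z) = Finset.range (z / d) from ?_,
    Finset.card_range]
  ext q
  rw [Finset.mem_filter, Finset.mem_range, Finset.mem_range, ← Nat.le_div_iff_mul_le hd]
  omega

/-- Register `g` only limits the search and need not be sharp; the cost of a division is thus
proportional to any known bound on its quotient. -/
theorem eval_div {x g : ℕ} {d z : Expr}
    (hd : ∀ i, (var x + lit 1) * d = a → d.eval I μ (Function.update ρ x i) = d.eval I μ ρ)
    (hz : ∀ i, z.eval I μ (Function.update ρ x i) = z.eval I μ ρ)
    (ha : (var x + lit 1) * d = a) (hpos : 0 < d.eval I μ ρ)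
    (hle : z.eval I μ ρ / d.eval I μ ρ ≤ ρ g) :
    (sum x g (le a z)).eval I μ ρ = z.eval I μ ρ / d.eval I μ ρ := by
  classical
  subst ha
  rw [eval_count (p := fun q => (q + 1) * d.eval I μ ρ ≤ z.eval I μ ρ)]
  · convert card_filter_mul_le hpos hle
  · intro i _
    rw [eval_le_ind, hz]
    simp [hd i rfl]

end

end WordRAM.Expr

namespace TimelineDP

open WordRAM WordRAM.Expr

/-! ### The expressions of the algorithm

Registers `0, …, 8` hold the numbers `n`, `T`, `k`, `ℓ`, the number of states of a vertex, the number
of joint states, `n + 1`, the size of the table of quotients and the size of the table of reachable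
joint states; register `9` is a loop counter. -/

/-- Bound variables occupy registers `34` to `50`, numbered so that no expression rebinds a register
holding one of its arguments; hypotheses such as `i < 49` in the evaluation lemmas ensure this. -/
def adjE (i u v : ℕ) : Expr := inp (lit 4 + ((var i * var 0 + var u) * var 0 + var v))
def nonIsolatedE (i v : ℕ) : Expr := ex 50 0 (adjE i v 50)
def sinceE (i v : ℕ) : Expr := ex 49 1 (le (var 49) (var i) * nonIsolatedE 49 v)
def untilE (i v : ℕ) : Expr := ex 49 1 (le (var i) (var 49) * nonIsolatedE 49 v)
def aliveE (i v : ℕ) : Expr := sinceE i v * untilE i v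
def preE (v : ℕ) : Expr := sum 48 1 (Expr.not (sinceE 48 v))
def postE (v : ℕ) : Expr := sum 48 1 (Expr.not (untilE 48 v))
def leftE (v : ℕ) : Expr := sum 47 1 (Expr.lt (var 47 * (var 3 + lit 1)) (preE v))
def rightE (v : ℕ) : Expr := sum 47 1 (Expr.lt (var 47 * (var 3 + lit 1)) (postE v))
def longE (v : ℕ) : Expr := le (preE v + postE v + var 3 + lit 2) (var 1)
def longAliveE (i v : ℕ) : Expr := aliveE i v * longE v
def rankE (i v : ℕ) : Expr := sum 46 0 (Expr.lt (var 46) (var v) * longAliveE i 46)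
def widthE (i : ℕ) : Expr := sum 46 0 (longAliveE i 46)
def slotE (c : ℕ) : Expr := ex 45 1 (Expr.lt (var c) (widthE 45))
def digitE (i v x : ℕ) : Expr := longAliveE i v *
  (mem (var x * var 6 + rankE i v) - var 4 * mem (var x * var 6 + rankE i v + lit 1))
def prevDigitE (i v x : ℕ) : Expr :=
  le (lit 1) (var i) * bind 44 (var i - lit 1) (digitE 44 v x)
def countE (d : ℕ) : Expr := sum 43 2 (le ((var 43 + lit 1) * (var 3 + lit 2)) (var d))
def remE (d : ℕ) : Expr := var d - countE d * (var 3 + lit 2)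
def transE (v d d' : ℕ) : Expr :=
  Expr.or (Expr.eq (var d') (var d - le (lit 1) (remE d)))
    (Expr.eq (var d') (countE d * (var 3 + lit 2) + (lit 2 * var 3 + lit 3)) *
      le (countE d + lit 1 + leftE v + rightE v) (var 2))
def fixedE (i v : ℕ) : Expr :=
  Expr.or (Expr.not (aliveE i v)) (Expr.or (Expr.lt (var i) (leftE v * (var 3 + lit 1)))
    (Expr.or (le (var 1) (var i + rightE v * (var 3 + lit 1)))
      (Expr.not (longE v) * le (leftE v + rightE v + lit 1) (var 2))))
def activeE (i v x : ℕ) : Expr :=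
  Expr.or (fixedE i v) (bind 42 (digitE i v x) (le (lit 1) (remE 42)))
def domE (i x : ℕ) : Expr :=
  all 40 0 (ex 41 0 (Expr.or (Expr.eq (var 40) (var 41)) (adjE i 40 41) * activeE i 41 x))
def stepE (i x x' : ℕ) : Expr :=
  all 40 0 (le (longAliveE i 40)
    (bind 38 (prevDigitE i 40 x) (bind 39 (digitE i 40 x') (transE 40 38 39)))) * domE i x'
def reachE (i x' : ℕ) : Expr :=
  ex 37 5 (Expr.or (le (var i) (lit 0))
    (le (lit 1) (mem (var 7 + ((var i - lit 1) * var 5 + var 37)))) * stepE i 37 x')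
def reachEntryE : Expr :=
  bind 35 (sum 34 1 (le ((var 34 + lit 1) * var 5) (var 9)))
    (bind 36 (var 9 - var 35 * var 5) (reachE 35 36))
def quotientEntryE : Expr :=
  bind 35 (sum 34 5 (le ((var 34 + lit 1) * var 6) (var 9)))
    (bind 36 (var 9 - var 35 * var 6) (le (var 36) (lit 0) * var 35 +
      le (lit 1) (var 36) * sum 34 5 (le ((var 34 + lit 1) * var 4) (mem (var 9 - lit 1)))))
def answerE : Expr :=
  all 40 0 (le (leftE 40 + rightE 40) (var 2)) *
    ex 37 5 (le (lit 1) (mem (var 7 + ((var 1 - lit 1) * var 5 + var 37))))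

/-- The registers hold the parameters of the instance, and the input its adjacency matrices. -/
structure Env (J : Inst) (I : List ℕ) (ρ : ℕ → ℕ) : Prop where
  n : ρ 0 = J.n
  T : ρ 1 = J.T
  k : ρ 2 = J.k
  ℓ : ρ 3 = J.ℓ
  input : ∀ i < J.T, ∀ u < J.n, ∀ v < J.n,
    I.getD (4 + ((i * J.n + u) * J.n + v)) 0 = ind (J.adj i u v)

/-- The registers also hold the derived parameters, and the memory holds the table of quotients. -/
structure FullEnv (J : Inst) (I : List ℕ) (ρ μ : ℕ → ℕ) : Prop extends Env J I ρ where
  base : ρ 4 = J.base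
  states : ρ 5 = J.states
  succ : ρ 6 = J.n + 1
  size : ρ 7 = J.states * (J.n + 1)
  table : ∀ x < J.states, ∀ j ≤ J.n, μ (x * (J.n + 1) + j) = x / J.base ^ j

/-! ### Values of the expressions of the algorithm -/

variable {J : Inst} {I : List ℕ} {ρ μ : ℕ → ℕ}

theorem Env.update (h : Env J I ρ) {x : ℕ} (hx : 9 ≤ x) (y : ℕ) :
    Env J I (Function.update ρ x y) where
  n := by rw [Function.update_of_ne (by omega), h.n]
  T := by rw [Function.update_of_ne (by omega), h.T]
  k := by rw [Function.update_of_ne (by omega), h.k]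
  ℓ := by rw [Function.update_of_ne (by omega), h.ℓ]
  input := h.input

theorem FullEnv.update (h : FullEnv J I ρ μ) {x : ℕ} (hx : 9 ≤ x) (y : ℕ) :
    FullEnv J I (Function.update ρ x y) μ where
  toEnv := h.toEnv.update hx y
  base := by rw [Function.update_of_ne (by omega), h.base]
  states := by rw [Function.update_of_ne (by omega), h.states]
  succ := by rw [Function.update_of_ne (by omega), h.succ]
  size := by rw [Function.update_of_ne (by omega), h.size]
  table := h.table

theorem eval_adjE (h : Env J I ρ) {i u v : ℕ} (hi : ρ i < J.T) (hu : ρ u < J.n) (hv : ρ v < J.n) :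
    (adjE i u v).eval I μ ρ = ind (J.adj (ρ i) (ρ u) (ρ v)) := by
  simp only [adjE, eval_inp, eval_add, eval_mul, eval_lit, eval_var, h.n]
  exact h.input _ hi _ hu _ hv

theorem eval_nonIsolatedE (h : Env J I ρ) {i v : ℕ} (hi' : i < 50) (hv' : v < 50)
    (hi : ρ i < J.T) (hv : ρ v < J.n) :
    (nonIsolatedE i v).eval I μ ρ = ind (J.NonIsolated (ρ i) (ρ v)) := by
  rw [nonIsolatedE, eval_ex (p := fun u => J.adj (ρ i) (ρ v) u), h.n, Inst.NonIsolated]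
  intro u hu
  rw [h.n] at hu
  rw [eval_adjE (h.update (by omega) u)] <;>
    simp [hi'.ne, hv'.ne, hi, hv, hu]

theorem eval_sinceE (h : Env J I ρ) {i v : ℕ} (hi' : i < 49) (hv' : v < 49) (hv : ρ v < J.n) :
    (sinceE i v).eval I μ ρ = ind (J.Since (ρ i) (ρ v)) := by
  rw [sinceE, eval_ex (p := fun p => p ≤ ρ i ∧ J.NonIsolated p (ρ v)), h.T, Inst.Since]
  intro p hp
  rw [h.T] at hp
  refine eval_and ?_ ?_
  · simp [eval_le_ind, hi'.ne]
  · rw [eval_nonIsolatedE (h.update (by omega) p) (by omega) (by omega) (by simpa using hp)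
      (by simpa [hv'.ne] using hv)]
    simp [hv'.ne]

theorem eval_untilE (h : Env J I ρ) {i v : ℕ} (hi' : i < 49) (hv' : v < 49) (hv : ρ v < J.n) :
    (untilE i v).eval I μ ρ = ind (J.Until (ρ i) (ρ v)) := by
  rw [untilE, eval_ex (p := fun p => ρ i ≤ p ∧ J.NonIsolated p (ρ v)), h.T, Inst.Until]
  intro p hp
  rw [h.T] at hp
  refine eval_and ?_ ?_
  · simp [eval_le_ind, hi'.ne]
  · rw [eval_nonIsolatedE (h.update (by omega) p) (by omega) (by omega) (by simpa using hp)
      (by simpa [hv'.ne] using hv)]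
    simp [hv'.ne]

theorem eval_aliveE (h : Env J I ρ) {i v : ℕ} (hi' : i < 49) (hv' : v < 49) (hv : ρ v < J.n) :
    (aliveE i v).eval I μ ρ = ind (J.Alive (ρ i) (ρ v)) :=
  eval_and (eval_sinceE h hi' hv' hv) (eval_untilE h hi' hv' hv)

theorem eval_preE (h : Env J I ρ) {v : ℕ} (hv' : v < 48) (hv : ρ v < J.n) :
    (preE v).eval I μ ρ = J.pre (ρ v) := by
  rw [preE, eval_count (p := fun i => ¬ J.Since i (ρ v)), h.T, Inst.pre]
  · congr!
  · intro i _
    refine eval_not ?_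
    rw [eval_sinceE (h.update (by omega) i) (by omega) (by omega) (by simpa [hv'.ne] using hv)]
    simp [hv'.ne]

theorem eval_postE (h : Env J I ρ) {v : ℕ} (hv' : v < 48) (hv : ρ v < J.n) :
    (postE v).eval I μ ρ = J.post (ρ v) := by
  rw [postE, eval_count (p := fun i => ¬ J.Until i (ρ v)), h.T, Inst.post]
  · congr!
  · intro i _
    refine eval_not ?_
    rw [eval_untilE (h.update (by omega) i) (by omega) (by omega) (by simpa [hv'.ne] using hv)]
    simp [hv'.ne]

open Classical in
theorem card_lt_need {T ℓ f : ℕ} (hf : f ≤ T) :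
    ((Finset.range T).filter fun j => j * (ℓ + 1) < f).card = need ℓ f := by
  rw [show (Finset.range T).filter (fun j => j * (ℓ + 1) < f) = Finset.range (need ℓ f) from ?_,
    Finset.card_range]
  ext j
  rw [Finset.mem_filter, Finset.mem_range, Finset.mem_range, lt_need]
  refine and_iff_right_of_imp fun h => ?_
  nlinarith

theorem eval_leftE (h : Env J I ρ) {v : ℕ} (hv' : v < 47) (hv : ρ v < J.n) :
    (leftE v).eval I μ ρ = J.left (ρ v) := by
  classical
  rw [leftE, eval_count (p := fun j => j * (J.ℓ + 1) < J.pre (ρ v)), h.T, Inst.left,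
    ← card_lt_need (J.pre_le _)]
  · congr!
  · intro i _
    rw [eval_lt, eval_preE (h.update (by omega) i) (by omega) (by simpa [hv'.ne] using hv)]
    simp [hv'.ne, h.ℓ]

theorem eval_rightE (h : Env J I ρ) {v : ℕ} (hv' : v < 47) (hv : ρ v < J.n) :
    (rightE v).eval I μ ρ = J.right (ρ v) := by
  classical
  rw [rightE, eval_count (p := fun j => j * (J.ℓ + 1) < J.post (ρ v)), h.T, Inst.right,
    ← card_lt_need (J.post_le _)]
  · congr!
  · intro i _
    rw [eval_lt, eval_postE (h.update (by omega) i) (by omega) (by simpa [hv'.ne] using hv)]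
    simp [hv'.ne, h.ℓ]

theorem eval_longE (h : Env J I ρ) {v : ℕ} (hv' : v < 48) (hv : ρ v < J.n) :
    (longE v).eval I μ ρ = ind (J.Long (ρ v)) := by
  rw [longE, eval_le_ind]
  simp only [eval_add, eval_var, eval_lit, eval_preE h hv' hv, eval_postE h hv' hv, h.ℓ, h.T,
    Inst.Long]

theorem eval_longAliveE (h : Env J I ρ) {i v : ℕ} (hi' : i < 48) (hv' : v < 48)
    (hv : ρ v < J.n) : (longAliveE i v).eval I μ ρ = ind (J.LongAlive (ρ i) (ρ v)) :=
  eval_and (eval_aliveE h (by omega) (by omega) hv) (eval_longE h hv' hv)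

theorem eval_rankE (h : Env J I ρ) {i v : ℕ} (hi' : i < 46) (hv' : v < 46) :
    (rankE i v).eval I μ ρ = J.rank (ρ i) (ρ v) := by
  rw [rankE, eval_count (p := fun u => u < ρ v ∧ J.LongAlive (ρ i) u), h.n, Inst.rank]
  · congr!
  · intro u hu
    rw [h.n] at hu
    refine eval_and ?_ ?_
    · simp [eval_lt, hv'.ne]
    · rw [eval_longAliveE (h.update (by omega) u) (by omega) (by omega) (by simpa using hu)]
      simp [hi'.ne]

theorem eval_widthE (h : Env J I ρ) {i : ℕ} (hi' : i < 46) :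
    (widthE i).eval I μ ρ = J.width (ρ i) := by
  rw [widthE, eval_count (p := fun u => J.LongAlive (ρ i) u), h.n, Inst.width]
  intro u hu
  rw [h.n] at hu
  rw [eval_longAliveE (h.update (by omega) u) (by omega) (by omega) (by simpa using hu)]
  simp [hi'.ne]

theorem eval_slotE (h : Env J I ρ) {c : ℕ} (hc : c < 45) :
    (slotE c).eval I μ ρ = ind (∃ i < J.T, ρ c < J.width i) := by
  rw [slotE, eval_ex (p := fun i => ρ c < J.width i), h.T]
  intro i _
  rw [eval_lt, eval_widthE (h.update (by omega) i)] <;> simp [hc.ne]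

/-- The digit of rank `r` is `q_r - base * q_{r+1}` for two adjacent table entries `q_j = x / base ^
j`. For vertices without a digit, the factor `longAliveE` cancels whatever was looked up. -/
theorem eval_digitE (h : FullEnv J I ρ μ) {i v x : ℕ} (hi' : i < 46) (hv' : v < 46)
    (hv : ρ v < J.n) (hx : ρ x < J.states) :
    (digitE i v x).eval I μ ρ = J.digit (ρ i) (ρ v) (ρ x) := by
  classical
  simp only [digitE, eval_mul, eval_sub, eval_mem, eval_add, eval_var, eval_lit,
    eval_rankE h.toEnv hi' hv', eval_longAliveE h.toEnv (show i < 48 by omega)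
    (show v < 48 by omega) hv, h.succ, h.base, Inst.digit]
  by_cases hl : J.LongAlive (ρ i) (ρ v)
  · have hr : J.rank (ρ i) (ρ v) < J.n :=
      (Inst.rank_lt_width hv hl).trans_le ((Finset.card_filter_le _ _).trans (by simp))
    rw [if_pos hl, h.table _ hx _ hr.le, add_assoc, h.table _ hx _ hr, ind, if_pos hl, one_mul,
      pow_succ, ← Nat.div_div_eq_div_mul]
    have := Nat.div_add_mod (ρ x / J.base ^ J.rank (ρ i) (ρ v)) J.base
    omega
  · rw [if_neg hl, ind, if_neg hl, zero_mul]

theorem eval_prevDigitE (h : FullEnv J I ρ μ) {i v x : ℕ} (hv' : v < 44) (hx' : x < 44)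
    (hv : ρ v < J.n) (hx : ρ x < J.states) :
    (prevDigitE i v x).eval I μ ρ = J.prevDigit (ρ i) (ρ v) (ρ x) := by
  rw [prevDigitE, eval_mul, eval_le_ind, eval_bind, eval_digitE (h.update (by omega) _)
    (by omega) (by omega) (by simpa [hv'.ne] using hv) (by simpa [hx'.ne] using hx)]
  simp only [Function.update_self, Function.update_of_ne hv'.ne, Function.update_of_ne hx'.ne,
    eval_lit, eval_var, eval_sub, Inst.prevDigit, ind_eq_ite]
  split_ifs <;> simp

theorem eval_countE (h : Env J I ρ) {d : ℕ} (hd' : d < 43) (hd : ρ d < J.base) :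
    (countE d).eval I μ ρ = ρ d / (J.ℓ + 2) := by
  rw [countE, eval_div (d := var 3 + lit 2) (z := var d) _ _ rfl]
  · simp [h.ℓ]
  · simp
  · simp only [eval_var, eval_add, eval_lit, h.ℓ, h.k]
    -- The state is below `(k + 1) * (ℓ + 2)`, so the count is at most `k`, the content of the
    -- bounding register `2`.
    rw [← Nat.lt_add_one_iff, Nat.div_lt_iff_lt_mul (by omega)]
    exact hd
  · intro i _
    simp
  · intro i
    simp [hd'.ne]

theorem eval_remE (h : Env J I ρ) {d : ℕ} (hd' : d < 43) (hd : ρ d < J.base) :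
    (remE d).eval I μ ρ = ρ d % (J.ℓ + 2) := by
  rw [remE]
  simp only [eval_sub, eval_var, eval_mul, eval_countE h hd' hd, eval_add, eval_lit, h.ℓ]
  have := Nat.div_add_mod' (ρ d) (J.ℓ + 2)
  omega

theorem eval_transE (h : Env J I ρ) {v d d' : ℕ} (hv' : v < 43) (hd' : d < 43)
    (hv : ρ v < J.n) (hd : ρ d < J.base) :
    (transE v d d').eval I μ ρ = ind (J.Trans (ρ v) (ρ d) (ρ d')) := by
  refine eval_or ?_ (eval_and ?_ ?_)
  · rw [eval_eq]
    simp only [eval_var, eval_sub, eval_le_ind, eval_remE h hd' hd, eval_lit,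
      ind_eq_ite (1 ≤ ρ d % (J.ℓ + 2))]
  · rw [eval_eq]
    simp only [eval_var, eval_add, eval_mul, eval_countE h hd' hd, eval_lit, h.ℓ]
  · rw [eval_le_ind]
    simp only [eval_var, eval_add, eval_countE h hd' hd, eval_lit, h.k,
      eval_leftE h (show v < 47 by omega) hv, eval_rightE h (show v < 47 by omega) hv]

theorem eval_fixedE (h : Env J I ρ) {i v : ℕ} (hi' : i < 47) (hv' : v < 47) (hv : ρ v < J.n) :
    (fixedE i v).eval I μ ρ = ind (J.Fixed (ρ i) (ρ v)) := by
  refine eval_or (eval_not (eval_aliveE h (by omega) (by omega) hv)) (eval_or ?_ (eval_or ?_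
    (eval_and (eval_not (eval_longE h (by omega) hv)) ?_)))
  · rw [eval_lt]
    simp only [eval_var, eval_add, eval_mul, eval_lit, h.ℓ, eval_leftE h hv' hv]
  · rw [eval_le_ind]
    simp only [eval_var, eval_add, eval_mul, eval_lit, h.ℓ, h.T, eval_rightE h hv' hv]
  · rw [eval_le_ind]
    simp only [eval_var, eval_add, eval_lit, h.k, eval_leftE h hv' hv, eval_rightE h hv' hv]

theorem digit_lt (i v x : ℕ) : J.digit i v x < J.base := by
  rw [Inst.digit]
  split_ifs
  · exact Nat.mod_lt _ Inst.base_pos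
  · exact Inst.base_pos

theorem prevDigit_lt (i v x : ℕ) : J.prevDigit i v x < J.base := by
  rw [Inst.prevDigit]
  split_ifs
  · exact digit_lt _ _ _
  · exact Inst.base_pos

theorem eval_activeE (h : FullEnv J I ρ μ) {i v x : ℕ} (hi' : i < 46) (hv' : v < 46)
    (hv : ρ v < J.n) (hx : ρ x < J.states) :
    (activeE i v x).eval I μ ρ = ind (J.Active (ρ i) (ρ v) (ρ x)) := by
  refine eval_or (eval_fixedE h.toEnv (by omega) (by omega) hv) ?_
  rw [eval_bind, eval_le_ind, eval_digitE h hi' hv' hv hx,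
    eval_remE (h.toEnv.update (by omega) _) (by omega) (by simpa using digit_lt _ _ _)]
  simp

theorem eval_domE (h : FullEnv J I ρ μ) {i x : ℕ} (hi' : i < 40) (hx' : x < 40) (hi : ρ i < J.T)
    (hx : ρ x < J.states) :
    (domE i x).eval I μ ρ = ind (J.Dom (ρ i) (ρ x)) := by
  rw [domE, eval_all (p := fun u => ∃ v < J.n, (u = v ∨ J.adj (ρ i) u v) ∧
    J.Active (ρ i) v (ρ x)), h.n, Inst.Dom]
  intro u hu
  rw [h.n] at hu
  have h1 := h.update (x := 40) (by omega) u
  rw [eval_ex (p := fun v => (u = v ∨ J.adj (ρ i) u v) ∧ J.Active (ρ i) v (ρ x)), h1.n]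
  intro v hv
  rw [h1.n] at hv
  have h2 := h1.update (x := 41) (by omega) v
  have e1 : Function.update (Function.update ρ 40 u) 41 v i = ρ i := by
    rw [Function.update_of_ne (by omega), Function.update_of_ne (by omega)]
  have e2 : Function.update (Function.update ρ 40 u) 41 v x = ρ x := by
    rw [Function.update_of_ne (by omega), Function.update_of_ne (by omega)]
  have e3 : Function.update (Function.update ρ 40 u) 41 v 40 = u := by simp
  have e4 : Function.update (Function.update ρ 40 u) 41 v 41 = v := by simp
  refine eval_and (eval_or ?_ ?_) ?_
  · rw [eval_eq, eval_var, eval_var, e3, e4]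
  · rw [eval_adjE h2.toEnv (by rwa [e1]) (by rwa [e3]) (by rwa [e4]), e1, e3, e4]
  · rw [eval_activeE h2 (by omega) (by omega) (by rwa [e4]) (by rwa [e2]), e1, e2, e4]

theorem eval_stepE (h : FullEnv J I ρ μ) {i x x' : ℕ} (hi' : i < 38) (hx₁ : x < 38) (hx₂ : x' < 38)
    (hi : ρ i < J.T) (hx : ρ x < J.states) (hx' : ρ x' < J.states) :
    (stepE i x x').eval I μ ρ = ind (J.Step (ρ i) (ρ x) (ρ x')) := by
  refine eval_and ?_ (eval_domE h (by omega) (by omega) hi hx')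
  rw [eval_all (p := fun v => J.LongAlive (ρ i) v → J.Trans v (J.prevDigit (ρ i) v (ρ x))
    (J.digit (ρ i) v (ρ x'))), h.n]
  intro v hv
  rw [h.n] at hv
  have h1 := h.update (x := 40) (by omega) v
  have e1 : ∀ j < 38, Function.update ρ 40 v j = ρ j := fun j hj => by
    rw [Function.update_of_ne (by omega)]
  have e2 : Function.update ρ 40 v 40 = v := by simp
  refine eval_imp ?_ ?_
  · rw [eval_longAliveE h1.toEnv (by omega) (by omega) (by rwa [e2]), e2, e1 i hi']
  · rw [eval_bind, eval_prevDigitE h1 (by omega) (by omega) (by rwa [e2]) (by rwa [e1 x hx₁]),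
      e2, e1 i hi', e1 x hx₁]
    set y := J.prevDigit (ρ i) v (ρ x) with hy
    have h2 := h1.update (x := 38) (by omega) y
    have f1 : ∀ j < 38, Function.update (Function.update ρ 40 v) 38 y j = ρ j := fun j hj => by
      rw [Function.update_of_ne (by omega), e1 j hj]
    have f2 : Function.update (Function.update ρ 40 v) 38 y 40 = v := by simp
    rw [eval_bind, eval_digitE h2 (by omega) (by omega) (by rwa [f2]) (by rwa [f1 x' hx₂]), f2,
      f1 i hi', f1 x' hx₂]
    rw [eval_transE (h2.toEnv.update (by omega) _) (by omega) (by omega)]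
    · simp
    · simpa using hv
    · simpa using prevDigit_lt _ _ _

/-- The table of reachable joint states is correct for all entries before `m`. -/
def TableUpTo (J : Inst) (μ : ℕ → ℕ) (m : ℕ) : Prop :=
  ∀ i < J.T, ∀ x < J.states, i * J.states + x < m →
    μ (J.states * (J.n + 1) + (i * J.states + x)) = ind (J.Reach i x)

/-- The table is filled row by row, so the preceding row is complete. In row `0` every predecessor
is admitted, which `step_zero` makes irrelevant, and the truncated index `i - 1` is harmless. -/
theorem eval_reachE (h : FullEnv J I ρ μ) {i x' : ℕ} (hi' : i < 37) (hx₂ : x' < 37)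
    (hi : ρ i < J.T) (hx' : ρ x' < J.states)
    (ht : TableUpTo J μ (ρ i * J.states + ρ x')) :
    (reachE i x').eval I μ ρ = ind (J.Reach (ρ i) (ρ x')) := by
  have hpos : 0 < J.states := by omega
  rw [reachE, eval_ex (p := fun x => (ρ i ≤ 0 ∨ 1 ≤ μ (J.states * (J.n + 1) +
    ((ρ i - 1) * J.states + x))) ∧ J.Step (ρ i) x (ρ x')), h.states]
  · refine ind_congr ?_
    generalize ρ i = t at *
    cases t with
    | zero =>
      rw [Inst.Reach]
      constructor
      · rintro ⟨x, -, -, hx⟩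
        exact Inst.step_zero.1 hx
      · exact fun hs => ⟨0, hpos, Or.inl le_rfl, Inst.step_zero.1 hs⟩
    | succ t =>
      rw [Inst.Reach]
      refine exists_congr fun x => and_congr_right fun hx => and_congr_left fun _ => ?_
      rw [Nat.add_sub_cancel, ht t (by omega) x hx (by rw [add_mul]; omega), one_le_ind]
      simp
  · intro x hx
    rw [h.states] at hx
    have h1 := h.update (x := 37) (by omega) x
    refine eval_and (eval_or ?_ ?_) ?_
    · simp [eval_le_ind, hi'.ne]
    · simp [eval_le_ind, hi'.ne, h.size, h.states]
    · rw [eval_stepE h1 (by omega) (by omega) (by omega)] <;> simp [hi'.ne, hx₂.ne, hi, hx, hx']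

theorem eval_reachEntryE (h : FullEnv J I ρ μ) (hy : ρ 9 < J.T * J.states)
    (ht : TableUpTo J μ (ρ 9)) :
    reachEntryE.eval I μ ρ = ind (J.Reach (ρ 9 / J.states) (ρ 9 % J.states)) := by
  have hpos : 0 < J.states := Nat.pos_of_mul_pos_left (by omega : 0 < J.T * J.states)
  have hdiv : ρ 9 / J.states < J.T := Nat.div_lt_of_lt_mul (by rwa [mul_comm])
  have hmod := Nat.mod_lt (ρ 9) hpos
  have hdm := Nat.div_add_mod' (ρ 9) J.states
  rw [reachEntryE, eval_bind, eval_div (d := var 5) (z := var 9) _ _ rfl]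
  rotate_left
  · rw [eval_var, h.states]; exact hpos
  · rw [eval_var, eval_var, h.states, h.T]; exact hdiv.le
  · intro i _; simp
  · intro i; simp
  have h1 := h.update (x := 35) (by omega) (ρ 9 / J.states)
  rw [eval_bind]
  simp only [eval_var, h.states, eval_sub, eval_mul, Function.update_self]
  simp only [ne_eq, Nat.reduceEqDiff, not_false_eq_true, Function.update_of_ne, h.states]
  rw [show ρ 9 - ρ 9 / J.states * J.states = ρ 9 % J.states by omega]
  have h2 := h1.update (x := 36) (by omega) (ρ 9 % J.states)
  rw [eval_reachE h2 (by omega) (by omega)]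
  · simp
  · simpa using hdiv
  · simpa using hmod
  · simpa [hdm] using ht

/-- Entry `x * (n + 1) + j` arises from its predecessor by one division by `base`, or is `x` itself
if `j = 0`. Powers `base ^ j` with `j ≤ n`, which might exceed the word bound, are never formed; all
quotients stay below the number of states. -/
theorem eval_quotientEntryE {s : ℕ} (h4 : ρ 4 = J.base) (h5 : ρ 5 = s) (h6 : ρ 6 = J.n + 1)
    (hy : ρ 9 < s * (J.n + 1)) (ht : ∀ y < ρ 9, μ y = y / (J.n + 1) / J.base ^ (y % (J.n + 1))) :
    quotientEntryE.eval I μ ρ = ρ 9 / (J.n + 1) / J.base ^ (ρ 9 % (J.n + 1)) := by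
  have hdiv : ρ 9 / (J.n + 1) < s := Nat.div_lt_of_lt_mul (by rwa [mul_comm])
  have hdm := Nat.div_add_mod' (ρ 9) (J.n + 1)
  have hmod := Nat.mod_lt (ρ 9) (show 0 < J.n + 1 by omega)
  rw [quotientEntryE, eval_bind, eval_div (d := var 6) (z := var 9) _ _ rfl]
  rotate_left
  · rw [eval_var, h6]; omega
  · rw [eval_var, eval_var, h6, h5]; exact hdiv.le
  · intro i _; simp
  · intro i; simp
  rw [eval_bind]
  simp only [eval_var, h6, eval_sub, eval_mul, Function.update_self]
  simp only [ne_eq, Nat.reduceEqDiff, not_false_eq_true, Function.update_of_ne, h6]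
  rw [show ρ 9 - ρ 9 / (J.n + 1) * (J.n + 1) = ρ 9 % (J.n + 1) by omega]
  simp only [eval_add, eval_mul, eval_le_ind, eval_var, eval_lit, Function.update_self]
  simp only [ne_eq, Nat.reduceEqDiff, not_false_eq_true, Function.update_of_ne,
    Function.update_self]
  by_cases hz : ρ 9 % (J.n + 1) = 0
  · simp [hz, ind]
  · have hle : 1 ≤ ρ 9 % (J.n + 1) := by omega
    have e1 : ρ 9 - 1 = (ρ 9 % (J.n + 1) - 1) + (ρ 9 / (J.n + 1)) * (J.n + 1) := by omega
    have e2 : (ρ 9 - 1) / (J.n + 1) = ρ 9 / (J.n + 1) := by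
      rw [e1, Nat.add_mul_div_right _ _ (by omega), Nat.div_eq_of_lt (by omega), zero_add]
    have e3 : (ρ 9 - 1) % (J.n + 1) = ρ 9 % (J.n + 1) - 1 := by
      rw [e1, Nat.add_mul_mod_self_right, Nat.mod_eq_of_lt (by omega)]
    have e4 : μ (ρ 9 - 1) / J.base = ρ 9 / (J.n + 1) / J.base ^ (ρ 9 % (J.n + 1)) := by
      rw [ht (ρ 9 - 1) (by omega), e2, e3, Nat.div_div_eq_div_mul, ← pow_succ,
        Nat.sub_add_cancel hle]
    rw [eval_div (d := var 4) (z := mem (var 9 - lit 1)) _ _ rfl]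
    · simp [ind, hz, hle, h4, e4]
    · simp [h4, Inst.base_pos]
    · simp only [eval_var, eval_mem, eval_sub, eval_lit, ne_eq, Nat.reduceEqDiff,
        not_false_eq_true, Function.update_of_ne, h4, h5, e4]
      exact (Nat.div_le_self _ _).trans hdiv.le
    · intro i _; simp
    · intro i; simp

theorem eval_answerE (h : FullEnv J I ρ μ) (hT : 1 ≤ J.T)
    (ht : TableUpTo J μ (J.T * J.states)) :
    answerE.eval I μ ρ = ind ((∀ v < J.n, J.left v + J.right v ≤ J.k) ∧
      ∃ x < J.states, J.Reach (J.T - 1) x) := by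
  refine eval_and ?_ ?_
  · rw [eval_all (p := fun v => J.left v + J.right v ≤ J.k), h.n]
    intro v hv
    rw [h.n] at hv
    have h1 := h.toEnv.update (x := 40) (by omega) v
    rw [eval_le_ind, eval_add, eval_leftE h1 (by omega) (by simpa using hv),
      eval_rightE h1 (by omega) (by simpa using hv)]
    simp [h.k]
  · rw [eval_ex (p := fun x => J.Reach (J.T - 1) x), h.states]
    intro x hx
    rw [h.states] at hx
    rw [eval_le_ind]
    simp only [eval_lit, eval_mem, eval_add, eval_var, eval_mul, eval_sub, ne_eq,
      Nat.reduceEqDiff, not_false_eq_true, Function.update_of_ne, Function.update_self, h.size,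
      h.T, h.states]
    rw [ht (J.T - 1) (by omega) x hx]
    · exact ind_congr one_le_ind
    · have : J.T * J.states = (J.T - 1) * J.states + J.states := by
        rw [← Nat.succ_mul]; congr 1; omega
      omega

end TimelineDP

/-! ### Explicit register contents and uniform cost bounds -/

namespace WordRAM

/-- The registers hold the entries of the list, and zeros behind it. -/
def regs (l : List ℕ) (j : ℕ) : ℕ := l.getD j 0

theorem update_regs {l : List ℕ} {j : ℕ} (hj : j < l.length) (x : ℕ) :
    Function.update (regs l) j x = regs (l.set j x) := by
  funext i
  by_cases hij : i = j
  · subst hij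
    simp [regs, hj]
  · rw [Function.update_of_ne hij, regs, regs, List.getD_eq_getElem?_getD,
      List.getD_eq_getElem?_getD, List.getElem?_set_ne (Ne.symm hij)]

/-- Concatenation of relocatable pieces of code. -/
def seqCode : List (ℕ → List Instr) → ℕ → List Instr
  | [], _ => []
  | f :: fs, p => f p ++ seqCode fs (p + (f p).length)

theorem codeAt_seqCode {P : Program} {f : ℕ → List Instr} {fs : List (ℕ → List Instr)} {p : ℕ} :
    CodeAt P p (seqCode (f :: fs) p) ↔
      CodeAt P p (f p) ∧ CodeAt P (p + (f p).length) (seqCode fs (p + (f p).length)) :=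
  codeAt_append

theorem codeAt_loop_body {P : Program} {x g p : ℕ} {body : List Instr}
    (h : CodeAt P p (loopCode x g body p)) : CodeAt P (p + 2) body := by
  simp only [loopCode, codeAt_append] at h
  exact h.2.1

section

variable {P : Program} {I : List ℕ} {W p N : ℕ}

theorem triple_setReg {pc d x : ℕ} {i : Instr} {r : ℕ → ℕ} {Q : (ℕ → ℕ) → Prop}
    (hi : P[pc]? = some i) (hx : x ≤ W)
    (hex : ∀ ρ μ, (∀ j < Expr.scratch, ρ j = r j) →
      i.exec I ⟨pc, ρ, μ⟩ = Config.setReg ⟨pc, ρ, μ⟩ d x) :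
    Triple P I W 1 pc (pc + 1) (St r Q) (St (Function.update r d x) Q) := by
  intro ρ μ ⟨hρ, hμ⟩ hB
  refine ⟨_, μ, ⟨fun j hj => ?_, hμ⟩, Reaches.setReg hi (hex ρ μ hρ) hB hx⟩
  by_cases hjd : j = d
  · simp [hjd]
  · simp [hjd, hρ j hj]

theorem triple_jump {pc a b l : ℕ} {r : ℕ → ℕ} {Q : (ℕ → ℕ) → Prop} (ha : a < Expr.scratch)
    (hb : b < Expr.scratch) (hi : P[pc]? = some (.jumpLE a b l)) :
    Triple P I W 1 pc (if r a ≤ r b then l else pc + 1) (St r Q) (St r Q) := by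
  intro ρ μ hA hB
  have := Reaches.jump (I := I) hi hB
  rw [hA.1 a ha, hA.1 b hb] at this
  exact ⟨ρ, μ, hA, this⟩

end

theorem triple_jump_of_le {P : Program} {I : List ℕ} {W pc a b l : ℕ} {r : ℕ → ℕ}
    {Q : (ℕ → ℕ) → Prop} (ha : a < Expr.scratch) (hb : b < Expr.scratch)
    (hi : P[pc]? = some (.jumpLE a b l)) (h : r a ≤ r b) :
    Triple P I W 1 pc l (St r Q) (St r Q) := by
  have := triple_jump (I := I) (W := W) (r := r) (Q := Q) ha hb hi
  rwa [if_pos h] at this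

theorem triple_jump_of_not_le {P : Program} {I : List ℕ} {W pc a b l : ℕ} {r : ℕ → ℕ}
    {Q : (ℕ → ℕ) → Prop} (ha : a < Expr.scratch) (hb : b < Expr.scratch)
    (hi : P[pc]? = some (.jumpLE a b l)) (h : ¬ r a ≤ r b) :
    Triple P I W 1 pc (pc + 1) (St r Q) (St r Q) := by
  have := triple_jump (I := I) (W := W) (r := r) (Q := Q) ha hb hi
  rwa [if_neg h] at this

/-- Exponents of bounds on the registers used by the algorithm. -/
def regDeg (j : ℕ) : ℕ × ℕ := if j = 5 then (0, 1) else if j ≤ 6 then (1, 0) else (1, 1)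

/-- Well-formed expressions whose values and cost depend at most linearly on the number of
states. -/
def Expr.Good (e : Expr) : Bool :=
  e.wf && decide ((e.mdeg regDeg).2 ≤ 1) && decide ((e.cdeg regDeg).2 ≤ 1)

/-- An exponent that bounds both the values and the cost of an expression. -/
def Expr.expo (e : Expr) : ℕ := (e.mdeg regDeg).1 + (e.cdeg regDeg).1

/-- The quantities of a run: `p` bounds the input and the small registers, `N` the number of states
and the memory contents, and `p ^ A * N` the values and the cost of expressions. -/
structure Limits (I : List ℕ) (W p N A : ℕ) : Prop where
  two_le : 2 ≤ p
  one_le : 1 ≤ N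
  input : ∀ j, I.getD j 0 ≤ p
  word : p ^ A * N ≤ W

section

variable {P : Program} {I : List ℕ} {W p N A : ℕ}

theorem Limits.mdeg_le (h : Limits I W p N A) {e : Expr} (hg : e.Good = true) (hA : e.expo ≤ A) :
    bnd p N (e.mdeg regDeg) ≤ W := by
  simp only [Expr.Good, Bool.and_eq_true, decide_eq_true_eq] at hg
  refine le_trans ?_ h.word
  have := bnd_mono h.two_le h.one_le (D := e.mdeg regDeg) (E := (A, 1))
    ⟨(Nat.le_add_right _ _).trans hA, hg.1.2⟩
  simpa [bnd] using this

theorem Limits.cdeg_le (h : Limits I W p N A) {e : Expr} (hg : e.Good = true) (hA : e.expo ≤ A) :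
    bnd p N (e.cdeg regDeg) ≤ p ^ A * N := by
  simp only [Expr.Good, Bool.and_eq_true, decide_eq_true_eq] at hg
  have := bnd_mono h.two_le h.one_le (D := e.cdeg regDeg) (E := (A, 1))
    ⟨(Nat.le_add_left _ _).trans hA, hg.2⟩
  simpa [bnd] using this

theorem Limits.wf {e : Expr} (hg : e.Good = true) : e.wf = true := by
  simp only [Expr.Good, Bool.and_eq_true] at hg
  exact hg.1.1

theorem regs_le {a b c d e f g i j q r : ℕ} (ha : a ≤ p) (hb : b ≤ p)
    (hc : c ≤ p) (hd : d ≤ p) (he : e ≤ p) (hf : f ≤ N) (hg : g ≤ p) (hi : i ≤ p * N)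
    (hj : j ≤ p * N) (hq : q ≤ p * N) (hr : r ≤ p * N) :
    ∀ x < Expr.scratch, regs [a, b, c, d, e, f, g, i, j, q, r] x ≤ bnd p N (regDeg x) := by
  intro x _
  by_cases hx : x < 11
  · interval_cases x <;> simpa [regs, bnd, regDeg]
  · rw [regs, List.getD_eq_default _ _ (by simp; omega)]
    exact Nat.zero_le _

theorem Limits.assign (h : Limits I W p N A) {x pc : ℕ} {e : Expr} {r r' : ℕ → ℕ}
    {Q : (ℕ → ℕ) → Prop} {v : ℕ} (hc : CodeAt P pc (assignCode x e pc)) (hg : e.Good = true)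
    (hA : e.expo ≤ A) (hr : ∀ j < Expr.scratch, r j ≤ bnd p N (regDeg j))
    (hQ : ∀ μ, Q μ → ∀ j, μ j ≤ N) (hv : ∀ μ, Q μ → e.eval I μ r = v)
    (hr' : Function.update r x v = r') :
    Triple P I W (p ^ A * N + 1) pc (pc + (assignCode x e pc).length) (St r Q) (St r' Q) := by
  subst hr'
  refine (triple_assign h.two_le h.one_le h.input (Limits.wf hg) hc hr hQ (h.mdeg_le hg hA)
    hv).weaken (Nat.add_le_add_right (h.cdeg_le hg hA) 1) ?_ (fun _ _ h => h) (fun _ _ h => h)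
  simp [assignCode, Expr.length_comp, add_assoc]

theorem Limits.store (h : Limits I W p N A) {pc : ℕ} {a e : Expr} {r : ℕ → ℕ}
    {Q Q' : (ℕ → ℕ) → Prop} (hc : CodeAt P pc (storeCode a e pc)) (hga : a.Good = true)
    (hAa : a.expo ≤ A) (hge : e.Good = true) (hAe : e.expo ≤ A)
    (hr : ∀ j < Expr.scratch, r j ≤ bnd p N (regDeg j)) (hQ : ∀ μ, Q μ → ∀ j, μ j ≤ N)
    (hQ' : ∀ μ, Q μ → Q' (Function.update μ (a.eval I μ r) (e.eval I μ r))) :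
    Triple P I W (2 * (p ^ A * N) + 1) pc (pc + (storeCode a e pc).length) (St r Q) (St r Q') := by
  refine (triple_store h.two_le h.one_le h.input (Limits.wf hga) (Limits.wf hge) hc hr hQ
    (h.mdeg_le hga hAa) (h.mdeg_le hge hAe) hQ').weaken ?_ ?_ (fun _ _ h => h) (fun _ _ h => h)
  · have := h.cdeg_le hga hAa
    have := h.cdeg_le hge hAe
    omega
  · simp [storeCode, Expr.length_comp, add_assoc]

theorem Limits.loop (h : Limits I W p N A) {x g pc c G : ℕ} {body : List Instr}
    (hx : x < Expr.scratch) (hg : g < Expr.scratch) (hxg : g ≠ x)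
    (hc : CodeAt P pc (loopCode x g body pc)) {r : ℕ → ℕ → ℕ} {r' : ℕ → ℕ}
    {Q : ℕ → (ℕ → ℕ) → Prop} (hG : ∀ i, r i g = G)
    (hbody : ∀ i < G, Triple P I W c (pc + 2) (pc + 2 + body.length)
      (St (Function.update (r i) x i) (Q i)) (St (Function.update (r (i + 1)) x i) (Q (i + 1))))
    (hr' : Function.update (r G) x G = r') :
    Triple P I W (G * (c + 4) + 2) pc (pc + (loopCode x g body pc).length) (St (r 0) (Q 0))
      (St r' (Q G)) := by
  subst hr'
  have hW : 1 ≤ W :=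
    le_trans (Nat.mul_pos (Nat.pow_pos (by have := h.two_le; omega)) h.one_le) h.word
  refine (triple_loop hW hx hg hxg hc hG hbody).weaken le_rfl ?_ (fun _ _ h => h) (fun _ _ h => h)
  simp [loopCode]
  omega

end

end WordRAM

namespace TimelineDP

open WordRAM WordRAM.Expr

/-! ### The program -/

def baseE : Expr := (var 2 + lit 1) * (var 3 + lit 2)
def statesStepE : Expr := var 5 * (slotE 9 * (var 4 - lit 1) + lit 1)

/-- All expressions that occur in the program. -/
def exprs : List Expr :=
  [baseE, lit 1, var 0 + lit 1, statesStepE, var 5 * var 6, var 1 * var 5, var 9, quotientEntryE,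
    var 7 + var 9, reachEntryE, answerE]

/-- The main part of the program. -/
def mainCode : List (ℕ → List Instr) :=
  [assignCode 4 baseE, assignCode 5 (lit 1), assignCode 6 (var 0 + lit 1),
    fun p => loopCode 9 0 (assignCode 5 statesStepE (p + 2)) p,
    assignCode 7 (var 5 * var 6), assignCode 8 (var 1 * var 5),
    fun p => loopCode 9 7 (storeCode (var 9) quotientEntryE (p + 2)) p,
    fun p => loopCode 9 8 (storeCode (var 7 + var 9) reachEntryE (p + 2)) p,
    assignCode 10 answerE,
    fun _ => [.const 9 1, .jumpLE 9 10 1, .jumpLE 0 0 2]]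

/-- An exponent for all expressions of the program. -/
def maxExpo : ℕ := (exprs.map Expr.expo).sum

/-- The degrees are computed from the syntax. Linearity in the number of states for each single
evaluation is what makes the whole program quadratic in it. -/
theorem good_of_mem : ∀ e ∈ exprs, e.Good = true := by
  have : exprs.all Expr.Good = true := by decide +kernel
  simpa using this

theorem expo_le {e : Expr} (he : e ∈ exprs) : e.expo ≤ maxExpo :=
  List.single_le_sum (by simp) _ (List.mem_map_of_mem he)

open Classical in
/-- The number of slots below `c` that are needed at some time. -/
noncomputable def slotsBelow (J : Inst) (c : ℕ) : ℕ :=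
  ((Finset.range c).filter fun c => ∃ i < J.T, c < J.width i).card

/-- Mirrors one round of the first loop, which multiplies register `5` by `base` or by `1`; the
maximum width is thus found by counting. -/
theorem slotsBelow_succ (J : Inst) (c : ℕ) :
    slotsBelow J (c + 1) = slotsBelow J c + ind (∃ i < J.T, c < J.width i) := by
  classical
  rw [slotsBelow, slotsBelow, Finset.range_add_one, Finset.filter_insert, ind]
  split_ifs <;> simp

theorem slotsBelow_le (J : Inst) {c : ℕ} (hc : c ≤ J.n) : slotsBelow J c ≤ J.slots := by
  classical
  exact Finset.card_le_card (Finset.filter_subset_filter _ (Finset.range_subset_range.2 hc))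

end TimelineDP

namespace WordRAM

theorem Triple.haltsWithin {P : Program} {I : List ℕ} {W b t q : ℕ} {answer : Bool}
    {A B : (ℕ → ℕ) → (ℕ → ℕ) → Prop} (h : Triple P I W b 0 q A B)
    (hA : A (fun _ => 0) fun _ => 0) (hq : P[q]? = some (.halt answer)) (hbt : b ≤ t) :
    HaltsWithin P I t W answer := by
  obtain ⟨ρ, μ, -, m, hm, he, hb⟩ := h _ _ hA fun _ => ⟨Nat.zero_le _, Nat.zero_le _⟩
  refine ⟨m, hm.trans hbt, ?_, fun r hr => hb r hr⟩
  change P[((step P I)^[m] Config.init).pc]? = _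
  rw [show (step P I)^[m] Config.init = ⟨q, ρ, μ⟩ from he]
  exact hq

end WordRAM

/-! ### Filling the two tables, and the running time of the dynamic program -/

namespace TimelineDP

open WordRAM WordRAM.Expr

/-- The table of quotients is correct for all entries before `m`. -/
def QuotientsUpTo (J : Inst) (m : ℕ) (μ : ℕ → ℕ) : Prop :=
  (∀ y < m, μ y = y / (J.n + 1) / J.base ^ (y % (J.n + 1))) ∧ ∀ j, μ j ≤ J.states

variable {J : Inst}

theorem states_pos : 1 ≤ J.states := Nat.pow_pos Inst.base_pos

theorem quotientsUpTo_succ {i : ℕ} {μ : ℕ → ℕ} (h : QuotientsUpTo J i μ)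
    (hi : i < J.states * (J.n + 1)) :
    QuotientsUpTo J (i + 1)
      (Function.update μ i (i / (J.n + 1) / J.base ^ (i % (J.n + 1)))) := by
  refine ⟨fun y hy => ?_, fun j => ?_⟩
  · by_cases hyi : y = i
    · rw [hyi, Function.update_self]
    · rw [Function.update_of_ne hyi, h.1 y (by omega)]
  · by_cases hji : j = i
    · rw [hji, Function.update_self]
      exact (Nat.div_le_self _ _).trans (Nat.div_lt_of_lt_mul (by rwa [mul_comm])).le
    · rw [Function.update_of_ne hji]
      exact h.2 j

theorem QuotientsUpTo.table {μ : ℕ → ℕ} (h : QuotientsUpTo J (J.states * (J.n + 1)) μ) :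
    ∀ x < J.states, ∀ j ≤ J.n, μ (x * (J.n + 1) + j) = x / J.base ^ j := by
  intro x hx j hj
  have e1 : (x * (J.n + 1) + j) / (J.n + 1) = x := by
    rw [add_comm, Nat.add_mul_div_right _ _ (by omega), Nat.div_eq_of_lt (by omega), zero_add]
  have e2 : (x * (J.n + 1) + j) % (J.n + 1) = j := by
    rw [add_comm, Nat.add_mul_mod_self_right, Nat.mod_eq_of_lt (by omega)]
  have := Nat.mul_le_mul_right (J.n + 1) hx
  rw [Nat.succ_mul] at this
  rw [h.1 _ (by omega), e1, e2]

/-- Both tables are correct, the second one for all entries before `m`. -/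
def TablesUpTo (J : Inst) (m : ℕ) (μ : ℕ → ℕ) : Prop :=
  QuotientsUpTo J (J.states * (J.n + 1)) μ ∧ TableUpTo J μ m

/-- The second table starts right behind the first, so writing to it keeps the quotients intact. Its
entries are `0` or `1`, so they respect the bound on memory contents. -/
theorem tablesUpTo_succ {i : ℕ} {μ : ℕ → ℕ} (h : TablesUpTo J i μ) :
    TablesUpTo J (i + 1) (Function.update μ (J.states * (J.n + 1) + i)
      (ind (J.Reach (i / J.states) (i % J.states)))) := by
  refine ⟨⟨fun y hy => ?_, fun j => ?_⟩, fun t ht x hx hlt => ?_⟩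
  · rw [Function.update_of_ne (by omega), h.1.1 y hy]
  · by_cases hji : j = J.states * (J.n + 1) + i
    · rw [hji, Function.update_self]
      exact (ind_le_one _).trans states_pos
    · rw [Function.update_of_ne hji]
      exact h.1.2 j
  · by_cases hxi : t * J.states + x = i
    · rw [← hxi, Function.update_self]
      congr 2
      · rw [add_comm, Nat.add_mul_div_right _ _ (by omega), Nat.div_eq_of_lt hx, zero_add]
      · rw [add_comm, Nat.add_mul_mod_self_right, Nat.mod_eq_of_lt hx]
    · rw [Function.update_of_ne (by omega)]
      exact h.2 t ht x hx (by omega)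

section

variable {I : List ℕ} {P : Program} {W p pc : ℕ}

/-- The final test of the answer in register `10`. -/
theorem verdict_triple {q : Prop} [Decidable q] {r : ℕ → ℕ} {Q : (ℕ → ℕ) → Prop} (hW : 1 ≤ W)
    (hr : r 10 = ind q) (hc : CodeAt P pc [.const 9 1, .jumpLE 9 10 1, .jumpLE 0 0 2]) :
    Triple P I W 3 pc (if q then 1 else 2) (St r Q) (fun _ _ => True) := by
  obtain ⟨i1, i2, i3, -⟩ := hc
  have t1 := triple_setReg (I := I) (W := W) (x := 1) (d := 9) (Q := Q) (r := r) i1 hW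
    (fun _ _ _ => rfl)
  have t2 := t1.trans (triple_jump (by norm_num) (by norm_num) i2)
  rw [Function.update_self, Function.update_of_ne (by norm_num), hr] at t2
  have t3 := triple_jump (I := I) (W := W) (Q := Q) (r := Function.update r 9 1) (by norm_num)
    (by norm_num) i3
  rw [if_pos le_rfl] at t3
  by_cases hq : q
  · rw [if_pos (one_le_ind.2 hq)] at t2
    rw [if_pos hq]
    exact t2.weaken (by omega) rfl (fun _ _ h => h) (fun _ _ _ => trivial)
  · rw [if_neg fun h => hq (one_le_ind.1 h)] at t2
    rw [if_neg hq]
    exact (t2.trans t3).weaken le_rfl rfl (fun _ _ h => h) (fun _ _ _ => trivial)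

open Classical in
theorem main_triple (hinput : ∀ i < J.T, ∀ u < J.n, ∀ v < J.n,
      I.getD (4 + ((i * J.n + u) * J.n + v)) 0 = ind (J.adj i u v))
    (hT : 1 ≤ J.T) (hn : J.n + 1 ≤ p) (hTp : J.T ≤ p) (hk : J.k ≤ p) (hℓ : J.ℓ ≤ p)
    (hb : J.base ≤ p) (hL : Limits I W p J.states maxExpo)
    (hc : CodeAt P pc (seqCode mainCode pc)) :
    Triple P I W (100 * (p * J.states * (p ^ maxExpo * J.states))) pc
      (if (∀ v < J.n, J.left v + J.right v ≤ J.k) ∧ ∃ x < J.states, J.Reach (J.T - 1) x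
        then 1 else 2)
      (St (regs [J.n, J.T, J.k, J.ℓ, 0, 0, 0, 0, 0, 0, 0]) fun μ => ∀ j, μ j = 0)
      fun _ _ => True := by
  have hN : 1 ≤ J.states := states_pos
  have hp : 1 ≤ p := by omega
  have hpN : p ≤ p * J.states := Nat.le_mul_of_pos_right p hN
  have hNp : J.states ≤ p * J.states := Nat.le_mul_of_pos_left _ hp
  have hSp : J.states * (J.n + 1) ≤ p * J.states := by
    rw [mul_comm]; exact Nat.mul_le_mul_right _ hn
  have hS2p : J.T * J.states ≤ p * J.states := Nat.mul_le_mul_right _ hTp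
  simp only [mainCode, codeAt_seqCode] at hc
  obtain ⟨c1, c2, c3, c4, c5, c6, c7, c8, c9, c10, -⟩ := hc
  have good : ∀ {e}, e ∈ exprs → e.Good = true := fun he => good_of_mem _ he
  have hQ0 : ∀ μ : ℕ → ℕ, (∀ j, μ j = 0) → ∀ j, μ j ≤ J.states := fun μ h j => by
    rw [h j]; exact Nat.zero_le _
  have t1 := hL.assign (r := regs [J.n, J.T, J.k, J.ℓ, 0, 0, 0, 0, 0, 0, 0])
    (r' := regs [J.n, J.T, J.k, J.ℓ, J.base, 0, 0, 0, 0, 0, 0]) c1 (good (by simp [exprs]))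
    (expo_le (by simp [exprs])) (regs_le (by omega) hTp hk hℓ (by omega) (by omega) (by omega)
      (by omega) (by omega) (by omega) (by omega)) hQ0 (v := J.base) (fun _ _ => rfl)
    (by rw [update_regs (by simp)]; rfl)
  have t2 := hL.assign (r := regs [J.n, J.T, J.k, J.ℓ, J.base, 0, 0, 0, 0, 0, 0])
    (r' := regs [J.n, J.T, J.k, J.ℓ, J.base, 1, 0, 0, 0, 0, 0]) c2 (good (by simp [exprs]))
    (expo_le (by simp [exprs])) (regs_le (by omega) hTp hk hℓ (by omega) (by omega) (by omega)
      (by omega) (by omega) (by omega) (by omega)) hQ0 (v := 1) (fun _ _ => rfl)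
    (by rw [update_regs (by simp)]; rfl)
  have t3 := hL.assign (r := regs [J.n, J.T, J.k, J.ℓ, J.base, 1, 0, 0, 0, 0, 0])
    (r' := regs [J.n, J.T, J.k, J.ℓ, J.base, 1, J.n + 1, 0, 0, 0, 0]) c3 (good (by simp [exprs]))
    (expo_le (by simp [exprs])) (regs_le (by omega) hTp hk hℓ (by omega) (by omega) (by omega)
      (by omega) (by omega) (by omega) (by omega)) hQ0 (v := J.n + 1) (fun _ _ => rfl)
    (by rw [update_regs (by simp)]; rfl)
  -- As only slots needed at some time are counted, no intermediate power exceeds the final number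
  -- of states.
  have hpow : ∀ i ≤ J.n, J.base ^ slotsBelow J i ≤ J.states := fun i hi =>
    Nat.pow_le_pow_right Inst.base_pos (slotsBelow_le J hi)
  have t4 := hL.loop (x := 9) (g := 0) (by norm_num) (by norm_num) (by norm_num) c4
    (r := fun i => regs [J.n, J.T, J.k, J.ℓ, J.base, J.base ^ slotsBelow J i, J.n + 1, 0, 0, 0, 0])
    (r' := regs [J.n, J.T, J.k, J.ℓ, J.base, J.states, J.n + 1, 0, 0, J.n, 0])
    (Q := fun _ μ => ∀ j, μ j = 0) (G := J.n) (c := p ^ maxExpo * J.states + 1) (fun _ => rfl)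
    (fun i hi => by
      refine hL.assign (codeAt_loop_body c4) (good (by simp [exprs])) (expo_le (by simp [exprs])) ?_
        hQ0 (v := J.base ^ slotsBelow J (i + 1)) ?_ ?_
      · rw [update_regs (by simp)]
        exact regs_le (by omega) hTp hk hℓ (by omega) (hpow i hi.le) (by omega) (by omega)
          (by omega) (show i ≤ p * J.states by omega) (by omega)
      · intro μ _
        rw [update_regs (by simp)]
        simp only [statesStepE, eval_mul, eval_add, eval_sub, eval_lit, eval_var]
        rw [eval_slotE (J := J) ⟨rfl, rfl, rfl, rfl, hinput⟩ (by norm_num), slotsBelow_succ,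
          pow_add]
        have hb1 : 1 ≤ J.base := Inst.base_pos
        simp only [regs, List.set_cons_succ, List.set_cons_zero, List.getD_cons_succ,
          List.getD_cons_zero, ind]
        split_ifs
        · rw [one_mul, Nat.sub_add_cancel hb1, pow_one]
        · simp
      · rw [update_regs (by simp), update_regs (by simp), update_regs (by simp)]
        rfl)
    (by rw [update_regs (by simp)]; rfl)
  have t5 := hL.assign (r := regs [J.n, J.T, J.k, J.ℓ, J.base, J.states, J.n + 1, 0, 0, J.n, 0])
    (r' := regs [J.n, J.T, J.k, J.ℓ, J.base, J.states, J.n + 1, J.states * (J.n + 1), 0, J.n, 0])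
    c5 (good (by simp [exprs])) (expo_le (by simp [exprs])) (regs_le (by omega) hTp hk hℓ (by omega)
      le_rfl (by omega) (by omega) (by omega) (by omega) (by omega)) hQ0
    (v := J.states * (J.n + 1)) (fun _ _ => rfl) (by rw [update_regs (by simp)]; rfl)
  have t6 := hL.assign
    (r := regs [J.n, J.T, J.k, J.ℓ, J.base, J.states, J.n + 1, J.states * (J.n + 1), 0, J.n, 0])
    (r' := regs [J.n, J.T, J.k, J.ℓ, J.base, J.states, J.n + 1, J.states * (J.n + 1),
      J.T * J.states, J.n, 0])
    c6 (good (by simp [exprs])) (expo_le (by simp [exprs])) (regs_le (by omega) hTp hk hℓ (by omega)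
      le_rfl (by omega) hSp (by omega) (by omega) (by omega)) hQ0
    (v := J.T * J.states) (fun _ _ => rfl) (by rw [update_regs (by simp)]; rfl)
  have t7 := hL.loop (x := 9) (g := 7) (by norm_num) (by norm_num) (by norm_num) c7
    (r := fun _ => regs [J.n, J.T, J.k, J.ℓ, J.base, J.states, J.n + 1, J.states * (J.n + 1),
      J.T * J.states, J.n, 0])
    (r' := regs [J.n, J.T, J.k, J.ℓ, J.base, J.states, J.n + 1, J.states * (J.n + 1),
      J.T * J.states, J.states * (J.n + 1), 0])
    (Q := QuotientsUpTo J) (G := J.states * (J.n + 1)) (c := 2 * (p ^ maxExpo * J.states) + 1)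
    (fun _ => rfl)
    (fun i hi => by
      refine hL.store (codeAt_loop_body c7) (good (by simp [exprs])) (expo_le (by simp [exprs]))
        (good (by simp [exprs])) (expo_le (by simp [exprs])) ?_ (fun μ h => h.2) (fun μ h => ?_)
      · rw [update_regs (by simp)]
        exact regs_le (by omega) hTp hk hℓ (by omega) le_rfl (by omega) hSp hS2p
          (hi.le.trans hSp) (by omega)
      · rw [eval_quotientEntryE (J := J) (s := J.states) rfl rfl rfl (by simpa using hi)
          (by simpa using h.1), eval_var, Function.update_self]
        exact quotientsUpTo_succ h hi)
    (by rw [update_regs (by simp)]; rfl)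
  have t8 := hL.loop (x := 9) (g := 8) (by norm_num) (by norm_num) (by norm_num) c8
    (r := fun _ => regs [J.n, J.T, J.k, J.ℓ, J.base, J.states, J.n + 1, J.states * (J.n + 1),
      J.T * J.states, J.states * (J.n + 1), 0])
    (r' := regs [J.n, J.T, J.k, J.ℓ, J.base, J.states, J.n + 1, J.states * (J.n + 1),
      J.T * J.states, J.T * J.states, 0])
    (Q := TablesUpTo J) (G := J.T * J.states) (c := 2 * (p ^ maxExpo * J.states) + 1)
    (fun _ => rfl)
    (fun i hi => by
      refine hL.store (codeAt_loop_body c8) (good (by simp [exprs])) (expo_le (by simp [exprs]))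
        (good (by simp [exprs])) (expo_le (by simp [exprs])) ?_ (fun μ h => h.1.2) (fun μ h => ?_)
      · rw [update_regs (by simp)]
        exact regs_le (by omega) hTp hk hℓ (by omega) le_rfl (by omega) hSp hS2p
          (hi.le.trans hS2p) (by omega)
      · rw [eval_reachEntryE (J := J) ⟨⟨rfl, rfl, rfl, rfl, hinput⟩, rfl, rfl, rfl, rfl, h.1.table⟩
          (by simpa using hi) (by simpa using h.2), eval_add, eval_var, eval_var,
          Function.update_self]
        exact tablesUpTo_succ h)
    (by rw [update_regs (by simp)]; rfl)
  set a := ind ((∀ v < J.n, J.left v + J.right v ≤ J.k) ∧ ∃ x < J.states, J.Reach (J.T - 1) x)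
    with ha
  have ha1 : a ≤ 1 := ind_le_one _
  have t9 := hL.assign (r := regs [J.n, J.T, J.k, J.ℓ, J.base, J.states, J.n + 1,
      J.states * (J.n + 1), J.T * J.states, J.T * J.states, 0])
    (r' := regs [J.n, J.T, J.k, J.ℓ, J.base, J.states, J.n + 1,
      J.states * (J.n + 1), J.T * J.states, J.T * J.states, a])
    (Q := TablesUpTo J (J.T * J.states)) c9 (good (by simp [exprs])) (expo_le (by simp [exprs]))
    (regs_le (by omega) hTp hk hℓ (by omega) le_rfl (by omega) hSp hS2p hS2p (by omega))
    (fun μ h => h.1.2) (v := a)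
    (fun μ h => eval_answerE
      ⟨⟨rfl, rfl, rfl, rfl, hinput⟩, rfl, rfl, rfl, rfl, h.1.table⟩ hT h.2)
    (by rw [update_regs (by simp)]; rfl)
  have hA1 : 1 ≤ p ^ maxExpo * J.states := Nat.mul_pos (Nat.pow_pos hp) hN
  have hW1 : 1 ≤ W := hA1.trans hL.word
  have hfin := verdict_triple (I := I) (r := regs [J.n, J.T, J.k, J.ℓ, J.base, J.states, J.n + 1,
      J.states * (J.n + 1), J.T * J.states, J.T * J.states, a])
    (Q := TablesUpTo J (J.T * J.states)) hW1 ha c10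
  have e0 : J.base ^ slotsBelow J 0 = 1 := by simp [slotsBelow]
  simp only [e0] at t4
  have start7 : ∀ μ : ℕ → ℕ, (∀ j, μ j = 0) → QuotientsUpTo J 0 μ := fun μ h =>
    ⟨fun y hy => absurd hy (Nat.not_lt_zero y), hQ0 μ h⟩
  have start8 : ∀ μ : ℕ → ℕ, QuotientsUpTo J (J.states * (J.n + 1)) μ → TablesUpTo J 0 μ :=
    fun μ h => ⟨h, fun _ _ _ _ hlt => absurd hlt (Nat.not_lt_zero _)⟩
  have t7' := t7.weaken le_rfl rfl (fun ρ μ (h : St _ (fun μ => ∀ j, μ j = 0) ρ μ) =>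
    ⟨h.1, start7 μ h.2⟩) (fun _ _ h => h)
  have t8' := t8.weaken le_rfl rfl (fun ρ μ
    (h : St _ (QuotientsUpTo J (J.states * (J.n + 1))) ρ μ) => ⟨h.1, start8 μ h.2⟩) (fun _ _ h => h)
  refine ((((((((t1.trans t2).trans t3).trans t4).trans t5).trans t6).trans t7').trans
    t8').trans (t9.trans hfin)).weaken ?_ rfl (fun _ _ h => h) (fun _ _ h => h)
  -- `X` bounds the cost of one evaluation and `Y` the number of rounds of each loop; both are
  -- linear in the number of states.
  set X := p ^ maxExpo * J.states
  set Y := p * J.states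
  have hY : 1 ≤ Y := Nat.mul_pos hp hN
  have hXY : X ≤ Y * X := Nat.le_mul_of_pos_left _ hY
  have hYX : Y ≤ Y * X := Nat.le_mul_of_pos_right _ hA1
  have b1 : J.n * (X + 1 + 4) ≤ Y * (X + 5) := Nat.mul_le_mul (by omega) (by omega)
  have b2 : J.states * (J.n + 1) * (2 * X + 1 + 4) ≤ Y * (2 * X + 5) :=
    Nat.mul_le_mul hSp (by omega)
  have b3 : J.T * J.states * (2 * X + 1 + 4) ≤ Y * (2 * X + 5) :=
    Nat.mul_le_mul hS2p (by omega)
  have d1 : Y * (X + 5) = Y * X + 5 * Y := by ring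
  have d2 : Y * (2 * X + 5) = 2 * (Y * X) + 5 * Y := by ring
  omega

end

/-- The program: read the parameters, accept if `T ≤ k`, `T ≤ ℓ` or `T ≤ k * (ℓ + 1)`, and run the
dynamic program otherwise. -/
def program : Program :=
  [.jumpLE 0 0 3, .halt true, .halt false, .const 0 0, .read 0 0, .const 1 1, .read 1 1,
    .const 2 2, .read 2 2, .const 3 3, .read 3 3, .jumpLE 1 2 1, .jumpLE 1 3 1, .const 9 1,
    .add 9 3 9, .mul 9 2 9, .jumpLE 1 9 1, .const 9 0] ++ seqCode mainCode 18

/-! ### Complete runs of the program -/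

section

variable {n T : ℕ} (G : TemporalGraph n T) (k ℓ : ℕ) {W : ℕ}

theorem params_triple (hn : n ≤ W) (hT : T ≤ W) (hk : k ≤ W) (hℓ : ℓ ≤ W) (hW : 3 ≤ W) :
    Triple program (G.encode k ℓ) W 9 0 11
      (St (regs [0, 0, 0, 0, 0, 0, 0, 0, 0, 0, 0]) fun μ => ∀ j, μ j = 0)
      (St (regs [n, T, k, ℓ, 0, 0, 0, 0, 0, 0, 0]) fun μ => ∀ j, μ j = 0) := by
  have s0 := triple_jump (P := program) (I := G.encode k ℓ) (W := W) (pc := 0) (a := 0) (b := 0)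
    (r := regs [0, 0, 0, 0, 0, 0, 0, 0, 0, 0, 0]) (Q := fun μ => ∀ j, μ j = 0) (by norm_num)
    (by norm_num) rfl
  have step : ∀ (pc d x y : ℕ) (l : List ℕ) (_ : d < l.length) (_ : d < scratch) (_ : x ≤ W)
      (_ : y ≤ W), program[pc]? = some (.const d x) → program[pc + 1]? = some (.read d d) →
      (G.encode k ℓ).getD x 0 = y →
      Triple program (G.encode k ℓ) W 2 pc (pc + 2) (St (regs l) fun μ => ∀ j, μ j = 0)
        (St (regs (l.set d y)) fun μ => ∀ j, μ j = 0) := by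
    intro pc d x y l hd hd' hx hy h1 h2 he
    have t1 := triple_setReg (P := program) (I := G.encode k ℓ) (W := W) (pc := pc)
      (d := d) (x := x) (r := regs l) (Q := fun μ => ∀ j, μ j = 0) h1 hx (fun _ _ _ => rfl)
    have t2 := triple_setReg (P := program) (I := G.encode k ℓ) (W := W) (pc := pc + 1)
      (d := d) (x := y) (r := Function.update (regs l) d x) (Q := fun μ => ∀ j, μ j = 0) h2 hy
      (fun ρ μ hρ => by simp only [Instr.exec, hρ d hd', Function.update_self, he])
    rw [Function.update_idem, update_regs hd y] at t2
    exact t1.trans t2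
  have s1 := step 3 0 0 n [0, 0, 0, 0, 0, 0, 0, 0, 0, 0, 0] (by simp) (by norm_num) (by omega) hn
    rfl rfl rfl
  have s2 := step 5 1 1 T [n, 0, 0, 0, 0, 0, 0, 0, 0, 0, 0] (by simp) (by norm_num) (by omega) hT
    rfl rfl rfl
  have s3 := step 7 2 2 k [n, T, 0, 0, 0, 0, 0, 0, 0, 0, 0] (by simp) (by norm_num) (by omega) hk
    rfl rfl rfl
  have s4 := step 9 3 3 ℓ [n, T, k, 0, 0, 0, 0, 0, 0, 0, 0] (by simp) (by norm_num) (by omega) hℓ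
    rfl rfl rfl
  exact s0.trans (s1.trans (s2.trans (s3.trans s4)))

/-- Once both comparisons with `T` have failed, `k * (ℓ + 1) ≤ T * T` fits into a word; for
unrestricted parameters the product could be too large to form. -/
theorem test_triple (hk : k < T) (hℓ : ℓ < T) (hT : T ≤ W) (hTT : T * T ≤ W) :
    Triple program (G.encode k ℓ) W 6 11 (if T ≤ k * (ℓ + 1) then 1 else 17)
      (St (regs [n, T, k, ℓ, 0, 0, 0, 0, 0, 0, 0]) fun μ => ∀ j, μ j = 0)
      (St (regs [n, T, k, ℓ, 0, 0, 0, 0, 0, k * (ℓ + 1), 0]) fun μ => ∀ j, μ j = 0) := by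
  have i1 := triple_jump_of_not_le (P := program) (I := G.encode k ℓ) (W := W) (pc := 11)
    (r := regs [n, T, k, ℓ, 0, 0, 0, 0, 0, 0, 0]) (Q := fun μ => ∀ j, μ j = 0) (a := 1) (b := 2)
    (by norm_num) (by norm_num) rfl hk.not_ge
  have i2 := triple_jump_of_not_le (P := program) (I := G.encode k ℓ) (W := W) (pc := 12)
    (r := regs [n, T, k, ℓ, 0, 0, 0, 0, 0, 0, 0]) (Q := fun μ => ∀ j, μ j = 0) (a := 1) (b := 3)
    (by norm_num) (by norm_num) rfl hℓ.not_ge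
  have i3 := triple_setReg (P := program) (I := G.encode k ℓ) (W := W) (pc := 13) (d := 9) (x := 1)
    (r := regs [n, T, k, ℓ, 0, 0, 0, 0, 0, 0, 0]) (Q := fun μ => ∀ j, μ j = 0) rfl (by omega)
    (fun _ _ _ => rfl)
  rw [update_regs (by simp)] at i3
  have i4 := triple_setReg (P := program) (I := G.encode k ℓ) (W := W) (pc := 14) (d := 9)
    (x := ℓ + 1) (r := regs [n, T, k, ℓ, 0, 0, 0, 0, 0, 1, 0]) (Q := fun μ => ∀ j, μ j = 0) rfl
    (by omega) (fun ρ μ h => by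
      simp only [Instr.exec, h 3 (by norm_num), h 9 (by norm_num)]
      rfl)
  rw [update_regs (by simp)] at i4
  have hmul : k * (ℓ + 1) ≤ T * T := Nat.mul_le_mul hk.le hℓ
  have i5 := triple_setReg (P := program) (I := G.encode k ℓ) (W := W) (pc := 15) (d := 9)
    (x := k * (ℓ + 1)) (r := regs [n, T, k, ℓ, 0, 0, 0, 0, 0, ℓ + 1, 0])
    (Q := fun μ => ∀ j, μ j = 0) rfl
    (by omega) (fun ρ μ h => by
      simp only [Instr.exec, h 2 (by norm_num), h 9 (by norm_num)]
      rfl)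
  rw [update_regs (by simp)] at i5
  have i6 := triple_jump (P := program) (I := G.encode k ℓ) (W := W) (pc := 16)
    (r := regs [n, T, k, ℓ, 0, 0, 0, 0, 0, k * (ℓ + 1), 0]) (Q := fun μ => ∀ j, μ j = 0)
    (a := 1) (b := 9) (by norm_num) (by norm_num) rfl
  exact i1.trans (i2.trans (i3.trans (i4.trans (i5.trans i6))))

theorem initial_state : St (regs [0, 0, 0, 0, 0, 0, 0, 0, 0, 0, 0]) (fun μ => ∀ j, μ j = 0)
    (fun _ => 0) fun _ => 0 := by
  refine ⟨fun j _ => ?_, fun _ => rfl⟩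
  by_cases hj : j < 11
  · interval_cases j <;> rfl
  · rw [regs, List.getD_eq_default _ _ (by simp; omega)]

theorem haltsWithin_of_le {t : ℕ} (hn : n ≤ W) (hT : T ≤ W) (hk : k ≤ W) (hℓ : ℓ ≤ W)
    (hW : 3 ≤ W) (hTT : T * T ≤ W) (h : T ≤ k ∨ T ≤ ℓ ∨ T ≤ k * (ℓ + 1)) (ht : 20 ≤ t) :
    HaltsWithin program (G.encode k ℓ) t W true := by
  have s := params_triple G k ℓ hn hT hk hℓ hW
  by_cases hTk : T ≤ k
  · have i1 := triple_jump_of_le (P := program) (I := G.encode k ℓ) (W := W) (pc := 11)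
      (r := regs [n, T, k, ℓ, 0, 0, 0, 0, 0, 0, 0]) (Q := fun μ => ∀ j, μ j = 0) (a := 1) (b := 2)
      (by norm_num) (by norm_num) rfl hTk
    exact (s.trans i1).haltsWithin initial_state rfl (by omega)
  by_cases hTℓ : T ≤ ℓ
  · have i1 := triple_jump_of_not_le (P := program) (I := G.encode k ℓ) (W := W) (pc := 11)
      (r := regs [n, T, k, ℓ, 0, 0, 0, 0, 0, 0, 0]) (Q := fun μ => ∀ j, μ j = 0) (a := 1) (b := 2)
      (by norm_num) (by norm_num) rfl hTk
    have i2 := triple_jump_of_le (P := program) (I := G.encode k ℓ) (W := W) (pc := 12)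
      (r := regs [n, T, k, ℓ, 0, 0, 0, 0, 0, 0, 0]) (Q := fun μ => ∀ j, μ j = 0) (a := 1) (b := 3)
      (by norm_num) (by norm_num) rfl hTℓ
    exact ((s.trans i1).trans i2).haltsWithin initial_state rfl (by omega)
  have i3 := test_triple G k ℓ (not_le.1 hTk) (not_le.1 hTℓ) hT hTT
  rw [if_pos (by tauto)] at i3
  exact (s.trans i3).haltsWithin initial_state rfl (by omega)

theorem haltsWithin_of_lt {t p : ℕ} (hk1 : 1 ≤ k) (hk : k < T) (hℓ : ℓ < T)
    (hkℓ : k * (ℓ + 1) < T) (hp : p = 4 * (n + T + 1))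
    (hword : p ^ maxExpo * (ofGraph G k ℓ).states ≤ W) (hTT : T * T ≤ W) (hpW : p ≤ W)
    (ht : 16 + 100 * (p * (ofGraph G k ℓ).states * (p ^ maxExpo * (ofGraph G k ℓ).states)) ≤ t) :
    ∃ answer, HaltsWithin program (G.encode k ℓ) t W answer ∧
      (answer = true ↔ G.TimelineDS k ℓ) := by
  classical
  set J := ofGraph G k ℓ with hJ
  have s := params_triple G k ℓ (W := W) (by omega) (by omega) (by omega) (by omega) (by omega)
  have i3 := test_triple G k ℓ hk hℓ (W := W) (by omega) hTT
  rw [if_neg (by omega)] at i3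
  have i4 := triple_setReg (P := program) (I := G.encode k ℓ) (W := W) (pc := 17) (d := 9) (x := 0)
    (r := regs [n, T, k, ℓ, 0, 0, 0, 0, 0, k * (ℓ + 1), 0]) (Q := fun μ => ∀ j, μ j = 0) rfl
    (Nat.zero_le _) (fun _ _ _ => rfl)
  rw [update_regs (by simp)] at i4
  have hbase : J.base ≤ p := by
    -- As `k ≥ 1`, each factor at most doubles; since `k * (ℓ + 1) < T`, this is the reason for the
    -- factor `4` in `p`.
    have : (k + 1) * (ℓ + 2) ≤ 4 * (k * (ℓ + 1)) := by nlinarith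
    change (k + 1) * (ℓ + 2) ≤ p
    omega
  have hL : Limits (G.encode k ℓ) W p J.states maxExpo :=
    ⟨by omega, states_pos, encode_le G k ℓ (by omega) (by omega) (by omega) (by omega) (by omega),
      hword⟩
  have hinput : ∀ i < J.T, ∀ u < J.n, ∀ v < J.n,
      (G.encode k ℓ).getD (4 + ((i * J.n + u) * J.n + v)) 0 = ind (J.adj i u v) :=
    fun i hi u hu v hv => by rw [ind]; exact encode_adj G k ℓ hi hu hv
  have main := main_triple hinput (show 1 ≤ T by omega) (show n + 1 ≤ p by omega)
    (show T ≤ p by omega) (show k ≤ p by omega) (show ℓ ≤ p by omega) hbase hL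
    (P := program) (pc := 18) (codeAt_self _ _)
  have all := s.trans (i3.trans (i4.trans main))
  have hiff := (timelineDS_iff G k ℓ).trans (Inst.solvable_iff_reach (J := J) hkℓ)
  by_cases hyes : (∀ v < J.n, J.left v + J.right v ≤ J.k) ∧ ∃ x < J.states, J.Reach (J.T - 1) x
  · rw [if_pos hyes] at all
    exact ⟨true, all.haltsWithin initial_state rfl (by omega), by simpa using hiff.2 hyes⟩
  · rw [if_neg hyes] at all
    refine ⟨false, all.haltsWithin initial_state rfl (by omega), ?_⟩
    simpa using fun h => hyes (hiff.1 h)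

end

end TimelineDP

/-! ### Assembly of the time and word bounds -/

/-- Timeline Dominating Set is solvable by a word RAM in time
`((k + 1) * (ℓ + 2)) ^ (4 * vimw (ℓ + 2)) * (n + T) ^ O(1)`. -/
theorem mainTheorem12 :
    ∃ (P : WordRAM.Program) (C c : ℕ), ∀ (n T : ℕ) (G : TemporalGraph n T) (k ℓ t : ℕ),
      1 ≤ k →
      t = C * ((k + 1) * (ℓ + 2)) ^ (4 * G.vimw (ℓ + 2)) * (n + T + 1) ^ c →
      ∃ answer : Bool,
        WordRAM.HaltsWithin P (G.encode k ℓ) t (k + ℓ + t) answer ∧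
          (answer = true ↔ G.TimelineDS k ℓ) := by
  -- These constants make `C * (n + T + 1) ^ c` equal to `p ^ (A + 6)` for `p = 4 * (n + T + 1)`.
  -- The dynamic program needs `100 * p ^ (A + 1) * N ^ 2` steps and a constant; as `p ≥ 4`, the
  -- surplus `p ^ 5 ≥ 1024` absorbs the constants.
  refine ⟨TimelineDP.program, 4 ^ (TimelineDP.maxExpo + 6), TimelineDP.maxExpo + 6,
    fun n T G k ℓ t hk1 ht => ?_⟩
  generalize hA : TimelineDP.maxExpo = A at ht
  obtain ⟨p, hp⟩ : ∃ p, p = 4 * (n + T + 1) := ⟨_, rfl⟩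
  have hp4 : 4 ≤ p := by omega
  have hpA : 1 ≤ p ^ A := Nat.pow_pos (by omega)
  have hM : 1 ≤ (k + 1) * (ℓ + 2) := Nat.mul_pos (by omega) (by omega)
  set R := ((k + 1) * (ℓ + 2)) ^ (4 * G.vimw (ℓ + 2)) with hR
  have hR1 : 1 ≤ R := Nat.pow_pos hM
  have ht' : t = R * (p ^ A * p ^ 6) := by
    rw [ht, ← pow_add, hp, mul_pow]
    ring
  have h1 : p ^ A * p ^ 6 ≤ t := ht' ▸ Nat.le_mul_of_pos_left _ hR1
  have h2 : p ^ 6 ≤ t := (Nat.le_mul_of_pos_left _ hpA).trans h1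
  have h3 : p ^ 6 = p * p * (p * p * p * p) := by ring
  have h4 : 256 ≤ p * p * p * p := by
    calc 256 = 4 * 4 * 4 * 4 := by norm_num
      _ ≤ p * p * p * p := by gcongr
  have hpp : p * 4 ≤ p * p := Nat.mul_le_mul_left _ hp4
  have h5 : p * p * 256 ≤ t := (Nat.mul_le_mul_left _ h4).trans (h3 ▸ h2)
  have hTT : T * T ≤ p * p := Nat.mul_le_mul (by omega) (by omega)
  have h6 : p * 1024 ≤ p ^ 6 := by
    have h7 : p * p * 256 ≤ p ^ 6 := h3 ▸ Nat.mul_le_mul_left (p * p) h4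
    linarith
  by_cases hle : T ≤ k * (ℓ + 1)
  -- Here `k` and `ℓ` need not be bounded in terms of `t`; reading them is covered by the summand `k
  -- + ℓ` of the word bound.
  · exact ⟨true, TimelineDP.haltsWithin_of_le G k ℓ (by omega) (by omega) (by omega) (by omega)
      (by omega) (by omega) (Or.inr (Or.inr hle)) (by omega),
      by simpa using TimelineDP.timelineDS_of_le G k ℓ hle⟩
  have hkT : k < T := by nlinarith
  have hℓT : ℓ < T := by nlinarith
  set N := (TimelineDP.ofGraph G k ℓ).states with hN
  -- There are at most `2 * vimw (ℓ + 2)` slots, and squaring doubles the exponent.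
  have hNR : N * N ≤ R := by
    have : N ≤ ((k + 1) * (ℓ + 2)) ^ (2 * G.vimw (ℓ + 2)) :=
      Nat.pow_le_pow_right hM (TimelineDP.slots_le_vimw G k ℓ)
    refine (Nat.mul_le_mul this this).trans (le_of_eq ?_)
    rw [hR, ← pow_add, ← two_mul, ← mul_assoc]
    norm_num
  have hN1 : 1 ≤ N := TimelineDP.states_pos
  have hbig : N * N * (p ^ A * (p * 1024)) ≤ t := by
    rewrite [ht']
    exact Nat.mul_le_mul hNR (Nat.mul_le_mul_left (p ^ A) h6)
  have hone : 1 ≤ N * N * (p ^ A * p) := Nat.mul_pos (Nat.mul_pos hN1 hN1)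
    (Nat.mul_pos hpA (by omega))
  have hbig' : N * N * (p ^ A * (p * 1024)) = 1024 * (N * N * (p ^ A * p)) := by ring
  refine TimelineDP.haltsWithin_of_lt G k ℓ hk1 hkT hℓT (not_le.1 hle) hp ?_ (by omega)
    (by omega) ?_
  · rewrite [hA, ← hN]
    have : p ^ A * N ≤ N * N * (p ^ A * p) := by
      calc p ^ A * N = N * 1 * (p ^ A * 1) := by ring
        _ ≤ N * N * (p ^ A * p) := by gcongr; omega
    generalize N * N * (p ^ A * p) = X at this hbig hbig' hone
    omega
  · rewrite [hA, ← hN]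
    have : p * N * (p ^ A * N) = N * N * (p ^ A * p) := by ring
    rewrite [this]
    omega
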